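/- **Setting.** Nets are indexed by $\varepsilon\in(0,1]$. A net $(r_\varepsilon)_\varepsilon$ of numbers is *moderate* if $|r_\varepsilon|=O(\varepsilon^{-N})$ as $\varepsilon\to0$ for some $N\in\mathbb N$, and *negligible* if $|r_\varepsilon|=O(\varepsilon^{q})$ for all $q\in\mathbb N$. The rings $\widetilde{\mathbb C}$, $\widetilde{\mathbb R}$ of generalized numbers are the moderate nets in $\mathbb C$, $\mathbb R$ modulo the negligible ones; $\widetilde{\mathbb C}$ carries the topology of $|z|_{\rm e}=e^{-\mathrm{v}(z)}$, $\mathrm{v}([(z_\varepsilon)_\varepsilon])=\sup\{b\in\mathbb R: |z_\varepsilon|=O(\varepsilon^b)\}$. For compact $K\subset\mathbb R^n$ and $j\in\mathbb N$ let $p_{K,j}(f)=\sup_{x\in K,|\alpha|\le j}|\partial^\alpha f(x)|$. The $\widetilde{\mathbb C}$-module $\mathcal G_c(\mathbb R^n)$ consists of the nets $(u_\varepsilon)_\varepsilon$ in $C_c^\infty(\mathbb R^n)$ with supports in a common compact set and with $(p_{K,j}(u_\varepsilon))_\varepsilon$ moderate for all $K,j$, modulo those for which $(p_{K,j}(u_\varepsilon))_\varepsilon$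 is negligible for all $K,j$. The support of $u\in\mathcal G_c(\mathbb R^n)$ is the complement of the largest open set on whose compact subsets all derivatives of $u$ are negligible; $\mathcal G_K$ is the set of $u\in\mathcal G_c(\mathbb R^n)$ with support in $K$, with the topology of the ultra-pseudo-seminorms $e^{-\mathrm v_{K',j}(u)}$, $\mathrm v_{K',j}(u)=\sup\{b: p_{K',j}(u_\varepsilon)=O(\varepsilon^b)\}$, $K'$ compact with $K$ in its interior; and $\mathcal G_c(\mathbb R^n)$ carries the inductive limit topology, that is, the finest locally convex $\widetilde{\mathbb C}$-linear topology for which all inclusions $\mathcal G_K\to\mathcal G_c(\mathbb R^n)$ are continuous. Here a $\widetilde{\mathbb C}$-linear topology is locally convex if $0$ has a base of neighbourhoods $A$ with $A+A\subseteq A$ and $[(\varepsilon^b)_\varepsilon]A\subseteq A$ for all $b\ge0$. $\mathcal L(\mathcal G_c(\mathbb R^n),\widetilde{\mathbb C})$ is the space of continuous $\widetilde{\mathbb C}$-linear functionals. A functional $T\in\mathcal L(\mathcal G_c(\mathbb R^n),\widetilde{\mathbb C})$ is *given by* a net $(T_\varepsilon)_\varepsilon$ of distributions on $\mathbb R^n$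 if for each compact $K$ there are $j,N\in\mathbb N$, $c>0$, $\eta\in(0,1]$ with $|T_\varepsilon(f)|\le c\,\varepsilon^{-N}p_{K,j}(f)$ for all $f\in C^\infty_c(\mathbb R^n)$ supported in $K$ and all $\varepsilon\in(0,\eta]$, and $T(u)=[(T_\varepsilon(u_\varepsilon))_\varepsilon]$ for all $u=[(u_\varepsilon)_\varepsilon]$; it is *basic* if it is given by some such net. Let $\iota_d(\delta)(u)=[(u_\varepsilon(0))_\varepsilon]$. Let $P(D)=\sum_{|\alpha|\le m}a_\alpha D^\alpha$, $D=-i\partial$, with $a_\alpha\in\widetilde{\mathbb C}$. It acts by $(P(D)T)(u)=T(\sum_\alpha(-1)^{|\alpha|}a_\alpha D^\alpha u)$, and $E$ is a *fundamental solution* if $P(D)E=\iota_d(\delta)$. A *representative* of $P$ is a net of polynomials $P_\varepsilon(\xi)=\sum_{|\alpha|\le m}a_{\alpha,\varepsilon}\xi^\alpha$, where $(a_{\alpha,\varepsilon})_\varepsilon$ is a representative of $a_\alpha$. Put $\widetilde P(\xi)=\bigl(\sum_{|\alpha|\le m}|\partial^\alpha P(\xi)|^2\bigr)^{1/2}\in\widetilde{\mathbb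 R}$ for $\xi\in\mathbb R^n$, and likewise $\widetilde{P_\varepsilon}(\xi)\in\mathbb R$. For $k:\mathbb R^n\to[0,\infty)$ continuous, $B_{\infty,k}(\mathbb R^n)$ is the set of tempered distributions $w$ whose Fourier transform $\widehat w$ (with kernel $e^{-ix\xi}$) is a locally integrable function with $\|w\|_{\infty,k}=(2\pi)^{-n}\|k\widehat w\|_{L^\infty}<\infty$. **Theorem.** Let $n,m\in\mathbb N$. (1) For every $P(D)=\sum_{|\alpha|\le m}a_\alpha D^\alpha$ with coefficients in $\widetilde{\mathbb C}$ such that $\widetilde P(\xi_0)$ is invertible in $\widetilde{\mathbb R}$ for some $\xi_0\in\mathbb R^n$, there is a fundamental solution $E\in\mathcal L(\mathcal G_c(\mathbb R^n),\widetilde{\mathbb C})$ of $P(D)$ which is basic. (2) For every $c>0$ there is a constant $C_0$, depending only on $n$, $m$ and $c$, such that for every $P(D)$ as in (1) and every representative $(P_\varepsilon)_\varepsilon$ of $P$ there is a fundamental solution $E\in\mathcal L(\mathcal G_c(\mathbb R^n),\widetilde{\mathbb C})$ of $P(D)$ given by a net of distributions $(E_\varepsilon)_\varepsilon$ such that, for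 all $\varepsilon\in(0,1]$, $E_\varepsilon/\cosh(c|x|)\in B_{\infty,\widetilde{P_\varepsilon}}(\mathbb R^n)$ and $$\Bigl\|\frac{E_\varepsilon}{\cosh(c|x|)}\Bigr\|_{\infty,\widetilde{P_\varepsilon}}\le C_0 .$$ -/

import Mathlib

open Filter Topology Asymptotics MeasureTheory TopologicalSpace
open scoped ContDiff ENNReal SchwartzMap FourierTransform

noncomputable section

namespace Colombeau

/-! ### Nets indexed by `(0,1]` and generalized numbers -/

/-- The index set `(0,1]`. -/
abbrev Idx : Type := Set.Ioc (0 : ℝ) 1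

/-- The filter `ε → 0` on `(0,1]`. -/
def near0 : Filter Idx := comap Subtype.val (𝓝 (0 : ℝ))

/-- `r_ε = O(ε^b)` as `ε → 0`. -/
def OPow (r : Idx → ℝ) (b : ℝ) : Prop := r =O[near0] fun ε => (ε : ℝ) ^ b

theorem OPow.add {r s : Idx → ℝ} {b : ℝ} (hr : OPow r b) (hs : OPow s b) :
    OPow (fun ε => r ε + s ε) b :=
  IsBigO.add hr hs

theorem OPow.mul {r s : Idx → ℝ} {a b : ℝ} (hr : OPow r a) (hs : OPow s b) :
    OPow (fun ε => r ε * s ε) (a + b) := by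
  refine (IsBigO.mul hr hs).congr_right fun ε => ?_
  rw [Real.rpow_add ε.2.1]

theorem OPow.anti {r : Idx → ℝ} {a b : ℝ} (hr : OPow r a) (h : b ≤ a) : OPow r b := by
  refine IsBigO.trans hr (IsBigO.of_bound 1 (Eventually.of_forall fun ε => ?_))
  have h0 := ε.2.1
  rw [Real.norm_of_nonneg (Real.rpow_nonneg h0.le _),
    Real.norm_of_nonneg (Real.rpow_nonneg h0.le _), one_mul]
  exact Real.rpow_le_rpow_of_exponent_ge h0 ε.2.2 h

theorem OPow.mono {r s : Idx → ℝ} {b : ℝ} (hs : OPow s b)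
    (h : ∀ᶠ ε in near0, |r ε| ≤ |s ε|) : OPow r b :=
  IsBigO.trans (IsBigO.of_bound 1 (by simpa using h)) hs

theorem OPow.const_mul {r : Idx → ℝ} {b : ℝ} (c : ℝ) (h : OPow r b) :
    OPow (fun ε => c * r ε) b := IsBigO.const_mul_left h c

theorem OPow.zero (b : ℝ) : OPow (fun _ => 0) b := isBigO_zero _ _

theorem OPow.const (c : ℝ) : OPow (fun _ => c) 0 := by
  simpa [OPow] using isBigO_const_const c (one_ne_zero (α := ℝ)) near0

/-- The growth condition of moderate nets: `r_ε = O(ε^{-N})` for some `N`. -/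
def Moderate (r : Idx → ℝ) : Prop := ∃ N : ℕ, OPow r (-(N : ℝ))

/-- The decay condition of negligible nets: `r_ε = O(ε^q)` for all `q`. -/
def Negligible (r : Idx → ℝ) : Prop := ∀ q : ℕ, OPow r (q : ℝ)

theorem Moderate.add {r s : Idx → ℝ} (hr : Moderate r) (hs : Moderate s) :
    Moderate (fun ε => r ε + s ε) := by
  obtain ⟨N, hN⟩ := hr
  obtain ⟨M, hM⟩ := hs
  refine ⟨N + M, OPow.add (hN.anti ?_) (hM.anti ?_)⟩ <;> push_cast <;>
    linarith [N.cast_nonneg (α := ℝ), M.cast_nonneg (α := ℝ)]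

theorem Moderate.mul {r s : Idx → ℝ} (hr : Moderate r) (hs : Moderate s) :
    Moderate (fun ε => r ε * s ε) := by
  obtain ⟨N, hN⟩ := hr
  obtain ⟨M, hM⟩ := hs
  refine ⟨N + M, (hN.mul hM).anti ?_⟩
  push_cast
  linarith

theorem Moderate.mono {r s : Idx → ℝ} (hs : Moderate s)
    (h : ∀ᶠ ε in near0, |r ε| ≤ |s ε|) : Moderate r :=
  hs.imp fun _ hN => hN.mono h

theorem Moderate.const (c : ℝ) : Moderate (fun _ => c) := ⟨0, by simpa using OPow.const c⟩

theorem Negligible.add {r s : Idx → ℝ} (hr : Negligible r) (hs : Negligible s) :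
    Negligible (fun ε => r ε + s ε) := fun q => (hr q).add (hs q)

theorem Negligible.mono {r s : Idx → ℝ} (hs : Negligible s)
    (h : ∀ᶠ ε in near0, |r ε| ≤ |s ε|) : Negligible r := fun q => (hs q).mono h

theorem Negligible.zero : Negligible (fun _ => 0) := fun q => OPow.zero q

theorem Moderate.mul_negligible {r s : Idx → ℝ} (hr : Moderate r) (hs : Negligible s) :
    Negligible (fun ε => r ε * s ε) := by
  obtain ⟨N, hN⟩ := hr
  intro q
  refine (hN.mul (hs (N + q))).anti ?_
  push_cast
  linarith

/-- The ring `𝓔_M` of moderate nets of numbers. -/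
def ModNet (𝕜 : Type) [NormedField 𝕜] : Subring (Idx → 𝕜) where
  carrier := {r | Moderate fun ε => ‖r ε‖}
  mul_mem' {a b} ha hb := by
    have := Moderate.mul (r := fun ε => ‖a ε‖) (s := fun ε => ‖b ε‖) ha hb
    simpa using this
  one_mem' := by simpa using Moderate.const 1
  add_mem' {a b} ha hb :=
    (Moderate.add (r := fun ε => ‖a ε‖) (s := fun ε => ‖b ε‖) ha hb).mono
      (Eventually.of_forall fun ε => by
        rw [abs_of_nonneg (norm_nonneg _), abs_of_nonneg (by positivity)]
        exact norm_add_le _ _)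
  zero_mem' := by simpa using Moderate.const 0
  neg_mem' {a} ha := by simpa using ha

/-- The ideal `𝓝` of negligible nets of numbers. -/
def NegNet (𝕜 : Type) [NormedField 𝕜] : Ideal (ModNet 𝕜) where
  carrier := {r | Negligible fun ε => ‖(r : Idx → 𝕜) ε‖}
  add_mem' {a b} ha hb :=
    (Negligible.add ha hb).mono
      (Eventually.of_forall fun ε => by
        rw [abs_of_nonneg (norm_nonneg _), abs_of_nonneg (by positivity)]
        exact norm_add_le _ _)
  zero_mem' := by simpa using Negligible.zero
  smul_mem' a b hb := by
    have := Moderate.mul_negligible a.2 hb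
    simpa using this

/-- The ring of generalized numbers over `𝕜`, moderate nets modulo negligible nets;
`GenNum ℂ` is `ℂ~` and `GenNum ℝ` is `ℝ~`. -/
def GenNum (𝕜 : Type) [NormedField 𝕜] : Type := ModNet 𝕜 ⧸ NegNet 𝕜

instance (𝕜 : Type) [NormedField 𝕜] : CommRing (GenNum 𝕜) :=
  inferInstanceAs (CommRing (ModNet 𝕜 ⧸ NegNet 𝕜))

namespace GenNum

variable {𝕜 : Type} [NormedField 𝕜]

/-- The class of a moderate net. -/
def mk : ModNet 𝕜 →+* GenNum 𝕜 := Ideal.Quotient.mk (NegNet 𝕜)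

theorem mk_surjective : Function.Surjective (mk : ModNet 𝕜 → GenNum 𝕜) :=
  Ideal.Quotient.mk_surjective

theorem mk_eq_mk {r s : ModNet 𝕜} :
    mk r = mk s ↔ Negligible fun ε => ‖(r : Idx → 𝕜) ε - (s : Idx → 𝕜) ε‖ :=
  Ideal.Quotient.mk_eq_mk_iff_sub_mem _ _

/-- The net `r` is moderate and its class is `z`. -/
def IsRep (r : Idx → 𝕜) (z : GenNum 𝕜) : Prop := ∃ h : r ∈ ModNet 𝕜, mk ⟨r, h⟩ = z

/-- The embedding of the numbers as constant nets. -/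
def const : 𝕜 →+* GenNum 𝕜 :=
  mk.comp ((Pi.constRingHom Idx 𝕜).codRestrict (ModNet 𝕜) fun c => Moderate.const ‖c‖)

/-- The absolute value `|[(z_ε)]| = [(|z_ε|)]`. -/
def abs : GenNum 𝕜 → GenNum ℝ :=
  Quotient.lift
    (fun r : ModNet 𝕜 => mk (𝕜 := ℝ) ⟨fun ε => ‖(r : Idx → 𝕜) ε‖, by
      have h : Moderate fun ε => ‖(r : Idx → 𝕜) ε‖ := r.2
      change Moderate fun ε => ‖‖(r : Idx → 𝕜) ε‖‖
      simpa only [norm_norm] using h⟩)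
    (by
      intro r s h
      have h' : mk r = mk s := Quotient.sound h
      rw [mk_eq_mk] at h' ⊢
      refine h'.mono (Eventually.of_forall fun ε => ?_)
      simp only [abs_norm]
      exact abs_norm_sub_norm_le _ _)

/-- The square root `√[(r_ε)] = [(√r_ε)]`, meant for `r ≥ 0`. -/
def sqrt : GenNum ℝ → GenNum ℝ :=
  Quotient.lift
    (fun r : ModNet ℝ => mk (𝕜 := ℝ) ⟨fun ε => √((r : Idx → ℝ) ε), by
      have h : Moderate fun ε => ‖(r : Idx → ℝ) ε‖ := r.2
      refine ((Moderate.const 1).add h).mono (Eventually.of_forall fun ε => ?_)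
      rw [abs_of_nonneg (norm_nonneg _), Real.norm_of_nonneg (Real.sqrt_nonneg _),
        abs_of_nonneg (by positivity), Real.norm_eq_abs]
      refine Real.sqrt_le_iff.2 ⟨by positivity, ?_⟩
      nlinarith [le_abs_self ((r : Idx → ℝ) ε), abs_nonneg ((r : Idx → ℝ) ε)]⟩)
    (by
      intro r s h
      have h' : mk r = mk s := Quotient.sound h
      rw [mk_eq_mk] at h' ⊢
      intro q
      obtain ⟨c, hc⟩ := (h' (2 * q)).bound
      refine IsBigO.of_bound (√c) ?_
      filter_upwards [hc] with ε hε
      have h0 := ε.2.1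
      have key : ∀ a b : ℝ, |√a - √b| ≤ √|a - b| := by
        have aux : ∀ a b : ℝ, √a - √b ≤ √|a - b| := by
          intro a b
          have h1 : a ≤ b + |a - b| := by linarith [le_abs_self (a - b)]
          have h2 : √a ≤ √b + √|a - b| := by
            refine Real.sqrt_le_iff.2 ⟨by positivity, ?_⟩
            have hb : b ≤ √b ^ 2 := by
              rcases le_total 0 b with hb | hb
              · rw [Real.sq_sqrt hb]
              · exact hb.trans (sq_nonneg _)
            nlinarith [Real.sq_sqrt (abs_nonneg (a - b)), Real.sqrt_nonneg b,
              Real.sqrt_nonneg |a - b|, mul_nonneg (Real.sqrt_nonneg b)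
              (Real.sqrt_nonneg |a - b|)]
          linarith
        intro a b
        rw [abs_le]
        refine ⟨?_, aux a b⟩
        have := aux b a
        rw [abs_sub_comm] at this
        linarith
      rw [norm_norm] at hε ⊢
      rw [Real.norm_eq_abs] at hε ⊢
      refine (key _ _).trans ?_
      have e : ‖(ε : ℝ) ^ (q : ℝ)‖ = √‖(ε : ℝ) ^ ((2 * q : ℕ) : ℝ)‖ := by
        rw [Real.norm_of_nonneg (Real.rpow_nonneg h0.le _),
          Real.norm_of_nonneg (Real.rpow_nonneg h0.le _), Real.rpow_natCast, Real.rpow_natCast,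
          mul_comm, pow_mul, Real.sqrt_sq (by positivity)]
      rw [e, ← Real.sqrt_mul' _ (norm_nonneg _)]
      exact Real.sqrt_le_sqrt hε)

/-- The valuation `sup {b : |z_ε| = O(ε^b)}` of a generalized number. -/
def val (z : GenNum 𝕜) : EReal :=
  sSup {b | ∃ (a : ℝ) (r : ModNet 𝕜), mk r = z ∧ OPow (fun ε => ‖(r : Idx → 𝕜) ε‖) a ∧ b = a}

/-- The ultra-pseudo-norm `|z|_e = exp (-val z)`. -/
def ultraNorm (z : GenNum 𝕜) : ℝ≥0∞ := EReal.exp (-val z)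

/-- The topology given by the ultra-pseudo-norm. -/
instance : TopologicalSpace (GenNum 𝕜) :=
  generateFrom {S | ∃ (z : GenNum 𝕜) (r : ℝ≥0∞), 0 < r ∧ S = {w | ultraNorm (w - z) < r}}

/-- The class of the net `(ε^b)_ε`. -/
def epsPow (b : ℝ) : GenNum ℂ :=
  mk ⟨fun ε => (((ε : ℝ) ^ b : ℝ) : ℂ), by
    refine ⟨⌈-b⌉₊, ?_⟩
    have : OPow (fun ε : Idx => ‖(((ε : ℝ) ^ b : ℝ) : ℂ)‖) b := by
      simp only [Complex.norm_real]
      exact (isBigO_refl _ _).norm_left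
    exact this.anti (by linarith [Nat.le_ceil (-b)])⟩

end GenNum

/-! ### Test functions, distributions and the seminorms `p_{K,j}` -/

/-- Euclidean space `ℝⁿ`. -/
abbrev Sp (n : ℕ) : Type := EuclideanSpace ℝ (Fin n)

/-- The space `C^∞_c(ℝⁿ)` of complex-valued test functions with its usual topology. -/
abbrev Test (n : ℕ) : Type := TestFunction (⊤ : Opens (Sp n)) ℂ ⊤

/-- The space `𝓓'(ℝⁿ)` of distributions. -/
abbrev Distr (n : ℕ) : Type := Test n →L[ℂ] ℂ

variable {n : ℕ}

/-- The partial derivative `∂_i` on test functions. -/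
def partialD (i : Fin n) : Module.End ℂ (Test n) :=
  (TestFunction.lineDerivCLM ℂ (EuclideanSpace.single i (1 : ℝ)) : Test n →L[ℂ] Test n)

theorem partialD_apply (i : Fin n) (f : Test n) (x : Sp n) :
    partialD i f x = lineDeriv ℝ f x (EuclideanSpace.single i (1 : ℝ)) :=
  TestFunction.lineDerivCLM_apply_of_le (by simp)

/-- The partial derivative `∂_{i₁} ⋯ ∂_{i_k}` for a word `i₁ … i_k`. As partial derivatives of test
functions commute, the operators `wordD w` with `w` of length at most `j` are exactly the
`∂^α` with `|α| ≤ j`. -/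
def wordD (w : List (Fin n)) : Module.End ℂ (Test n) := (w.map partialD).prod

/-- `p_{K,j}(f) = sup {|∂^α f(x)| : x ∈ K, |α| ≤ j}`. -/
def semi (K : Set (Sp n)) (j : ℕ) (f : Test n) : ℝ :=
  sSup {r | ∃ w : List (Fin n), w.length ≤ j ∧ ∃ x ∈ K, r = ‖wordD w f x‖}

theorem semi_bdd (K : Set (Sp n)) (j : ℕ) (f : Test n) :
    BddAbove {r | ∃ w : List (Fin n), w.length ≤ j ∧ ∃ x ∈ K, r = ‖wordD w f x‖} := by
  have h : BddAbove (⋃ w ∈ {w : List (Fin n) | w.length ≤ j},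
      Set.range fun x => ‖wordD w f x‖) := by
    refine (List.finite_length_le (Fin n) j).bddAbove_biUnion.2 fun w _ => ?_
    obtain ⟨C, hC⟩ := (wordD w f).continuous.bounded_above_of_compact_support
      (wordD w f).hasCompactSupport
    exact ⟨C, by rintro _ ⟨x, rfl⟩; exact hC x⟩
  refine h.mono ?_
  rintro _ ⟨w, hw, x, -, rfl⟩
  exact Set.mem_biUnion hw ⟨x, rfl⟩

theorem le_semi {K : Set (Sp n)} {j : ℕ} (f : Test n) {w : List (Fin n)} (hw : w.length ≤ j)
    {x : Sp n} (hx : x ∈ K) : ‖wordD w f x‖ ≤ semi K j f :=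
  le_csSup (semi_bdd K j f) ⟨w, hw, x, hx, rfl⟩

theorem semi_nonneg (K : Set (Sp n)) (j : ℕ) (f : Test n) : 0 ≤ semi K j f :=
  Real.sSup_nonneg (by rintro _ ⟨w, -, x, -, rfl⟩; exact norm_nonneg _)

theorem semi_le {K : Set (Sp n)} {j : ℕ} {f : Test n} {C : ℝ} (hC : 0 ≤ C)
    (h : ∀ w : List (Fin n), w.length ≤ j → ∀ x ∈ K, ‖wordD w f x‖ ≤ C) : semi K j f ≤ C :=
  Real.sSup_le (by rintro _ ⟨w, hw, x, hx, rfl⟩; exact h w hw x hx) hC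

theorem semi_add_le (K : Set (Sp n)) (j : ℕ) (f g : Test n) :
    semi K j (f + g) ≤ semi K j f + semi K j g :=
  semi_le (add_nonneg (semi_nonneg _ _ _) (semi_nonneg _ _ _)) fun w hw x hx => by
    rw [map_add]
    exact (norm_add_le _ _).trans (add_le_add (le_semi f hw hx) (le_semi g hw hx))

theorem semi_smul_le (K : Set (Sp n)) (j : ℕ) (a : ℂ) (f : Test n) :
    semi K j (a • f) ≤ ‖a‖ * semi K j f :=
  semi_le (mul_nonneg (norm_nonneg _) (semi_nonneg _ _ _)) fun w hw x hx => by
    rw [map_smul]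
    change ‖a • (wordD w f x)‖ ≤ _
    rw [norm_smul]
    exact mul_le_mul_of_nonneg_left (le_semi f hw hx) (norm_nonneg _)

theorem semi_partialD_le (K : Set (Sp n)) (j : ℕ) (i : Fin n) (f : Test n) :
    semi K j (partialD i f) ≤ semi K (j + 1) f :=
  semi_le (semi_nonneg _ _ _) fun w hw x hx => by
    have : wordD w (partialD i f) = wordD (w ++ [i]) f := by
      simp [wordD, Module.End.mul_apply]
    rw [this]
    exact le_semi f (by simpa using hw) hx

theorem tsupport_partialD (i : Fin n) (f : Test n) :
    tsupport (partialD i f) ⊆ tsupport f := by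
  refine closure_minimal (fun x hx => ?_) (isClosed_tsupport _)
  by_contra h
  refine hx ?_
  rw [partialD_apply]
  have h0 : (f : Sp n → ℂ) =ᶠ[𝓝 x] fun _ => 0 := notMem_tsupport_iff_eventuallyEq.1 h
  rw [h0.lineDeriv_eq]
  simp [lineDeriv]

/-! ### The Colombeau algebra `𝓖_c(ℝⁿ)` -/

/-- Moderate nets of smooth functions whose supports lie in a common compact set. -/
def EcM (n : ℕ) : Submodule (ModNet ℂ) (Idx → Test n) where
  carrier := {f | (∃ K : Set (Sp n), IsCompact K ∧ ∀ ε, tsupport (f ε) ⊆ K) ∧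
    ∀ K : Set (Sp n), IsCompact K → ∀ j, Moderate fun ε => semi K j (f ε)}
  add_mem' := by
    rintro f g ⟨⟨K, hK, hf⟩, hf'⟩ ⟨⟨L, hL, hg⟩, hg'⟩
    refine ⟨⟨K ∪ L, hK.union hL, fun ε => ?_⟩, fun M hM j => ?_⟩
    · exact (tsupport_add (f ε) (g ε)).trans (Set.union_subset_union (hf ε) (hg ε))
    · refine ((hf' M hM j).add (hg' M hM j)).mono (Eventually.of_forall fun ε => ?_)
      rw [abs_of_nonneg (semi_nonneg _ _ _),
        abs_of_nonneg (add_nonneg (semi_nonneg _ _ _) (semi_nonneg _ _ _))]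
      exact semi_add_le _ _ _ _
  zero_mem' := by
    refine ⟨⟨∅, isCompact_empty, fun ε => ?_⟩, fun M hM j => ?_⟩
    · change tsupport (fun _ : Sp n => (0 : ℂ)) ⊆ ∅
      simp
    · refine (Moderate.const 0).mono (Eventually.of_forall fun ε => ?_)
      rw [abs_of_nonneg (semi_nonneg _ _ _), abs_zero]
      refine semi_le le_rfl fun w _ x _ => ?_
      rw [Pi.zero_apply, map_zero]
      simp
  smul_mem' := by
    rintro r f ⟨⟨K, hK, hf⟩, hf'⟩
    refine ⟨⟨K, hK, fun ε => ?_⟩, fun M hM j => ?_⟩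
    · exact (tsupport_smul_subset_right (fun _ : Sp n => (r : Idx → ℂ) ε) (f ε)).trans (hf ε)
    · refine (Moderate.mul r.2 (hf' M hM j)).mono (Eventually.of_forall fun ε => ?_)
      rw [abs_of_nonneg (semi_nonneg _ _ _),
        abs_of_nonneg (mul_nonneg (norm_nonneg _) (semi_nonneg _ _ _))]
      exact semi_smul_le _ _ _ _

instance : Module (ModNet ℂ) (EcM n) := Submodule.module _

instance : SMul (ModNet ℂ) (EcM n) := (Submodule.module (EcM n)).toSMul

/-- The negligible nets among them. -/
def Nc (n : ℕ) : Submodule (ModNet ℂ) (EcM n) where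
  carrier := {f | ∀ K : Set (Sp n), IsCompact K → ∀ j,
    Negligible fun ε => semi K j ((f : Idx → Test n) ε)}
  add_mem' := by
    rintro f g hf hg M hM j
    refine ((hf M hM j).add (hg M hM j)).mono (Eventually.of_forall fun ε => ?_)
    rw [abs_of_nonneg (semi_nonneg _ _ _),
      abs_of_nonneg (add_nonneg (semi_nonneg _ _ _) (semi_nonneg _ _ _))]
    exact semi_add_le _ _ _ _
  zero_mem' := by
    intro M hM j
    refine Negligible.zero.mono (Eventually.of_forall fun ε => ?_)
    rw [abs_of_nonneg (semi_nonneg _ _ _), abs_zero]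
    refine semi_le le_rfl fun w _ x _ => ?_
    rw [ZeroMemClass.coe_zero, Pi.zero_apply, map_zero]
    simp
  smul_mem' := by
    rintro r f hf M hM j
    refine (Moderate.mul_negligible r.2 (hf M hM j)).mono (Eventually.of_forall fun ε => ?_)
    rw [abs_of_nonneg (semi_nonneg _ _ _),
      abs_of_nonneg (mul_nonneg (norm_nonneg _) (semi_nonneg _ _ _))]
    exact semi_smul_le _ _ _ _

/-- The Colombeau algebra `𝓖_c(ℝⁿ)` of compactly supported generalized functions, as a
`ℂ~`-module. (Multiplying a representative by a cut-off function, one sees that every generalized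
function with compact support is represented by a net with supports in a common compact set.) -/
def Gc (n : ℕ) : Type := EcM n ⧸ Nc n

instance : AddCommGroup (Gc n) := inferInstanceAs (AddCommGroup (EcM n ⧸ Nc n))

theorem Nc_torsion (n : ℕ) :
    Module.IsTorsionBySet (ModNet ℂ) (EcM n ⧸ Nc n) (NegNet ℂ : Set (ModNet ℂ)) := by
  rintro u ⟨r, hr⟩
  obtain ⟨f, rfl⟩ := Submodule.Quotient.mk_surjective _ u
  change r • Submodule.Quotient.mk f = 0
  rw [← Submodule.Quotient.mk_smul, Submodule.Quotient.mk_eq_zero]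
  intro M hM j
  refine (Moderate.mul_negligible (f.2.2 M hM j) hr).mono (Eventually.of_forall fun ε => ?_)
  rw [abs_of_nonneg (semi_nonneg _ _ _),
    abs_of_nonneg (mul_nonneg (semi_nonneg _ _ _) (norm_nonneg _)), mul_comm]
  exact semi_smul_le _ _ _ _

/-- The `ℂ~`-module structure: `[(r_ε)] • [(f_ε)] = [(r_ε f_ε)]`. -/
instance : Module (GenNum ℂ) (Gc n) := (Nc_torsion n).module

namespace Gc

/-- The class of a net. -/
def mk (f : EcM n) : Gc n := Submodule.Quotient.mk f

theorem mk_surjective : Function.Surjective (mk : EcM n → Gc n) :=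
  Submodule.Quotient.mk_surjective _

theorem mk_add (f g : EcM n) : mk (f + g) = mk f + mk g := rfl

theorem mk_smul (r : ModNet ℂ) (f : EcM n) : mk (r • f) = GenNum.mk r • mk f := rfl

theorem mk_eq_mk {f g : EcM n} : mk f = mk g ↔ f - g ∈ Nc n := Submodule.Quotient.eq _

/-- The support of `u`: the complement of the largest open set on which `u` vanishes, that is, on
whose compact subsets all derivatives of a representative are negligible. -/
def supp (u : Gc n) : Set (Sp n) :=
  (⋃₀ {V | IsOpen V ∧ ∃ f : EcM n, mk f = u ∧ ∀ K ⊆ V, IsCompact K →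
    ∀ j, Negligible fun ε => semi K j ((f : Idx → Test n) ε)})ᶜ

/-- The valuation `val_{p_{K,j}}(u) = sup {b : p_{K,j}(u_ε) = O(ε^b)}`. -/
def val (K : Set (Sp n)) (j : ℕ) (u : Gc n) : EReal :=
  sSup {b | ∃ (a : ℝ) (f : EcM n), mk f = u ∧
    OPow (fun ε => semi K j ((f : Idx → Test n) ε)) a ∧ b = a}

/-- The ultra-pseudo-seminorm `exp (-val_{p_{K,j}}(u))`. -/
def ultraSemi (K : Set (Sp n)) (j : ℕ) (u : Gc n) : ℝ≥0∞ := EReal.exp (-val K j u)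

/-- The set `𝓖_K(ℝⁿ)` of the elements of `𝓖_c(ℝⁿ)` with support in `K`. -/
abbrev GK (K : Set (Sp n)) : Type := {u : Gc n // supp u ⊆ K}

/-- The topology of `𝓖_K(ℝⁿ)`, given by the ultra-pseudo-seminorms of `p_{K',j}`, where `K'` is a
compact set containing `K` in its interior. -/
@[reducible]
def topGK (K : Set (Sp n)) : TopologicalSpace (GK K) :=
  generateFrom {S | ∃ (K' : Set (Sp n)) (j : ℕ) (u : GK K) (r : ℝ≥0∞),
    IsCompact K' ∧ K ⊆ interior K' ∧ 0 < r ∧ S = {v : GK K | ultraSemi K' j (v.1 - u.1) < r}}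

end Gc

/-- `ℂ~`-convex subsets of a `ℂ~`-module. -/
def GenConvex {M : Type} [AddCommGroup M] [Module (GenNum ℂ) M] (A : Set M) : Prop :=
  (∀ u ∈ A, ∀ v ∈ A, u + v ∈ A) ∧ ∀ b : ℝ, 0 ≤ b → ∀ u ∈ A, GenNum.epsPow b • u ∈ A

/-- Locally convex `ℂ~`-linear topologies: the module is a topological `ℂ~`-module and `0` has a
base of `ℂ~`-convex neighbourhoods. -/
def IsLocallyConvexTop {M : Type} [AddCommGroup M] [Module (GenNum ℂ) M]
    (t : TopologicalSpace M) : Prop :=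
  @IsTopologicalAddGroup M t _ ∧ @ContinuousSMul (GenNum ℂ) M _ _ t ∧
    ∀ U ∈ @nhds M t 0, ∃ A ∈ @nhds M t 0, A ⊆ U ∧ GenConvex A

/-- The inductive limit topology of `𝓖_c(ℝⁿ)`: the finest locally convex `ℂ~`-linear topology for
which all the inclusions `𝓖_K(ℝⁿ) → 𝓖_c(ℝⁿ)`, `K` compact, are continuous. -/
instance : TopologicalSpace (Gc n) :=
  sInf {t | IsLocallyConvexTop t ∧
    ∀ K : Set (Sp n), IsCompact K → (Gc.topGK K).coinduced Subtype.val ≤ t}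

/-! ### Functionals on `𝓖_c(ℝⁿ)` given by nets of distributions -/

/-- Moderate nets of distributions: for each compact `K` there are `j`, `c`, `N`, `η` with
`|T_ε(f)| ≤ c ε^{-N} p_{K,j}(f)` for all `f ∈ C^∞_K(ℝⁿ)` and `ε ∈ (0,η]`. -/
def ModDistr (T : Idx → Distr n) : Prop :=
  ∀ K : Set (Sp n), IsCompact K → ∃ (j : ℕ) (c : ℝ) (N : ℕ) (η : ℝ), 0 < c ∧ 0 < η ∧ η ≤ 1 ∧
    ∀ f : Test n, tsupport f ⊆ K → ∀ ε : Idx, (ε : ℝ) ≤ η →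
      ‖T ε f‖ ≤ c * (ε : ℝ) ^ (-(N : ℝ)) * semi K j f

theorem eventually_le_near0 {η : ℝ} (h : 0 < η) : ∀ᶠ ε : Idx in near0, (ε : ℝ) ≤ η :=
  (eventually_le_nhds h).comap _

theorem ModDistr.bound {T : Idx → Distr n} (hT : ModDistr T) (f : EcM n) :
    ∃ (K : Set (Sp n)) (j : ℕ) (s : Idx → ℝ), IsCompact K ∧ Moderate s ∧ ∀ᶠ ε in near0,
      ‖T ε ((f : Idx → Test n) ε)‖ ≤ |s ε * semi K j ((f : Idx → Test n) ε)| := by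
  obtain ⟨⟨K, hK, hf⟩, -⟩ := f.2
  obtain ⟨j, c, N, η, hc, hη, -, h⟩ := hT K hK
  refine ⟨K, j, fun ε => c * (ε : ℝ) ^ (-(N : ℝ)), hK,
    ⟨N, OPow.const_mul c (isBigO_refl _ _)⟩, ?_⟩
  filter_upwards [eventually_le_near0 hη] with ε hε
  exact (h _ (hf ε) ε hε).trans (le_abs_self _)

theorem ModDistr.moderate {T : Idx → Distr n} (hT : ModDistr T) (f : EcM n) :
    (fun ε => T ε ((f : Idx → Test n) ε)) ∈ ModNet ℂ := by
  obtain ⟨K, j, s, hK, hs, h⟩ := hT.bound f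
  refine (hs.mul (f.2.2 K hK j)).mono ?_
  simpa only [abs_norm] using h

theorem ModDistr.negligible {T : Idx → Distr n} (hT : ModDistr T) {f : EcM n} (hf : f ∈ Nc n) :
    Negligible fun ε => ‖T ε ((f : Idx → Test n) ε)‖ := by
  obtain ⟨K, j, s, hK, hs, h⟩ := hT.bound f
  refine (hs.mul_negligible (hf K hK j)).mono ?_
  simpa only [abs_norm] using h

/-- The functional `u ↦ [(T_ε(u_ε))_ε]` on `𝓖_c(ℝⁿ)` given by a moderate net of distributions. -/
def ofNet (T : Idx → Distr n) (hT : ModDistr T) : Gc n →ₗ[GenNum ℂ] GenNum ℂ where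
  toFun := Quotient.lift (fun f : EcM n => GenNum.mk ⟨_, hT.moderate f⟩) (by
    intro f g h
    have h' : Gc.mk f = Gc.mk g := Quotient.sound h
    rw [Gc.mk_eq_mk] at h'
    rw [GenNum.mk_eq_mk]
    simpa using hT.negligible h')
  map_add' := by
    intro u v
    obtain ⟨f, rfl⟩ := Gc.mk_surjective u
    obtain ⟨g, rfl⟩ := Gc.mk_surjective v
    change GenNum.mk ⟨_, hT.moderate (f + g)⟩ =
      GenNum.mk ⟨_, hT.moderate f⟩ + GenNum.mk ⟨_, hT.moderate g⟩
    rw [← map_add]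
    congr 1
    ext ε
    simp
  map_smul' := by
    intro z u
    obtain ⟨r, rfl⟩ := GenNum.mk_surjective z
    obtain ⟨f, rfl⟩ := Gc.mk_surjective u
    change GenNum.mk ⟨_, hT.moderate (r • f)⟩ = GenNum.mk r * GenNum.mk ⟨_, hT.moderate f⟩
    rw [← map_mul]
    congr 1
    ext ε
    exact map_smul (T ε) _ _

/-- The continuous functional `T` is given by the net `(T_ε)_ε` of distributions: the net is
moderate and `T u = [(T_ε(u_ε))_ε]` for all `u`. -/
def IsGivenBy (T : Gc n →L[GenNum ℂ] GenNum ℂ) (Tnet : Idx → Distr n) : Prop :=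
  ∃ h : ModDistr Tnet, (T : Gc n →ₗ[GenNum ℂ] GenNum ℂ) = ofNet Tnet h

/-- Basic functionals. -/
def IsBasic (T : Gc n →L[GenNum ℂ] GenNum ℂ) : Prop := ∃ Tnet : Idx → Distr n, IsGivenBy T Tnet

/-- The Dirac distribution `δ`. -/
def dirac (n : ℕ) : Distr n where
  toFun f := f 0
  map_add' _ _ := rfl
  map_smul' _ _ := rfl
  cont := continuous_eval_const _

theorem modDistr_dirac (n : ℕ) : ModDistr fun _ => dirac n := by
  intro K hK
  refine ⟨0, 1, 0, 1, one_pos, one_pos, le_rfl, fun f hf ε _ => ?_⟩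
  simp only [Nat.cast_zero, neg_zero, Real.rpow_zero, one_mul]
  change ‖f 0‖ ≤ _
  by_cases h : (0 : Sp n) ∈ K
  · exact le_semi (w := []) f le_rfl h
  · rw [image_eq_zero_of_notMem_tsupport fun h' => h (hf h'), norm_zero]
    exact semi_nonneg _ _ _

/-- The functional `ι_d(δ) : u ↦ [(δ(u_ε))_ε]`. -/
def iotaDelta (n : ℕ) : Gc n →ₗ[GenNum ℂ] GenNum ℂ := ofNet (fun _ => dirac n) (modDistr_dirac n)

/-! ### Differential operators with generalized constant coefficients -/

/-- `D_i = -i ∂_i` on moderate nets with compact support. -/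
def netD (i : Fin n) : EcM n →ₗ[ModNet ℂ] EcM n where
  toFun f := ⟨fun ε => (-Complex.I) • partialD i ((f : Idx → Test n) ε), by
    obtain ⟨⟨K, hK, hf⟩, hf'⟩ := f.2
    refine ⟨⟨K, hK, fun ε => ?_⟩, fun M hM j => ?_⟩
    · exact (tsupport_smul_subset_right (fun _ : Sp n => -Complex.I) _).trans
        ((tsupport_partialD i _).trans (hf ε))
    · refine (hf' M hM (j + 1)).mono (Eventually.of_forall fun ε => ?_)
      rw [abs_of_nonneg (semi_nonneg _ _ _), abs_of_nonneg (semi_nonneg _ _ _)]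
      refine (semi_smul_le _ _ _ _).trans ?_
      simpa using semi_partialD_le M j i _⟩
  map_add' f g := by
    refine Subtype.ext (funext fun ε => ?_)
    change (-Complex.I) • partialD i ((f : Idx → Test n) ε + (g : Idx → Test n) ε) =
      (-Complex.I) • partialD i ((f : Idx → Test n) ε) +
        (-Complex.I) • partialD i ((g : Idx → Test n) ε)
    rw [map_add, smul_add]
  map_smul' r f := by
    refine Subtype.ext (funext fun ε => ?_)
    change (-Complex.I) • partialD i ((r : Idx → ℂ) ε • (f : Idx → Test n) ε) =
      (r : Idx → ℂ) ε • ((-Complex.I) • partialD i ((f : Idx → Test n) ε))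
    rw [map_smul, smul_comm]

theorem netD_mem_Nc (i : Fin n) {f : EcM n} (hf : f ∈ Nc n) : netD i f ∈ Nc n := by
  intro M hM j
  refine (hf M hM (j + 1)).mono (Eventually.of_forall fun ε => ?_)
  rw [abs_of_nonneg (semi_nonneg _ _ _), abs_of_nonneg (semi_nonneg _ _ _)]
  refine (semi_smul_le _ _ _ _).trans ?_
  simpa using semi_partialD_le M j i _

/-- The map `[(f_ε)] ↦ [(D_i f_ε)]`. -/
def Gc.mapD (i : Fin n) : Gc n → Gc n :=
  Quotient.lift (fun f : EcM n => Gc.mk (netD i f)) (by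
    intro f g h
    have h' : Gc.mk f = Gc.mk g := Quotient.sound h
    rw [Gc.mk_eq_mk] at h' ⊢
    rw [← map_sub]
    exact netD_mem_Nc i h')

theorem Gc.mapD_mk (i : Fin n) (f : EcM n) : Gc.mapD i (Gc.mk f) = Gc.mk (netD i f) := rfl

theorem Gc.mapD_add (i : Fin n) (u v : Gc n) :
    Gc.mapD i (u + v) = Gc.mapD i u + Gc.mapD i v := by
  obtain ⟨f, rfl⟩ := Gc.mk_surjective u
  obtain ⟨g, rfl⟩ := Gc.mk_surjective v
  rw [← Gc.mk_add, Gc.mapD_mk, Gc.mapD_mk, Gc.mapD_mk, ← Gc.mk_add]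
  exact congrArg Gc.mk ((netD i).map_add f g)

theorem Gc.mapD_smul (i : Fin n) (z : GenNum ℂ) (u : Gc n) :
    Gc.mapD i (z • u) = z • Gc.mapD i u := by
  obtain ⟨r, rfl⟩ := GenNum.mk_surjective z
  obtain ⟨f, rfl⟩ := Gc.mk_surjective u
  rw [← Gc.mk_smul, Gc.mapD_mk, Gc.mapD_mk, ← Gc.mk_smul]
  exact congrArg Gc.mk ((netD i).map_smul r f)

/-- `D_i = -i ∂_i` on `𝓖_c(ℝⁿ)`. -/
def Gc.D (i : Fin n) : Module.End (GenNum ℂ) (Gc n) where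
  toFun := Gc.mapD i
  map_add' := Gc.mapD_add i
  map_smul' := Gc.mapD_smul i

/-- `D^α = D_1^{α_1} ⋯ D_n^{α_n}` on `𝓖_c(ℝⁿ)`. -/
def Gc.Dpow (α : Fin n →₀ ℕ) : Module.End (GenNum ℂ) (Gc n) :=
  ((List.finRange n).map fun i => Gc.D i ^ α i).prod

/-- The transpose `ᵗP(D) = ∑_α (-1)^{|α|} a_α D^α` of `P(D) = ∑_α a_α D^α`. -/
def transposeD (P : MvPolynomial (Fin n) (GenNum ℂ)) : Module.End (GenNum ℂ) (Gc n) :=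
  ∑ α ∈ P.support, (P.coeff α * (-1) ^ α.degree) • Gc.Dpow α

/-- The action of `P(D)` on functionals: `(P(D)T)(u) = T(ᵗP(D)u)`. -/
def actD (P : MvPolynomial (Fin n) (GenNum ℂ)) (T : Gc n →ₗ[GenNum ℂ] GenNum ℂ) :
    Gc n →ₗ[GenNum ℂ] GenNum ℂ :=
  T ∘ₗ transposeD P

/-- `E` is a fundamental solution of `P(D)`: `P(D)E = ι_d(δ)`. -/
def IsFundamentalSolution (P : MvPolynomial (Fin n) (GenNum ℂ))
    (E : Gc n →L[GenNum ℂ] GenNum ℂ) : Prop :=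
  actD P E = iotaDelta n

/-- The net `(P_ε)_ε` of polynomials of degree at most `m` is a representative of `P`: its
coefficients are representatives of the coefficients of `P`. -/
def IsRepresentative (m : ℕ) (P : MvPolynomial (Fin n) (GenNum ℂ))
    (Pnet : Idx → MvPolynomial (Fin n) ℂ) : Prop :=
  (∀ ε, (Pnet ε).totalDegree ≤ m) ∧
    ∀ α, GenNum.IsRep (fun ε => (Pnet ε).coeff α) (P.coeff α)

/-- The formal derivative `∂^α P` of a polynomial. -/
def polyD {R : Type} [CommRing R] (α : Fin n → ℕ) (P : MvPolynomial (Fin n) R) :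
    MvPolynomial (Fin n) R :=
  ((List.finRange n).map fun i =>
    ((MvPolynomial.pderiv i).toLinearMap : Module.End R (MvPolynomial (Fin n) R)) ^ α i).prod P

/-- The multi-indices `α` with `|α| ≤ m`. -/
def multiIdx (n m : ℕ) : Finset (Fin n → ℕ) :=
  (Finset.range (m + 1)).biUnion fun k => Finset.piAntidiag Finset.univ k

/-- The generalized weight `P~(ξ) = (∑_{|α| ≤ m} |∂^α P(ξ)|²)^{1/2}` in `ℝ~` of a polynomial of
degree at most `m` with coefficients in `ℂ~`, at a point `ξ` of `ℝⁿ`. -/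
def genWeight (m : ℕ) (P : MvPolynomial (Fin n) (GenNum ℂ)) (ξ : Sp n) : GenNum ℝ :=
  GenNum.sqrt (∑ α ∈ multiIdx n m,
    GenNum.abs (MvPolynomial.eval (fun i => GenNum.const (ξ i : ℂ)) (polyD α P)) ^ 2)

/-- The weight `p~(ξ) = (∑_{|α| ≤ m} |∂^α p(ξ)|²)^{1/2}` of a complex polynomial of degree at
most `m`. -/
def weight (m : ℕ) (p : MvPolynomial (Fin n) ℂ) (ξ : Sp n) : ℝ :=
  √(∑ α ∈ multiIdx n m, ‖MvPolynomial.eval (fun i => (ξ i : ℂ)) (polyD α p)‖ ^ 2)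

/-! ### The spaces `B_{p,k}` and the quotient by `cosh(c|x|)` -/

/-- The Fourier transform `φ^(x) = ∫ e^{-i⟨x,ξ⟩} φ(ξ) dξ` on the Schwartz space. -/
def hat (φ : 𝓢(Sp n, ℂ)) : 𝓢(Sp n, ℂ) :=
  SchwartzMap.compCLMOfContinuousLinearEquiv ℂ
    (ContinuousLinearEquiv.smulLeft (Units.mk0 (2 * Real.pi)⁻¹ (by positivity))) (𝓕 φ)

theorem hat_apply (φ : 𝓢(Sp n, ℂ)) (x : Sp n) :
    hat φ x = ∫ ξ, Complex.exp (-Complex.I * inner ℝ x ξ) * φ ξ := by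
  change (𝓕 φ) ((2 * Real.pi)⁻¹ • x) = _
  rw [SchwartzMap.fourier_coe, Real.fourier_eq']
  congr 1
  ext ξ
  rw [smul_eq_mul, inner_smul_right, real_inner_comm]
  congr 2
  push_cast
  field_simp

/-- The Fourier transform of the tempered distribution `w` is the locally integrable
function `g`. -/
def HasFourierFun (w : 𝓢'(Sp n, ℂ)) (g : Sp n → ℂ) : Prop :=
  LocallyIntegrable g ∧
    ∀ φ : 𝓢(Sp n, ℂ), HasCompactSupport φ → w (hat φ) = ∫ ξ, g ξ * φ ξ

/-- `‖w‖_{p,k} = (2π)^{-n} ‖k w^‖_p`; this is `∞` if `w^` is not a function, and otherwise the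
infimum is over the functions which are almost everywhere equal to `w^`. -/
def normB (p : ℝ≥0∞) (k : Sp n → ℝ) (w : 𝓢'(Sp n, ℂ)) : ℝ≥0∞ :=
  ⨅ (g : Sp n → ℂ) (_ : HasFourierFun w g),
    ENNReal.ofReal (((2 * Real.pi) ^ n)⁻¹) * eLpNorm (fun ξ => (k ξ : ℂ) * g ξ) p

/-- `w ∈ B_{p,k}(ℝⁿ)`. -/
def MemB (p : ℝ≥0∞) (k : Sp n → ℝ) (w : 𝓢'(Sp n, ℂ)) : Prop :=
  (∃ g, HasFourierFun w g) ∧ normB p k w < ⊤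

theorem contDiff_cosh_norm (c : ℝ) :
    ContDiff ℝ ∞ fun x : Sp n => Real.cosh (c * ‖x‖) := by
  set a : ℕ → ℝ := fun k => ((2 * k).factorial : ℝ)⁻¹ with ha
  set p := FormalMultilinearSeries.ofScalars ℝ a with hp
  have hrad : p.radius = ⊤ := by
    refine FormalMultilinearSeries.ofScalars_radius_eq_top_of_tendsto ℝ a
      (Eventually.of_forall fun k => by simp only [ha]; positivity) ?_
    refine squeeze_zero (fun k => by positivity) (fun k => ?_)
      (tendsto_one_div_add_atTop_nhds_zero_nat (𝕜 := ℝ))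
    have h1 : (2 * (k + 1)).factorial = (2 * k + 2) * ((2 * k + 1) * (2 * k).factorial) := by
      rw [show 2 * (k + 1) = 2 * k + 1 + 1 by ring, Nat.factorial_succ, Nat.factorial_succ]
    have h2 : (0 : ℝ) < (2 * k).factorial := by positivity
    simp only [ha, Nat.succ_eq_add_one, h1, norm_inv, Real.norm_natCast]
    push_cast
    rw [div_le_div_iff₀ (by positivity) (by positivity), inv_mul_eq_div, one_mul, div_le_iff₀
      (by positivity)]
    rw [inv_mul_eq_div, le_div_iff₀ h2]
    nlinarith [mul_nonneg h2.le (k.cast_nonneg (α := ℝ)),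
      mul_nonneg (mul_nonneg h2.le (k.cast_nonneg (α := ℝ))) (k.cast_nonneg (α := ℝ))]
  have han : ContDiff ℝ ∞ p.sum := by
    have h := (p.hasFPowerSeriesOnBall (by rw [hrad]; simp)).analyticOnNhd
    rw [hrad, Metric.eball_top] at h
    exact h.contDiff
  have heq : (fun x : Sp n => Real.cosh (c * ‖x‖)) =
      fun x => p.sum (c ^ 2 * ‖x‖ ^ 2) := by
    funext x
    rw [Real.cosh_eq_tsum, hp]
    change _ = FormalMultilinearSeries.ofScalarsSum a (c ^ 2 * ‖x‖ ^ 2)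
    rw [FormalMultilinearSeries.ofScalars_sum_eq]
    refine tsum_congr fun k => ?_
    rw [ha, smul_eq_mul, pow_mul, mul_pow]
    ring
  rw [heq]
  exact han.comp (contDiff_const.mul (contDiff_norm_sq ℝ))

/-- The test function `f / cosh(c|x|)`. -/
def divCosh (c : ℝ) (f : Test n) : Test n where
  toFun x := f x / (Real.cosh (c * ‖x‖) : ℂ)
  contDiff' := by
    have h : ContDiff ℝ ∞ fun x : Sp n => (Real.cosh (c * ‖x‖))⁻¹ • f x :=
      ((contDiff_cosh_norm c).inv fun x => (Real.cosh_pos _).ne').smul f.contDiff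
    convert h using 2 with x
    rw [Complex.real_smul, Complex.ofReal_inv, div_eq_inv_mul]
  hasCompactSupport' := by
    simp_rw [div_eq_mul_inv]
    exact f.hasCompactSupport.mul_right
  tsupport_subset' := Set.subset_univ _

/-- The tempered distribution `w` is the distribution `E / cosh(c|x|) : f ↦ E(f / cosh(c|x|))`. -/
def IsDivCosh (c : ℝ) (E : Distr n) (w : 𝓢'(Sp n, ℂ)) : Prop :=
  ∀ f : Test n, w (f.hasCompactSupport.toSchwartzMap f.contDiff) = E (divCosh c f)

end Colombeau

end

open Colombeau

noncomputable section

namespace Colombeau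

/-! ### The topology of the ring of generalized numbers -/

namespace GenNum

variable {𝕜 : Type} [NormedField 𝕜]

/-! The proof carries out Hörmander's construction of a fundamental solution for a single
polynomial, with constants that depend on the polynomial only through its weight, and applies it to
each `P_ε` separately.

For one `p ≠ 0` of degree at most `m`, put `E(f) = (2π)^{-n} ∫ dξ (1/2π) ∫_0^{2π} f^(-ξ -
e^{it}θ(ξ)) / p(ξ + e^{it}θ(ξ)) dt`, where the circle around each `ξ` avoids the zeros of `p`.
Transposing `p(D)` multiplies the numerator by `p`, which cancels the denominator. The mean value
property replaces the circle average by `f^(-ξ)`, and Fourier inversion leaves `f(0)`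
(`solDistr_transpose`). The choice of circles must be uniform in `p`. The Taylor coefficients of `p`
at `ξ` lie in a fixed finite-dimensional space, so by homogeneity and compactness of its unit sphere
finitely many vectors `θ` of size at most `ρ` suffice, with `|p| ≥ κ p~(ξ)` on the circle and `κ`
depending only on `n`, `m`, `ρ` (`exists_circle_family`, `exists_measurable_circle`).

The weight varies slowly, `p~(η) ≤ C (1 + |ξ - η|)^m p~(ξ)` (`weight_le_mul`), and Fourier-Laplace
transforms decay rapidly in strips. Hence a factor `1/p~(η)` can be pulled out of the integral at
any point `η` (`IsCircleChoice.norm_div_le`). This is used in two ways. At a fixed `ξ₀` where the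
generalized weight is invertible it gives `|E_ε(f)| ≤ C p_{K,m+n+1}(f) / P_ε~(ξ₀)`. Invertible
generalized numbers are bounded below by a power of `ε` (`GenNum.IsRep.exists_lower`), so the net is
moderate. At a variable `η` it bounds the Fourier transform of `E q` with `q = 1/cosh(c|x|)`, which
is the same integral with `f^` replaced by a translate of `q^`; the result is `C₀/p~(η)`. Here `q^`
must extend to a strip with decay, which holds because the derivatives of `q` are `O(e^{-c|x|})`
(`exists_norm_dirD_sechNorm_le`) and the circles satisfy `nρ < c`.

On the generalized side, a moderate net of distributions defines a continuous functional
(`continuous_ofNet`), and `P_ε(D)E_ε = δ` holds exactly for small `ε`, so the classes agree. -/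

/-- The generalized numbers of order `O(ε^a)`. -/
def orderGe (𝕜 : Type) [NormedField 𝕜] (a : ℝ) : AddSubgroup (GenNum 𝕜) where
  carrier := {z | ∃ r : ModNet 𝕜, mk r = z ∧ OPow (fun ε => ‖(r : Idx → 𝕜) ε‖) a}
  add_mem' := by
    rintro _ _ ⟨r, rfl, hr⟩ ⟨s, rfl, hs⟩
    refine ⟨r + s, map_add _ _ _, (hr.add hs).mono (Eventually.of_forall fun ε => ?_)⟩
    rw [abs_of_nonneg (norm_nonneg _), abs_of_nonneg (by positivity)]
    exact norm_add_le _ _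
  zero_mem' := ⟨0, map_zero _, by simpa using OPow.zero a⟩
  neg_mem' := by
    rintro _ ⟨r, rfl, hr⟩
    exact ⟨-r, map_neg _ _, by simpa using hr⟩

theorem mk_mem_orderGe {a : ℝ} {r : ModNet 𝕜} (h : OPow (fun ε => ‖(r : Idx → 𝕜) ε‖) a) :
    mk r ∈ orderGe 𝕜 a := ⟨r, rfl, h⟩

theorem orderGe_anti {a b : ℝ} (h : a ≤ b) : orderGe 𝕜 b ≤ orderGe 𝕜 a := by
  rintro _ ⟨r, rfl, hr⟩
  exact ⟨r, rfl, hr.anti h⟩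

theorem mul_mem_orderGe {a b : ℝ} {z w : GenNum 𝕜} (hz : z ∈ orderGe 𝕜 a)
    (hw : w ∈ orderGe 𝕜 b) : z * w ∈ orderGe 𝕜 (a + b) := by
  obtain ⟨r, rfl, hr⟩ := hz
  obtain ⟨s, rfl, hs⟩ := hw
  exact ⟨r * s, map_mul _ _ _, by simpa using hr.mul hs⟩

theorem exists_mem_orderGe (z : GenNum 𝕜) : ∃ N : ℕ, z ∈ orderGe 𝕜 (-(N : ℝ)) := by
  obtain ⟨r, rfl⟩ := mk_surjective z
  obtain ⟨N, hN⟩ : Moderate fun ε => ‖(r : Idx → 𝕜) ε‖ := r.2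
  exact ⟨N, r, rfl, hN⟩

/-- These subgroups need not be ideals: multiplication by a number of order `-N` costs `N`, which is
absorbed by passing to a smaller subgroup. Products are controlled by `max a 0`, whose double is at
least `a`. -/
theorem ringSubgroupsBasis_orderGe : RingSubgroupsBasis (orderGe 𝕜) := by
  refine RingSubgroupsBasis.of_comm _ (fun a b => ⟨max a b, ?_⟩) (fun a => ⟨max a 0, ?_⟩)
    fun x a => ?_
  · exact le_inf (orderGe_anti (le_max_left _ _)) (orderGe_anti (le_max_right _ _))
  · rintro _ ⟨z, hz, w, hw, rfl⟩
    refine orderGe_anti ?_ (mul_mem_orderGe hz hw)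
    linarith [le_max_left a 0, le_max_right a 0]
  · obtain ⟨N, hN⟩ := exists_mem_orderGe x
    refine ⟨a + N, fun w hw => orderGe_anti ?_ (mul_mem_orderGe hN hw)⟩
    linarith

theorem le_val_of_mem {a : ℝ} {z : GenNum 𝕜} (h : z ∈ orderGe 𝕜 a) : (a : EReal) ≤ val z := by
  obtain ⟨r, rfl, hr⟩ := h
  exact le_sSup ⟨a, r, rfl, hr, rfl⟩

theorem mem_orderGe_of_lt_val {a : ℝ} {z : GenNum 𝕜} (h : (a : EReal) < val z) :
    z ∈ orderGe 𝕜 a := by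
  obtain ⟨_, ⟨b, r, rfl, hr, rfl⟩, hb⟩ := lt_sSup_iff.1 h
  exact ⟨r, rfl, hr.anti (by exact_mod_cast hb.le)⟩

theorem ultraNorm_le_of_mem {a : ℝ} {z : GenNum 𝕜} (h : z ∈ orderGe 𝕜 a) :
    ultraNorm z ≤ EReal.exp (-a) :=
  EReal.exp_monotone (EReal.neg_le_neg_iff.2 (le_val_of_mem h))

theorem mem_of_ultraNorm_lt {a : ℝ} {z : GenNum 𝕜} (h : ultraNorm z < EReal.exp (-a)) :
    z ∈ orderGe 𝕜 a :=
  mem_orderGe_of_lt_val (EReal.neg_lt_neg_iff.1 (EReal.exp_strictMono.lt_iff_lt.1 h))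

theorem min_val_le (z w : GenNum 𝕜) : min (val z) (val w) ≤ val (z + w) := by
  refine le_of_forall_lt fun c hc => ?_
  obtain ⟨_, ⟨a, r, hr, hra, rfl⟩, ha⟩ := lt_sSup_iff.1 (lt_min_iff.1 hc).1
  obtain ⟨_, ⟨b, s, hs, hsb, rfl⟩, hb⟩ := lt_sSup_iff.1 (lt_min_iff.1 hc).2
  have hz : z ∈ orderGe 𝕜 (min a b) := ⟨r, hr, hra.anti (min_le_left _ _)⟩
  have hw : w ∈ orderGe 𝕜 (min a b) := ⟨s, hs, hsb.anti (min_le_right _ _)⟩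
  refine lt_of_lt_of_le ?_ (le_val_of_mem (add_mem hz hw))
  rcases min_cases a b with h | h <;> rw [h.1] <;> assumption

theorem ultraNorm_add_le (z w : GenNum 𝕜) :
    ultraNorm (z + w) ≤ max (ultraNorm z) (ultraNorm w) := by
  rw [ultraNorm, ultraNorm, ultraNorm, ← EReal.exp_monotone.map_max]
  refine EReal.exp_monotone ?_
  rcases le_total (val z) (val w) with h | h
  · rw [max_eq_left (EReal.neg_le_neg_iff.2 h), EReal.neg_le_neg_iff]
    simpa [h] using min_val_le z w
  · rw [max_eq_right (EReal.neg_le_neg_iff.2 h), EReal.neg_le_neg_iff]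
    simpa [h] using min_val_le z w

theorem ultraNorm_zero : ultraNorm (0 : GenNum 𝕜) = 0 := by
  rw [ultraNorm, EReal.exp_eq_zero_iff, EReal.neg_eq_bot_iff, EReal.eq_top_iff_forall_lt]
  intro a
  refine lt_of_lt_of_le ?_ (le_val_of_mem (zero_mem (orderGe 𝕜 (a + 1))))
  exact_mod_cast lt_add_one a

theorem _root_.Colombeau.exists_exp_neg_lt {r : ℝ≥0∞} (hr : 0 < r) :
    ∃ a : ℝ, EReal.exp (-(a : EReal)) < r := by
  obtain ⟨s, hs, hsr⟩ := ENNReal.lt_iff_exists_nnreal_btwn.1 hr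
  refine ⟨-Real.log s, ?_⟩
  have hs0 : (0 : ℝ) < s := by exact_mod_cast hs
  have : (-((-Real.log s : ℝ) : EReal)) = ((Real.log s : ℝ) : EReal) := by
    rw [EReal.coe_neg, neg_neg]
  rw [this, EReal.exp_coe, Real.exp_log hs0]
  simpa using hsr

theorem orderGe_mem_nhds (z : GenNum 𝕜) (a : ℝ) : {w | w - z ∈ orderGe 𝕜 a} ∈ 𝓝 z := by
  have hpos : 0 < EReal.exp (-(a : EReal)) := by
    rw [EReal.zero_lt_exp_iff, ← EReal.coe_neg]
    exact EReal.bot_lt_coe _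
  have ho : IsOpen {w : GenNum 𝕜 | ultraNorm (w - z) < EReal.exp (-a)} :=
    isOpen_generateFrom_of_mem ⟨z, _, hpos, rfl⟩
  refine mem_of_superset (ho.mem_nhds ?_) fun w hw => mem_of_ultraNorm_lt hw
  change ultraNorm (z - z) < _
  rwa [sub_self, ultraNorm_zero]

/-- Balls and subgroups are interleaved: norm below `e^{-a}` forces order `a`, and order `a` forces
norm at most `e^{-a}`. The ultrametric inequality makes the balls open. The purpose is to inherit
the topological ring structure and a basis of additive subgroups. -/
theorem topology_eq : (instTopologicalSpace : TopologicalSpace (GenNum 𝕜)) =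
    (ringSubgroupsBasis_orderGe (𝕜 := 𝕜)).topology := by
  refine le_antisymm (le_of_nhds_le_nhds fun z => ?_) (le_generateFrom ?_)
  · intro s hs
    obtain ⟨a, -, ha⟩ := ((ringSubgroupsBasis_orderGe (𝕜 := 𝕜)).hasBasis_nhds z).mem_iff.1 hs
    exact mem_of_superset (orderGe_mem_nhds z a) ha
  · rintro _ ⟨z, r, hr, rfl⟩
    refine (@isOpen_iff_mem_nhds _ (ringSubgroupsBasis_orderGe (𝕜 := 𝕜)).topology _).2
      fun w hw => ?_
    obtain ⟨a, ha⟩ := exists_exp_neg_lt hr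
    refine ((ringSubgroupsBasis_orderGe (𝕜 := 𝕜)).hasBasis_nhds w).mem_iff.2
      ⟨a, trivial, fun v hv => ?_⟩
    change ultraNorm (v - z) < r
    rw [← sub_add_sub_cancel v w z]
    exact (ultraNorm_add_le _ _).trans_lt
      (max_lt ((ultraNorm_le_of_mem hv).trans_lt ha) hw)

instance : IsTopologicalRing (GenNum 𝕜) := by
  rw [topology_eq]
  exact (ringSubgroupsBasis_orderGe (𝕜 := 𝕜)).toRingFilterBasis.isTopologicalRing

theorem hasBasis_nhds (z : GenNum 𝕜) :
    (𝓝 z).HasBasis (fun _ : ℝ => True) fun a => {w | w - z ∈ orderGe 𝕜 a} := by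
  rw [topology_eq]
  exact (ringSubgroupsBasis_orderGe (𝕜 := 𝕜)).hasBasis_nhds z

end GenNum

variable {n : ℕ}

/-! ### Products of test functions -/

/-- The pointwise product of two test functions. -/
def mulTest (χ f : Test n) : Test n where
  toFun x := χ x * f x
  contDiff' := χ.contDiff.mul f.contDiff
  hasCompactSupport' := f.hasCompactSupport.mul_left
  tsupport_subset' := Set.subset_univ _

theorem differentiable_test (f : Test n) : Differentiable ℝ f :=
  f.contDiff.differentiable (by simp)

theorem partialD_eq_fderiv (i : Fin n) (f : Test n) (x : Sp n) :
    partialD i f x = fderiv ℝ f x (EuclideanSpace.single i (1 : ℝ)) := by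
  rw [partialD_apply, (differentiable_test f x).lineDeriv_eq_fderiv]

theorem partialD_mulTest (i : Fin n) (χ f : Test n) :
    partialD i (mulTest χ f) = mulTest (partialD i χ) f + mulTest χ (partialD i f) := by
  ext x
  change _ = partialD i χ x * f x + χ x * partialD i f x
  rw [partialD_eq_fderiv, partialD_eq_fderiv, partialD_eq_fderiv]
  have : (mulTest χ f : Sp n → ℂ) = fun x => χ x * f x := rfl
  rw [this, fderiv_fun_mul (differentiable_test χ x) (differentiable_test f x)]
  simp
  ring

theorem wordD_append_singleton (w : List (Fin n)) (i : Fin n) (f : Test n) :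
    wordD (w ++ [i]) f = wordD w (partialD i f) := by
  simp [wordD, Module.End.mul_apply]

theorem semi_mono_order (K : Set (Sp n)) {j k : ℕ} (h : j ≤ k) (f : Test n) :
    semi K j f ≤ semi K k f :=
  semi_le (semi_nonneg _ _ _) fun _ hw _ hx => le_semi f (hw.trans h) hx

theorem semi_mono_set {K L : Set (Sp n)} (h : K ⊆ L) (j : ℕ) (f : Test n) :
    semi K j f ≤ semi L j f :=
  semi_le (semi_nonneg _ _ _) fun _ hw _ hx => le_semi f hw (h hx)

theorem semi_union_le (K L : Set (Sp n)) (j : ℕ) (f : Test n) :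
    semi (K ∪ L) j f ≤ semi K j f + semi L j f :=
  semi_le (add_nonneg (semi_nonneg _ _ _) (semi_nonneg _ _ _)) fun _ hw _ hx =>
    hx.elim (fun h => (le_semi f hw h).trans (le_add_of_nonneg_right (semi_nonneg _ _ _)))
      fun h => (le_semi f hw h).trans (le_add_of_nonneg_left (semi_nonneg _ _ _))

/-- Leibniz rule by induction on the word. The innermost derivative is peeled off and produces both
`∂χ · f` and `χ · ∂f`, so `χ` has to stay quantified in the induction. -/
theorem exists_norm_wordD_mulTest_le (w : List (Fin n)) : ∀ χ : Test n, ∃ C : ℝ, 0 ≤ C ∧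
    ∀ (f : Test n) (K : Set (Sp n)), ∀ x ∈ K,
      ‖wordD w (mulTest χ f) x‖ ≤ C * semi K w.length f := by
  induction w using List.reverseRecOn with
  | nil =>
    intro χ
    obtain ⟨C, hC⟩ := χ.continuous.bounded_above_of_compact_support χ.hasCompactSupport
    refine ⟨C, (norm_nonneg _).trans (hC 0), fun f K x hx => ?_⟩
    change ‖χ x * f x‖ ≤ _
    rw [norm_mul]
    exact mul_le_mul (hC x) (le_semi (w := []) f le_rfl hx) (norm_nonneg _)
      ((norm_nonneg _).trans (hC 0))
  | append_singleton w i ih =>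
    intro χ
    obtain ⟨C₁, h₁, H₁⟩ := ih (partialD i χ)
    obtain ⟨C₂, h₂, H₂⟩ := ih χ
    refine ⟨C₁ + C₂, by positivity, fun f K x hx => ?_⟩
    rw [wordD_append_singleton, partialD_mulTest, map_add, add_mul, List.length_append,
      List.length_singleton]
    refine (norm_add_le _ _).trans (add_le_add ((H₁ f K x hx).trans ?_)
      ((H₂ _ K x hx).trans ?_))
    · exact mul_le_mul_of_nonneg_left (semi_mono_order _ (Nat.le_succ _) _) h₁
    · exact mul_le_mul_of_nonneg_left (semi_partialD_le _ _ _ _) h₂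

theorem exists_semi_mulTest_le (χ : Test n) (j : ℕ) : ∃ C : ℝ, 0 ≤ C ∧
    ∀ (f : Test n) (K : Set (Sp n)), semi K j (mulTest χ f) ≤ C * semi K j f := by
  choose C hC H using fun w : List (Fin n) => exists_norm_wordD_mulTest_le w χ
  set S := (List.finite_length_le (Fin n) j).toFinset
  refine ⟨∑ w ∈ S, C w, Finset.sum_nonneg fun w _ => hC w, fun f K => ?_⟩
  refine semi_le (mul_nonneg (Finset.sum_nonneg fun w _ => hC w) (semi_nonneg _ _ _))
    fun w hw x hx => (H w f K x hx).trans ?_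
  refine mul_le_mul ?_ (semi_mono_order _ hw _) (semi_nonneg _ _ _)
    (Finset.sum_nonneg fun w _ => hC w)
  exact Finset.single_le_sum (fun w _ => hC w) (by simpa [S] using hw)

theorem tsupport_wordD (w : List (Fin n)) (f : Test n) : tsupport (wordD w f) ⊆ tsupport f := by
  induction w with
  | nil => rfl
  | cons i w ih =>
    have : wordD (i :: w) f = partialD i (wordD w f) := by simp [wordD, Module.End.mul_apply]
    rw [this]
    exact (tsupport_partialD _ _).trans ih

/-- A test function which is `1` near a compact set `K`. -/
theorem exists_cutoff {K K' : Set (Sp n)} (hK : IsCompact K) (hK' : IsCompact K')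
    (h : K ⊆ interior K') : ∃ χ : Test n, tsupport χ ⊆ K' ∧
      ∃ U : Set (Sp n), IsOpen U ∧ K ⊆ U ∧ ∀ x ∈ U, χ x = 1 := by
  obtain ⟨f, hf, h0, -⟩ := exists_contMDiffMap_one_nhds_of_subset_interior
    (modelWithCornersSelf ℝ (Sp n)) (n := ⊤) hK.isClosed h
  have hsupp : tsupport (fun x => ((f x : ℝ) : ℂ)) ⊆ K' := by
    refine closure_minimal (fun x hx => ?_) hK'.isClosed
    by_contra hx'
    exact hx (by simp [h0 x hx'])
  refine ⟨⟨fun x => ((f x : ℝ) : ℂ), ?_, ?_, Set.subset_univ _⟩, hsupp, ?_⟩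
  · exact Complex.ofRealCLM.contDiff.comp (contMDiff_iff_contDiff.1 f.contMDiff)
  · exact hK'.of_isClosed_subset (isClosed_tsupport _) hsupp
  · obtain ⟨U, hU, hKU, hU'⟩ := mem_nhdsSet_iff_exists.1 hf
    exact ⟨U, hU, hKU, fun x hx => by
      have := hU' hx
      change ((f x : ℝ) : ℂ) = 1
      simpa using this⟩

/-- The difference vanishes on the open set `U` together with all derivatives, so only points of `K`
outside `U` contribute. -/
theorem semi_sub_mulTest_le {χ : Test n} {U : Set (Sp n)} (hU : IsOpen U)
    (hχ : ∀ x ∈ U, χ x = 1) (j : ℕ) : ∃ C : ℝ, ∀ (f : Test n) (K : Set (Sp n)),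
      semi K j (f - mulTest χ f) ≤ C * semi (K \ U) j f := by
  obtain ⟨C, hC, H⟩ := exists_semi_mulTest_le χ j
  refine ⟨1 + C, fun f K => semi_le (mul_nonneg (by positivity) (semi_nonneg _ _ _))
    fun w hw x hx => ?_⟩
  by_cases hxU : x ∈ U
  · have h1 : x ∉ tsupport (f - mulTest χ f) := by
      rw [notMem_tsupport_iff_eventuallyEq]
      filter_upwards [hU.mem_nhds hxU] with y hy
      change f y - χ y * f y = 0
      rw [hχ y hy]
      ring
    rw [image_eq_zero_of_notMem_tsupport fun h => h1 (tsupport_wordD w _ h), norm_zero]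
    exact mul_nonneg (by positivity) (semi_nonneg _ _ _)
  · rw [map_sub, add_mul, one_mul]
    refine (norm_sub_le _ _).trans (add_le_add (le_semi f hw ⟨hx, hxU⟩) ?_)
    exact (le_semi (mulTest χ f) hw (⟨hx, hxU⟩ : x ∈ K \ U)).trans (H f _)

/-! ### Continuity of the functionals given by moderate nets -/

namespace Gc

/-- The product of a net with a fixed test function. -/
def mulNet (χ : Test n) (f : EcM n) : EcM n :=
  ⟨fun ε => mulTest χ ((f : Idx → Test n) ε), by
    refine ⟨⟨tsupport χ, χ.hasCompactSupport, fun ε => tsupport_mul_subset_left⟩,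
      fun M hM j => ?_⟩
    obtain ⟨C, hC, H⟩ := exists_semi_mulTest_le χ j
    refine ((Moderate.const C).mul (f.2.2 M hM j)).mono (Eventually.of_forall fun ε => ?_)
    rw [abs_of_nonneg (semi_nonneg _ _ _), abs_of_nonneg (mul_nonneg hC (semi_nonneg _ _ _))]
    exact H _ _⟩

/-- Each point off the support has a compact neighbourhood inside one of the open sets defining it,
and finitely many of these cover `L`. The representative attached to such a set may differ from `f`,
but only by a negligible net. -/
theorem negligible_semi_of_subset_compl_supp {f : EcM n} {L : Set (Sp n)} (hL : IsCompact L)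
    (h : L ⊆ (supp (mk f))ᶜ) (j : ℕ) :
    Negligible fun ε => semi L j ((f : Idx → Test n) ε) := by
  refine hL.induction_on (p := fun s => Negligible fun ε => semi s j ((f : Idx → Test n) ε))
    ?_ ?_ ?_ ?_
  · refine Negligible.zero.mono (Eventually.of_forall fun ε => ?_)
    rw [abs_of_nonneg (semi_nonneg _ _ _), abs_zero]
    exact semi_le le_rfl fun w _ x hx => hx.elim
  · refine fun s t hst ht => ht.mono (Eventually.of_forall fun ε => ?_)
    rw [abs_of_nonneg (semi_nonneg _ _ _), abs_of_nonneg (semi_nonneg _ _ _)]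
    exact semi_mono_set hst _ _
  · refine fun s t hs ht => (hs.add ht).mono (Eventually.of_forall fun ε => ?_)
    rw [abs_of_nonneg (semi_nonneg _ _ _),
      abs_of_nonneg (add_nonneg (semi_nonneg _ _ _) (semi_nonneg _ _ _))]
    exact semi_union_le _ _ _ _
  · intro x hx
    have hx' := h hx
    rw [supp, compl_compl] at hx'
    obtain ⟨V, ⟨hV, g, hg, hgV⟩, hxV⟩ := hx'
    obtain ⟨N, hN, hxN, hNV⟩ := exists_compact_subset hV hxV
    refine ⟨N, mem_nhdsWithin_of_mem_nhds (mem_interior_iff_mem_nhds.1 hxN), ?_⟩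
    have hfg : f - g ∈ Nc n := mk_eq_mk.1 hg.symm
    refine ((hfg N hN j).add (hgV N hNV hN j)).mono (Eventually.of_forall fun ε => ?_)
    rw [abs_of_nonneg (semi_nonneg _ _ _),
      abs_of_nonneg (add_nonneg (semi_nonneg _ _ _) (semi_nonneg _ _ _))]
    have e : (f : Idx → Test n) ε = ((f - g : EcM n) : Idx → Test n) ε + (g : Idx → Test n) ε :=
      (sub_add_cancel _ _).symm
    conv_lhs => rw [e]
    exact semi_add_le _ _ _ _

/-- Cutting off near the support changes the representative only by a negligible net. All elements
of `GK K` thereby get representatives supported in one compact set, to which a single estimate of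
`ModDistr` applies. -/
theorem mk_mulNet {K : Set (Sp n)} {f : EcM n} (hf : supp (mk f) ⊆ K) {χ : Test n}
    {U : Set (Sp n)} (hU : IsOpen U) (hKU : K ⊆ U) (hχ : ∀ x ∈ U, χ x = 1) :
    mk (mulNet χ f) = mk f := by
  refine (mk_eq_mk.2 fun M hM j => ?_).symm
  obtain ⟨C, hC⟩ := semi_sub_mulTest_le hU hχ j
  have := negligible_semi_of_subset_compl_supp (f := f) (hM.diff hU)
    (fun x hx h => hx.2 (hKU (hf h))) j
  refine ((Moderate.const C).mul_negligible this).mono (Eventually.of_forall fun ε => ?_)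
  rw [abs_of_nonneg (semi_nonneg _ _ _)]
  exact (hC _ _).trans (le_abs_self _)

theorem supp_sub_subset {K : Set (Sp n)} {u v : Gc n} (hu : supp u ⊆ K) (hv : supp v ⊆ K) :
    supp (u - v) ⊆ K := by
  intro x hx
  by_contra hxK
  have h1 : x ∈ (supp u)ᶜ := fun h => hxK (hu h)
  have h2 : x ∈ (supp v)ᶜ := fun h => hxK (hv h)
  rw [supp, compl_compl] at h1 h2
  obtain ⟨V, ⟨hV, f, rfl, hf⟩, hxV⟩ := h1
  obtain ⟨W, ⟨hW, g, rfl, hg⟩, hxW⟩ := h2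
  refine hx ⟨V ∩ W, ⟨hV.inter hW, f - g, rfl, fun L hL hLc j => ?_⟩, hxV, hxW⟩
  refine ((hf L (hL.trans Set.inter_subset_left) hLc j).add
    (hg L (hL.trans Set.inter_subset_right) hLc j)).mono (Eventually.of_forall fun ε => ?_)
  rw [abs_of_nonneg (semi_nonneg _ _ _),
    abs_of_nonneg (add_nonneg (semi_nonneg _ _ _) (semi_nonneg _ _ _))]
  refine semi_le (add_nonneg (semi_nonneg _ _ _) (semi_nonneg _ _ _)) fun w hw x hx => ?_
  have e : ((f - g : EcM n) : Idx → Test n) ε = (f : Idx → Test n) ε - (g : Idx → Test n) ε := rfl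
  rw [e, map_sub]
  exact (norm_sub_le _ _).trans (add_le_add (le_semi _ hw hx) (le_semi _ hw hx))

theorem ultraSemi_zero (K : Set (Sp n)) (j : ℕ) : ultraSemi K j (0 : Gc n) = 0 := by
  rw [ultraSemi, EReal.exp_eq_zero_iff, EReal.neg_eq_bot_iff, EReal.eq_top_iff_forall_lt]
  intro a
  have : ((a + 1 : ℝ) : EReal) ≤ val K j (0 : Gc n) := by
    refine le_sSup ⟨a + 1, 0, rfl, (OPow.zero _).mono (Eventually.of_forall fun ε => ?_), rfl⟩
    rw [abs_of_nonneg (semi_nonneg _ _ _), abs_zero]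
    refine semi_le le_rfl fun w _ x _ => ?_
    rw [ZeroMemClass.coe_zero, Pi.zero_apply, map_zero]
    simp
  refine lt_of_lt_of_le ?_ this
  exact_mod_cast lt_add_one a

theorem exists_rep_of_ultraSemi_lt {K : Set (Sp n)} {j : ℕ} {u : Gc n} {a : ℝ}
    (h : ultraSemi K j u < EReal.exp (-a)) :
    ∃ f : EcM n, mk f = u ∧ OPow (fun ε => semi K j ((f : Idx → Test n) ε)) a := by
  have h' := EReal.neg_lt_neg_iff.1 (EReal.exp_strictMono.lt_iff_lt.1 h)
  obtain ⟨_, ⟨b, f, rfl, hf, rfl⟩, hb⟩ := lt_sSup_iff.1 h'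
  exact ⟨f, rfl, hf.anti (by exact_mod_cast hb.le)⟩

end Gc

theorem ofNet_mk (T : Idx → Distr n) (hT : ModDistr T) (f : EcM n) :
    ofNet T hT (Gc.mk f) = GenNum.mk ⟨_, hT.moderate f⟩ := rfl

/-- Quantitative continuity on `GK K`: after cutting off to `K'`, the estimate of `ModDistr` for
`K'` costs `N` powers of `ε`, while the cut-off costs only a constant. -/
theorem exists_ofNet_mem_orderGe (T : Idx → Distr n) (hT : ModDistr T) {K : Set (Sp n)}
    (hK : IsCompact K) : ∃ (K' : Set (Sp n)) (j N : ℕ), IsCompact K' ∧ K ⊆ interior K' ∧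
      ∀ u : Gc n, Gc.supp u ⊆ K → ∀ a : ℝ, Gc.ultraSemi K' j u < EReal.exp (-a) →
        ofNet T hT u ∈ GenNum.orderGe ℂ (a - N) := by
  obtain ⟨K', hK', hKK'⟩ := exists_compact_superset hK
  obtain ⟨χ, hχK', U, hU, hKU, hχ⟩ := exists_cutoff hK hK' hKK'
  obtain ⟨j, c, N, η, hc, hη, -, H⟩ := hT K' hK'
  obtain ⟨C, hC, HC⟩ := exists_semi_mulTest_le χ j
  refine ⟨K', j, N, hK', hKK', fun u hu a ha => ?_⟩
  obtain ⟨f, rfl, hf⟩ := Gc.exists_rep_of_ultraSemi_lt ha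
  rw [← Gc.mk_mulNet hu hU hKU hχ, ofNet_mk]
  refine GenNum.mk_mem_orderGe ?_
  have h1 : OPow (fun ε : Idx => (c * C) * ((ε : ℝ) ^ (-(N : ℝ)) *
      semi K' j ((f : Idx → Test n) ε))) (a - N) := by
    have h2 : OPow (fun ε : Idx => (ε : ℝ) ^ (-(N : ℝ))) (-(N : ℝ)) := isBigO_refl _ _
    exact ((OPow.mul h2 hf).anti (by linarith)).const_mul _
  refine h1.mono ?_
  filter_upwards [eventually_le_near0 hη] with ε hε
  have h0 : (0 : ℝ) ≤ (ε : ℝ) ^ (-(N : ℝ)) := Real.rpow_nonneg ε.2.1.le _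
  rw [abs_of_nonneg (norm_nonneg _), abs_of_nonneg (mul_nonneg (mul_nonneg hc.le hC)
    (mul_nonneg h0 (semi_nonneg _ _ _)))]
  refine (H (mulTest χ ((f : Idx → Test n) ε)) (tsupport_mul_subset_left.trans hχK') ε hε).trans ?_
  calc c * (ε : ℝ) ^ (-(N : ℝ)) * semi K' j (mulTest χ ((f : Idx → Test n) ε))
      ≤ c * (ε : ℝ) ^ (-(N : ℝ)) * (C * semi K' j ((f : Idx → Test n) ε)) :=
        mul_le_mul_of_nonneg_left (HC _ _) (mul_nonneg hc.le h0)
    _ = _ := by ring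

theorem epsPow_mem_orderGe {b : ℝ} (hb : 0 ≤ b) : GenNum.epsPow b ∈ GenNum.orderGe ℂ 0 := by
  refine GenNum.mk_mem_orderGe (OPow.anti ?_ hb)
  simp only [Complex.norm_real]
  exact (isBigO_refl _ _).norm_left

/-- The functional given by a moderate net of distributions is continuous. -/
theorem continuous_ofNet (T : Idx → Distr n) (hT : ModDistr T) : Continuous (ofNet T hT) := by
  rw [continuous_iff_le_induced]
  -- The finest topology is an infimum in this order, so it suffices that the topology induced by
  -- the functional is one of the competitors. Its convex neighbourhoods of zero are the preimages
  -- of `orderGe`.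
  refine sInf_le ⟨⟨topologicalAddGroup_induced (ofNet T hT),
    continuousSMul_induced (ofNet T hT), fun V hV => ?_⟩, fun K hK => ?_⟩
  · rw [nhds_induced, map_zero, ((GenNum.hasBasis_nhds 0).comap _).mem_iff] at hV
    obtain ⟨a, -, ha⟩ := hV
    refine ⟨_, ?_, ha, ?_, ?_⟩
    · rw [nhds_induced, map_zero]
      exact ((GenNum.hasBasis_nhds 0).comap _).mem_of_mem trivial
    · intro u hu v hv
      simp only [Set.mem_preimage, Set.mem_ofPred_eq, sub_zero, map_add] at hu hv ⊢
      exact add_mem hu hv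
    · intro b hb u hu
      simp only [Set.mem_preimage, Set.mem_ofPred_eq, sub_zero, map_smul, smul_eq_mul] at hu ⊢
      simpa using GenNum.mul_mem_orderGe (epsPow_mem_orderGe hb) hu
  · rw [← continuous_iff_coinduced_le, continuous_induced_rng]
    let _ := Gc.topGK K
    refine continuous_iff_continuousAt.2 fun u => ?_
    obtain ⟨K', j, N, hK', hKK', H⟩ := exists_ofNet_mem_orderGe T hT hK
    refine (GenNum.hasBasis_nhds _).tendsto_right_iff.2 fun a _ => ?_
    have hpos : 0 < EReal.exp (-((a + N : ℝ) : EReal)) := by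
      rw [EReal.zero_lt_exp_iff, ← EReal.coe_neg]
      exact EReal.bot_lt_coe _
    have ho : IsOpen {v : Gc.GK K | Gc.ultraSemi K' j (v.1 - u.1) <
        EReal.exp (-((a + N : ℝ) : EReal))} :=
      isOpen_generateFrom_of_mem ⟨K', j, u, _, hK', hKK', hpos, rfl⟩
    filter_upwards [ho.mem_nhds (by simpa [Gc.ultraSemi_zero] using hpos)] with v hv
    have := H _ (Gc.supp_sub_subset v.2 u.2) _ hv
    rw [map_sub, add_sub_cancel_right] at this
    exact this

/-! ### Derivatives of polynomials and the weight -/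

theorem mem_multiIdx {m : ℕ} {α : Fin n → ℕ} : α ∈ multiIdx n m ↔ ∑ i, α i ≤ m := by
  simp [multiIdx]

theorem coeff_pderiv_pow {R : Type} [CommRing R] (i : Fin n) (k : ℕ) (P : MvPolynomial (Fin n) R)
    (s : Fin n →₀ ℕ) :
    ((((MvPolynomial.pderiv i).toLinearMap : Module.End R (MvPolynomial (Fin n) R)) ^ k) P).coeff s
      = (s i + k).descFactorial k * P.coeff (s + Finsupp.single i k) := by
  induction k generalizing s with
  | zero => simp
  | succ k ih =>
    rw [pow_succ', Module.End.mul_apply]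
    change MvPolynomial.coeff s (MvPolynomial.pderiv i _) = _
    rw [MvPolynomial.coeff_pderiv, ih, add_assoc, ← Finsupp.single_add]
    have h1 : (s + Finsupp.single i 1 : Fin n →₀ ℕ) i = s i + 1 := by simp
    rw [h1, add_comm 1 k, show s i + 1 + k = s i + (k + 1) by ring, Nat.descFactorial_succ,
      show s i + (k + 1) - k = s i + 1 by omega]
    push_cast
    ring

/-- The identities for `polyD` below are read off from this formula. The variables do not interact,
since each index occurs only once in the list. -/
theorem coeff_polyD {R : Type} [CommRing R] (α : Fin n → ℕ) (P : MvPolynomial (Fin n) R)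
    (s : Fin n →₀ ℕ) :
    (polyD α P).coeff s = (∏ i, (s i + α i).descFactorial (α i) : ℕ) *
      P.coeff (s + Finsupp.equivFunOnFinite.symm α) := by
  have key : ∀ (l : List (Fin n)) (_ : l.Nodup) (s : Fin n →₀ ℕ),
      ((l.map fun i => ((MvPolynomial.pderiv i).toLinearMap :
        Module.End R (MvPolynomial (Fin n) R)) ^ α i).prod P).coeff s =
      ((l.map fun i => (s i + α i).descFactorial (α i)).prod : ℕ) *
        P.coeff (s + (l.map fun i => Finsupp.single i (α i)).sum) := by
    intro l
    induction l with
    | nil => simp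
    | cons i l ih =>
      intro hl s
      rw [List.nodup_cons] at hl
      rw [List.map_cons, List.prod_cons, Module.End.mul_apply, coeff_pderiv_pow, ih hl.2,
        List.map_cons, List.prod_cons, List.map_cons, List.sum_cons, ← mul_assoc, ← add_assoc]
      have : (l.map fun j => ((s + Finsupp.single i (α i)) j + α j).descFactorial (α j)) =
          l.map fun j => (s j + α j).descFactorial (α j) := by
        refine List.map_congr_left fun j hj => ?_
        have hij : i ≠ j := fun h => hl.1 (h ▸ hj)
        simp [hij]
      rw [this]
      push_cast
      ring
  rw [polyD, key _ (List.nodup_finRange n), ← List.ofFn_eq_map, List.prod_ofFn, ← List.ofFn_eq_map,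
    List.sum_ofFn]
  congr 3
  ext j
  simp [Finsupp.single_apply]

theorem polyD_polyD {R : Type} [CommRing R] (α β : Fin n → ℕ) (P : MvPolynomial (Fin n) R) :
    polyD α (polyD β P) = polyD (α + β) P := by
  ext s
  have h : s + Finsupp.equivFunOnFinite.symm α + Finsupp.equivFunOnFinite.symm β =
      s + Finsupp.equivFunOnFinite.symm (α + β) := by
    ext i
    simp [add_assoc]
  rw [coeff_polyD, coeff_polyD, coeff_polyD, ← mul_assoc, h, ← Nat.cast_mul,
    ← Finset.prod_mul_distrib]
  congr 2
  refine Finset.prod_congr rfl fun i _ => ?_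
  simp only [Finsupp.coe_add, Pi.add_apply, Finsupp.equivFunOnFinite_symm_apply_apply]
  rw [← add_assoc, add_comm (α i) (β i), mul_comm,
    ← Nat.descFactorial_mul_descFactorial (Nat.le_add_right (β i) (α i)), Nat.add_sub_cancel,
    Nat.add_sub_cancel_left, mul_comm]

theorem totalDegree_le_iff_coeff {R : Type} [CommRing R] {m : ℕ} {P : MvPolynomial (Fin n) R} :
    P.totalDegree ≤ m ↔ ∀ s : Fin n →₀ ℕ, m < ∑ i, s i → P.coeff s = 0 := by
  constructor
  · intro h s hs
    by_contra hc
    have := (MvPolynomial.le_totalDegree (MvPolynomial.mem_support_iff.2 hc)).trans h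
    rw [Finsupp.sum_fintype _ _ fun _ => rfl] at this
    omega
  · intro h
    refine Finset.sup_le fun s hs => ?_
    rw [Finsupp.sum_fintype _ _ fun _ => rfl]
    by_contra hc
    exact MvPolynomial.mem_support_iff.1 hs (h s (not_le.1 hc))

theorem sum_support_eq_sum_multiIdx {R M : Type} [CommRing R] [AddCommMonoid M] {m : ℕ}
    {p : MvPolynomial (Fin n) R} (hp : p.totalDegree ≤ m) (F : (Fin n →₀ ℕ) → R → M)
    (hF : ∀ s, F s 0 = 0) :
    ∑ s ∈ p.support, F s (p.coeff s) = ∑ α ∈ multiIdx n m,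
      F (Finsupp.equivFunOnFinite.symm α) (p.coeff (Finsupp.equivFunOnFinite.symm α)) := by
  refine Finset.sum_of_injOn (fun s : Fin n →₀ ℕ => (s : Fin n → ℕ))
    (fun s _ t _ h => DFunLike.coe_injective h) (fun s hs => ?_) (fun α hα h => ?_)
    fun s _ => by simp
  · refine mem_multiIdx.2 ?_
    by_contra hc
    exact MvPolynomial.mem_support_iff.1 hs (totalDegree_le_iff_coeff.1 hp s (not_le.1 hc))
  · have : p.coeff (Finsupp.equivFunOnFinite.symm α) = 0 := by
      by_contra hc
      exact h ⟨_, MvPolynomial.mem_support_iff.2 hc, rfl⟩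
    rw [this, hF]

theorem eval_eq_sum_multiIdx {R : Type} [CommRing R] {m : ℕ} {p : MvPolynomial (Fin n) R}
    (hp : p.totalDegree ≤ m) (z : Fin n → R) :
    MvPolynomial.eval z p = ∑ α ∈ multiIdx n m,
      p.coeff (Finsupp.equivFunOnFinite.symm α) * ∏ i, z i ^ α i := by
  rw [MvPolynomial.eval_eq', sum_support_eq_sum_multiIdx hp fun s a => a * ∏ i, z i ^ s i]
  · simp
  · simp

theorem totalDegree_polyD_le {R : Type} [CommRing R] {m : ℕ} {P : MvPolynomial (Fin n) R}
    (hP : P.totalDegree ≤ m) (α : Fin n → ℕ) : (polyD α P).totalDegree ≤ m := by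
  rw [totalDegree_le_iff_coeff] at hP ⊢
  intro s hs
  rw [coeff_polyD, hP, mul_zero]
  refine hs.trans_le (Finset.sum_le_sum fun i _ => ?_)
  simp

theorem polyD_eq_zero {R : Type} [CommRing R] {m : ℕ} {P : MvPolynomial (Fin n) R}
    (hP : P.totalDegree ≤ m) {α : Fin n → ℕ} (hα : m < ∑ i, α i) : polyD α P = 0 := by
  ext s
  rw [coeff_polyD, totalDegree_le_iff_coeff.1 hP, mul_zero, MvPolynomial.coeff_zero]
  refine hα.trans_le (Finset.sum_le_sum fun i _ => ?_)
  simp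

/-- Where the subtraction of exponents truncates, a descending factorial vanishes, so the formula
needs no side condition. -/
theorem polyD_monomial {R : Type} [CommRing R] (α : Fin n → ℕ) (s : Fin n →₀ ℕ) (a : R) :
    polyD α (MvPolynomial.monomial s a) =
      MvPolynomial.monomial (s - Finsupp.equivFunOnFinite.symm α)
        ((∏ i, (s i).descFactorial (α i) : ℕ) * a) := by
  classical
  ext t
  rw [coeff_polyD, MvPolynomial.coeff_monomial, MvPolynomial.coeff_monomial]
  by_cases h : s = t + Finsupp.equivFunOnFinite.symm α
  · subst h
    simp
  · rw [if_neg h, mul_zero]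
    split_ifs with h'
    · have : ∃ i, s i < α i := by
        by_contra! hc
        refine h ?_
        rw [← h', tsub_add_cancel_of_le]
        exact fun i => by simpa using hc i
      obtain ⟨i, hi⟩ := this
      rw [Finset.prod_eq_zero (Finset.mem_univ i) (Nat.descFactorial_eq_zero_iff_lt.2 hi)]
      simp
    · rfl

/-- The binomial theorem in each variable. Indices not below `s` contribute zero, so the range can
be the common set `multiIdx n m`, which makes the formula additive over monomials. -/
theorem taylor_monomial {m : ℕ} (s : Fin n →₀ ℕ) (hs : ∑ i, s i ≤ m) (a : ℂ) (z y : Fin n → ℂ) :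
    MvPolynomial.eval (z + y) (MvPolynomial.monomial s a) =
      ∑ α ∈ multiIdx n m, MvPolynomial.eval z (polyD α (MvPolynomial.monomial s a)) *
        ∏ i, y i ^ α i / ((α i).factorial : ℂ) := by
  have h1 : Fintype.piFinset (fun i => Finset.range (s i + 1)) ⊆ multiIdx n m := by
    intro α hα
    rw [Fintype.mem_piFinset] at hα
    rw [mem_multiIdx]
    exact (Finset.sum_le_sum fun i _ => Nat.lt_succ_iff.1 (Finset.mem_range.1 (hα i))).trans hs
  rw [← Finset.sum_subset h1]
  · rw [MvPolynomial.eval_monomial, Finsupp.prod_fintype _ _ fun _ => pow_zero _]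
    have : ∀ i, (z + y) i ^ s i = ∑ k ∈ Finset.range (s i + 1),
        y i ^ k * z i ^ (s i - k) * ((s i).choose k : ℂ) := fun i => by
      rw [Pi.add_apply, add_comm, add_pow]
    simp_rw [this, Finset.prod_univ_sum, Finset.mul_sum]
    refine Finset.sum_congr rfl fun α hα => ?_
    rw [polyD_monomial, MvPolynomial.eval_monomial, Finsupp.prod_fintype _ _ fun _ => pow_zero _,
      Nat.cast_prod, mul_comm _ a, mul_assoc, mul_assoc, ← Finset.prod_mul_distrib,
      ← Finset.prod_mul_distrib]
    congr 1
    refine Finset.prod_congr rfl fun i _ => ?_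
    rw [Nat.choose_eq_descFactorial_div_factorial, Nat.cast_div (Nat.factorial_dvd_descFactorial _ _)
      (by exact_mod_cast (Nat.factorial_ne_zero _))]
    simp only [Finsupp.coe_tsub, Pi.sub_apply, Finsupp.equivFunOnFinite_symm_apply_apply]
    ring
  · intro α _ hα
    have : ∃ i, s i < α i := by
      by_contra! hc
      exact hα (Fintype.mem_piFinset.2 fun i => Finset.mem_range.2 (Nat.lt_succ_iff.2 (hc i)))
    obtain ⟨i, hi⟩ := this
    rw [polyD_monomial,
      Finset.prod_eq_zero (Finset.mem_univ i) (Nat.descFactorial_eq_zero_iff_lt.2 hi)]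
    simp

theorem taylor {m : ℕ} {p : MvPolynomial (Fin n) ℂ} (hp : p.totalDegree ≤ m) (z y : Fin n → ℂ) :
    MvPolynomial.eval (z + y) p = ∑ α ∈ multiIdx n m, MvPolynomial.eval z (polyD α p) *
        ∏ i, y i ^ α i / ((α i).factorial : ℂ) := by
  have hD : ∀ α, polyD α p = ∑ s ∈ p.support, polyD α (MvPolynomial.monomial s (p.coeff s)) := by
    intro α
    conv_lhs => rw [p.as_sum]
    exact map_sum _ _ _
  conv_lhs => rw [p.as_sum]
  simp_rw [hD, map_sum, Finset.sum_mul]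
  rw [Finset.sum_comm]
  refine Finset.sum_congr rfl fun s hs => taylor_monomial s ?_ _ _ _
  by_contra hc
  exact MvPolynomial.mem_support_iff.1 hs (totalDegree_le_iff_coeff.1 hp s (not_le.1 hc))

/-! ### Lower bound and slow variation of the weight -/

theorem weight_nonneg (m : ℕ) (p : MvPolynomial (Fin n) ℂ) (ξ : Sp n) : 0 ≤ weight m p ξ :=
  Real.sqrt_nonneg _

theorem norm_le_weight {m : ℕ} (p : MvPolynomial (Fin n) ℂ) (ξ : Sp n) {α : Fin n → ℕ}
    (hα : α ∈ multiIdx n m) :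
    ‖MvPolynomial.eval (fun i => (ξ i : ℂ)) (polyD α p)‖ ≤ weight m p ξ := by
  refine Real.le_sqrt_of_sq_le ?_
  exact Finset.single_le_sum
    (f := fun α => ‖MvPolynomial.eval (fun i => (ξ i : ℂ)) (polyD α p)‖ ^ 2)
    (fun _ _ => sq_nonneg _) hα

theorem weight_le_sum (m : ℕ) (p : MvPolynomial (Fin n) ℂ) (ξ : Sp n) :
    weight m p ξ ≤
      ∑ α ∈ multiIdx n m, ‖MvPolynomial.eval (fun i => (ξ i : ℂ)) (polyD α p)‖ := by
  rw [weight, Real.sqrt_le_left (Finset.sum_nonneg fun _ _ => norm_nonneg _)]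
  exact Finset.sum_sq_le_sq_sum_of_nonneg fun _ _ => norm_nonneg _

/-- Differentiating along an exponent of top degree leaves a nonzero constant, which is one of the
terms of the weight. This bound depends on `p` and is used only qualitatively. -/
theorem exists_weight_lower {m : ℕ} {p : MvPolynomial (Fin n) ℂ} (hp : p.totalDegree ≤ m)
    (h0 : p ≠ 0) : ∃ κ : ℝ, 0 < κ ∧ ∀ ξ, κ ≤ weight m p ξ := by
  obtain ⟨s, hs, hdeg⟩ := Finset.exists_mem_eq_sup p.support
    (MvPolynomial.support_nonempty.2 h0) fun s => s.sum fun _ e => e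
  have hdeg' : p.totalDegree = ∑ i, s i := by
    rw [MvPolynomial.totalDegree, hdeg, Finsupp.sum_fintype _ _ fun _ => rfl]
  have hC : polyD s p = MvPolynomial.C (((∏ i, (s i).factorial : ℕ) : ℂ) * p.coeff s) := by
    ext t
    rw [coeff_polyD, MvPolynomial.coeff_C]
    split_ifs with h
    · subst h
      simp [Nat.descFactorial_self]
    · rw [totalDegree_le_iff_coeff.1 le_rfl, mul_zero]
      rw [hdeg']
      obtain ⟨i, hi⟩ := Finsupp.ne_iff.1 (Ne.symm h)
      refine Finset.sum_lt_sum (fun i _ => by simp) ⟨i, Finset.mem_univ _, ?_⟩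
      simpa using Nat.pos_of_ne_zero hi
  refine ⟨‖((∏ i, (s i).factorial : ℕ) : ℂ) * p.coeff s‖, ?_, fun ξ => ?_⟩
  · refine norm_pos_iff.2 (mul_ne_zero ?_ (MvPolynomial.mem_support_iff.1 hs))
    exact_mod_cast Finset.prod_ne_zero_iff.2 fun i _ => Nat.factorial_ne_zero _
  · have := norm_le_weight (m := m) p ξ (α := s) (mem_multiIdx.2 (by rwa [← hdeg']))
    rwa [hC, MvPolynomial.eval_C] at this

theorem norm_prod_pow_div_le {m : ℕ} {y : Fin n → ℂ} {r : ℝ} (hr : 1 ≤ r) (hy : ∀ i, ‖y i‖ ≤ r)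
    {α : Fin n → ℕ} (hα : α ∈ multiIdx n m) :
    ‖∏ i, y i ^ α i / ((α i).factorial : ℂ)‖ ≤ r ^ m := by
  rw [norm_prod]
  calc ∏ i, ‖y i ^ α i / ((α i).factorial : ℂ)‖ ≤ ∏ i, r ^ α i := by
        refine Finset.prod_le_prod (fun _ _ => norm_nonneg _) fun i _ => ?_
        rw [norm_div, norm_pow, Complex.norm_natCast]
        refine (div_le_self (by positivity) ?_).trans (pow_le_pow_left₀ (norm_nonneg _) (hy i) _)
        exact_mod_cast Nat.factorial_pos _
    _ = r ^ ∑ i, α i := Finset.prod_pow_eq_pow_sum _ _ _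
    _ ≤ r ^ m := pow_le_pow_right₀ hr (mem_multiIdx.1 hα)

/-- Every derivative of `p` is expanded around `ξ`. Its Taylor coefficients are again derivatives of
`p` at `ξ`, hence bounded by the weight there. One factor of the cardinality counts the derivatives,
the other the Taylor terms. -/
theorem weight_le_mul {m : ℕ} {p : MvPolynomial (Fin n) ℂ} (hp : p.totalDegree ≤ m)
    (ξ η : Sp n) : weight m p η ≤
      ((multiIdx n m).card : ℝ) ^ 2 * (1 + ‖η - ξ‖) ^ m * weight m p ξ := by
  refine (weight_le_sum m p η).trans ?_
  have key : ∀ β ∈ multiIdx n m, ‖MvPolynomial.eval (fun i => (η i : ℂ)) (polyD β p)‖ ≤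
      (multiIdx n m).card * ((1 + ‖η - ξ‖) ^ m * weight m p ξ) := by
    intro β _
    have e : (fun i => (η i : ℂ)) = (fun i => (ξ i : ℂ)) + fun i => (((η - ξ) i : ℝ) : ℂ) := by
      ext i
      simp
    rw [e, taylor (totalDegree_polyD_le hp β), ← nsmul_eq_mul]
    refine (norm_sum_le _ _).trans (Finset.sum_le_card_nsmul _ _ _ fun α hα => ?_)
    rw [norm_mul, mul_comm]
    refine mul_le_mul ?_ ?_ (norm_nonneg _) (by positivity)
    · refine norm_prod_pow_div_le (by linarith [norm_nonneg (η - ξ)]) (fun i => ?_) hα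
      rw [Complex.norm_real]
      linarith [PiLp.norm_apply_le (η - ξ) i]
    · rw [polyD_polyD]
      -- Orders above `m` are not counted in the weight, but these derivatives vanish.
      by_cases h : α + β ∈ multiIdx n m
      · exact norm_le_weight p ξ h
      · rw [mem_multiIdx, not_le] at h
        rw [polyD_eq_zero hp h, map_zero, norm_zero]
        exact weight_nonneg _ _ _
  refine (Finset.sum_le_card_nsmul _ _ _ key).trans_eq ?_
  rw [nsmul_eq_mul]
  ring

/-! ### A measurable choice of circles avoiding the zeros of a polynomial -/

/-- The polynomial with Taylor coefficients `a` at the origin. -/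
def taylorPoly {m : ℕ} (a : multiIdx n m → ℂ) (y : Fin n → ℂ) : ℂ :=
  ∑ α, a α * ∏ i, y i ^ (α : Fin n → ℕ) i / (((α : Fin n → ℕ) i).factorial : ℂ)

theorem norm_taylorPoly_le {m : ℕ} (a : multiIdx n m → ℂ) {y : Fin n → ℂ} (hy : ‖y‖ ≤ 1) :
    ‖taylorPoly a y‖ ≤ (multiIdx n m).card * ‖a‖ := by
  refine (norm_sum_le _ _).trans ((Finset.sum_le_card_nsmul _ _ ‖a‖ fun α _ => ?_).trans_eq ?_)
  · rw [norm_mul]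
    have := norm_prod_pow_div_le (m := m) le_rfl (fun i => (norm_le_pi_norm y i).trans hy) α.2
    rw [one_pow] at this
    exact (mul_le_mul (norm_le_pi_norm a α) this (norm_nonneg _) (norm_nonneg _)).trans_eq
      (mul_one _)
  · rw [nsmul_eq_mul, Finset.card_univ, Fintype.card_coe]

theorem taylorPoly_sub {m : ℕ} (a b : multiIdx n m → ℂ) (y : Fin n → ℂ) :
    taylorPoly (a - b) y = taylorPoly a y - taylorPoly b y := by
  simp [taylorPoly, sub_mul, Finset.sum_sub_distrib]

theorem taylorPoly_smul {m : ℕ} (c : ℂ) (a : multiIdx n m → ℂ) (y : Fin n → ℂ) :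
    taylorPoly (c • a) y = c * taylorPoly a y := by
  simp [taylorPoly, Finset.mul_sum, mul_assoc]

theorem continuous_taylorPoly {m : ℕ} (a : multiIdx n m → ℂ) : Continuous (taylorPoly a) := by
  unfold taylorPoly
  fun_prop

/-- On the complex line through the origin and a point where the polynomial does not vanish, it
becomes a nonzero polynomial in one variable. Its finitely many zeros exclude only finitely many
radii. -/
theorem exists_circle_ne_zero {m : ℕ} {a : multiIdx n m → ℂ} (ha : a ≠ 0) {ρ : ℝ} (hρ : 0 < ρ) :
    ∃ θ : Fin n → ℂ, ‖θ‖ ≤ ρ ∧ ∀ z : ℂ, ‖z‖ = 1 → taylorPoly a (z • θ) ≠ 0 := by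
  set p : MvPolynomial (Fin n) ℂ := ∑ α : multiIdx n m,
    MvPolynomial.monomial (Finsupp.equivFunOnFinite.symm (α : Fin n → ℕ))
      (a α / ∏ i, (((α : Fin n → ℕ) i).factorial : ℂ)) with hp
  have heval : ∀ y, MvPolynomial.eval y p = taylorPoly a y := by
    intro y
    rw [hp, map_sum]
    refine Finset.sum_congr rfl fun α _ => ?_
    rw [MvPolynomial.eval_monomial, Finsupp.prod_fintype _ _ fun _ => pow_zero _,
      Finset.prod_div_distrib]
    simp only [Finsupp.equivFunOnFinite_symm_apply_apply]
    ring
  have hp0 : p ≠ 0 := by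
    obtain ⟨α, hα⟩ := Function.ne_iff.1 ha
    intro h
    have := congrArg (MvPolynomial.coeff (Finsupp.equivFunOnFinite.symm (α : Fin n → ℕ))) h
    rw [hp, MvPolynomial.coeff_sum, Finset.sum_eq_single α] at this
    · rw [MvPolynomial.coeff_monomial, if_pos rfl, MvPolynomial.coeff_zero, div_eq_zero_iff] at this
      refine this.elim hα ?_
      exact_mod_cast Finset.prod_ne_zero_iff.2 fun i _ => Nat.factorial_ne_zero _
    · intro β _ hβ
      rw [MvPolynomial.coeff_monomial, if_neg]
      exact fun h => hβ (Subtype.ext (Finsupp.equivFunOnFinite.symm.injective h))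
    · simp
  obtain ⟨y, hy⟩ : ∃ y, MvPolynomial.eval y p ≠ 0 := by
    by_contra! hc
    exact hp0 (MvPolynomial.funext fun y => by simpa using hc y)
  set q : Polynomial ℂ := MvPolynomial.eval₂ Polynomial.C
    (fun i => Polynomial.C (y i) * Polynomial.X) p with hq
  have hqe : ∀ z, q.eval z = taylorPoly a (z • y) := by
    intro z
    rw [← heval, hq, ← Polynomial.coe_evalRingHom, MvPolynomial.hom_eval₂, MvPolynomial.eval,
      MvPolynomial.coe_eval₂Hom]
    congr 1
    · exact RingHom.ext fun w => by simp
    · funext i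
      rw [map_mul, Polynomial.coe_evalRingHom, Polynomial.eval_C,
        Polynomial.eval_X, mul_comm]
      rfl
  have hq0 : q ≠ 0 := by
    intro h
    have := hqe 1
    rw [h, one_smul, ← heval, Polynomial.eval_zero] at this
    exact hy this.symm
  -- The denominator is `1 + ‖y‖` because `y` may be zero.
  have hinf : (Set.Ioo 0 (ρ / (1 + ‖y‖)) \ ((fun z : ℂ => ‖z‖) '' {z | q.IsRoot z})).Nonempty := by
    refine ((Set.Ioo_infinite (by positivity)).sdiff (Set.Finite.image _ ?_)).nonempty
    exact Polynomial.finite_setOfPred_isRoot hq0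
  obtain ⟨r, ⟨hr0, hr1⟩, hr⟩ := hinf
  refine ⟨(r : ℂ) • y, ?_, fun z hz h => hr ⟨z * r, ?_, ?_⟩⟩
  · rw [norm_smul, Complex.norm_real, Real.norm_of_nonneg hr0.le]
    rw [lt_div_iff₀ (by positivity)] at hr1
    nlinarith [norm_nonneg y]
  · change q.eval _ = 0
    rw [hqe, mul_smul, h]
  · simp [hz, abs_of_pos hr0]

theorem exists_pos_le_finset {ι : Type*} (t : Finset ι) (f : ι → ℝ) (hf : ∀ i ∈ t, 0 < f i) :
    ∃ c : ℝ, 0 < c ∧ ∀ i ∈ t, c ≤ f i := by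
  rcases t.eq_empty_or_nonempty with rfl | h
  · exact ⟨1, one_pos, by simp⟩
  · exact ⟨t.inf' h f, (Finset.lt_inf'_iff h).2 hf, fun i hi => Finset.inf'_le _ hi⟩

/-- A circle that is good for `a` remains good for nearby coefficient vectors, so finitely many
circles serve the unit sphere. Homogeneity in `a` extends the bound to all nonzero vectors. -/
theorem exists_circle_family (n m : ℕ) {ρ : ℝ} (hρ : 0 < ρ) :
    ∃ (θ : ℕ → Fin n → ℂ) (N : ℕ) (c : ℝ), 0 < c ∧ (∀ k, ‖θ k‖ ≤ ρ) ∧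
      ∀ a : multiIdx n m → ℂ, a ≠ 0 → ∃ k ≤ N, ∀ z : ℂ, ‖z‖ = 1 →
        c * ‖a‖ ≤ ‖taylorPoly a (z • θ k)‖ := by
  -- Besides `ρ`, the radius is kept below `1`, where `norm_taylorPoly_le` controls perturbations of
  -- the coefficients. The number `d` is the minimum over the circle; the values for `a = 0` are
  -- dummies.
  have h1 : ∀ a : multiIdx n m → ℂ, ∃ (θ : Fin n → ℂ) (d : ℝ), ‖θ‖ ≤ min ρ 1 ∧ 0 < d ∧
      (a ≠ 0 → ∀ z : ℂ, ‖z‖ = 1 → d ≤ ‖taylorPoly a (z • θ)‖) := by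
    intro a
    by_cases ha : a = 0
    · exact ⟨0, 1, by simpa using hρ.le, one_pos, fun h => (h ha).elim⟩
    obtain ⟨θ, hθ, hz⟩ := exists_circle_ne_zero ha (lt_min hρ one_pos)
    obtain ⟨z₀, hz₀, hmin⟩ := (isCompact_sphere (0 : ℂ) 1).exists_isMinOn
      ((NormedSpace.sphere_nonempty (x := (0 : ℂ)) (r := 1)).2 zero_le_one)
      (f := fun z => ‖taylorPoly a (z • θ)‖)
      (((continuous_taylorPoly a).comp (continuous_id.smul continuous_const)).norm.continuousOn)
    refine ⟨θ, _, hθ, norm_pos_iff.2 (hz z₀ (by simpa using hz₀)), fun _ z h => ?_⟩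
    exact hmin (by simpa using h)
  choose θ d hθ hd H using h1
  set A : ℝ := (multiIdx n m).card + 1 with hA
  have hApos : 0 < A := by positivity
  -- Within distance `d a / (2 * A)` the values on the circle move by at most `d a / 2`, so half of
  -- the minimum survives.
  obtain ⟨t, ht, hcov⟩ := (isCompact_sphere (0 : multiIdx n m → ℂ) 1).elim_nhds_subcover
    (fun a => Metric.ball a (d a / (2 * A)))
    fun a _ => Metric.ball_mem_nhds a (div_pos (hd a) (by positivity))
  obtain ⟨c, hc, hct⟩ := exists_pos_le_finset t (fun a => d a / 2) fun a _ => half_pos (hd a)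
  -- The finite family is numbered by a list; indices past its end get the harmless vector `0`.
  refine ⟨fun k => (t.toList[k]?.map θ).getD 0, t.toList.length, c, hc, fun k => ?_, fun a ha => ?_⟩
  · change ‖(t.toList[k]?.map θ).getD 0‖ ≤ ρ
    rcases t.toList[k]? with _ | b
    · simpa using hρ.le
    · simpa using (hθ b).trans (min_le_left _ _)
  · have hna : 0 < ‖a‖ := norm_pos_iff.2 ha
    set b : multiIdx n m → ℂ := ((‖a‖⁻¹ : ℝ) : ℂ) • a with hb
    have hbn : ‖b‖ = 1 := by
      rw [hb, norm_smul, Complex.norm_real, norm_inv, norm_norm, inv_mul_cancel₀ hna.ne']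
    obtain ⟨a', ha't, hab⟩ := Set.mem_iUnion₂.1 (hcov (by simpa using hbn))
    obtain ⟨k, hk, hka⟩ := List.mem_iff_getElem.1 (Finset.mem_toList.2 ha't)
    refine ⟨k, hk.le, fun z hz => ?_⟩
    have hθk : (t.toList[k]?.map θ).getD 0 = θ a' := by
      rw [List.getElem?_eq_getElem hk, hka]
      rfl
    change c * ‖a‖ ≤ ‖taylorPoly a (z • (t.toList[k]?.map θ).getD 0)‖
    rw [hθk]
    have ha'0 : a' ≠ 0 := by
      have := ht a' ha't
      rintro rfl
      simp at this
    have e1 := H a' ha'0 z hz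
    have hy : ‖z • θ a'‖ ≤ 1 := by
      rw [norm_smul, hz, one_mul]
      exact (hθ a').trans (min_le_right _ _)
    have e2 := norm_taylorPoly_le (b - a') hy
    rw [taylorPoly_sub] at e2
    have e3 : ((multiIdx n m).card : ℝ) * ‖b - a'‖ ≤ d a' / 2 := by
      have : ‖b - a'‖ < d a' / (2 * A) := by simpa [dist_eq_norm] using hab
      rw [lt_div_iff₀ (by positivity)] at this
      rw [hA] at this
      nlinarith [norm_nonneg (b - a')]
    have e4 : d a' / 2 ≤ ‖taylorPoly b (z • θ a')‖ := by
      have := norm_sub_norm_le (taylorPoly a' (z • θ a')) (taylorPoly b (z • θ a'))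
      rw [norm_sub_rev] at this
      linarith
    have e5 : a = (‖a‖ : ℂ) • b := by
      rw [hb, smul_smul, ← Complex.ofReal_mul, mul_inv_cancel₀ hna.ne', Complex.ofReal_one, one_smul]
    have e6 : ‖taylorPoly a (z • θ a')‖ = ‖a‖ * ‖taylorPoly b (z • θ a')‖ := by
      conv_lhs => rw [e5]
      rw [taylorPoly_smul, norm_mul, Complex.norm_real, norm_norm]
    rw [e6, mul_comm]
    exact mul_le_mul_of_nonneg_left ((hct a' ha't).trans e4) hna.le

/-- For every polynomial `p` there is a measurable choice of circles `z ↦ ξ + zθ(ξ)` on which `|p|`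
is bounded below by a multiple of the weight; the constant depends only on the dimension, the degree
and the size of the circles. -/
theorem exists_measurable_circle (n m : ℕ) {ρ : ℝ} (hρ : 0 < ρ) :
    ∃ c : ℝ, 0 < c ∧ ∀ p : MvPolynomial (Fin n) ℂ, p.totalDegree ≤ m → p ≠ 0 →
      ∃ θ : Sp n → Fin n → ℂ, Measurable θ ∧ (∀ ξ, ‖θ ξ‖ ≤ ρ) ∧ ∀ ξ (z : ℂ), ‖z‖ = 1 →
        c * weight m p ξ ≤ ‖MvPolynomial.eval ((fun i => (ξ i : ℂ)) + z • θ ξ) p‖ := by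
  classical
  obtain ⟨θ, N, c, hc, hθ, H⟩ := exists_circle_family n m hρ
  set A : ℝ := (multiIdx n m).card + 1 with hA
  have hApos : 0 < A := by positivity
  refine ⟨c / A, div_pos hc hApos, fun p hp hp0 => ?_⟩
  set a : Sp n → multiIdx n m → ℂ := fun ξ α =>
    MvPolynomial.eval (fun i => (ξ i : ℂ)) (polyD α p) with ha
  have hacont : Continuous a := by
    refine continuous_pi fun α => (MvPolynomial.continuous_eval _).comp ?_
    fun_prop
  have hta : ∀ ξ y, MvPolynomial.eval ((fun i => (ξ i : ℂ)) + y) p = taylorPoly (a ξ) y := by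
    intro ξ y
    rw [taylor hp, taylorPoly, ← Finset.sum_coe_sort]
  have hwa : ∀ ξ, weight m p ξ ≤ A * ‖a ξ‖ := by
    intro ξ
    refine (weight_le_sum m p ξ).trans ((Finset.sum_le_card_nsmul _ _ ‖a ξ‖ fun α hα => ?_).trans ?_)
    · exact norm_le_pi_norm (a ξ) ⟨α, hα⟩
    · rw [nsmul_eq_mul, hA]
      nlinarith [norm_nonneg (a ξ)]
  have ha0 : ∀ ξ, a ξ ≠ 0 := by
    intro ξ h
    obtain ⟨κ, hκ, hκ'⟩ := exists_weight_lower hp hp0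
    have h1 := hwa ξ
    rw [h, norm_zero, mul_zero] at h1
    linarith [hκ' ξ]
  set S : Sp n → ℕ → Prop := fun ξ k => ∀ z : ℂ, ‖z‖ = 1 →
    c * ‖a ξ‖ ≤ ‖MvPolynomial.eval ((fun i => (ξ i : ℂ)) + z • θ k) p‖ with hS
  -- For fixed `k` the condition is closed in `ξ`, being an intersection over `z` of closed
  -- conditions. Selecting the greatest admissible index is therefore measurable.
  have hmeas : Measurable fun ξ => Nat.findGreatest (S ξ) N := by
    refine measurable_findGreatest fun k _ => IsClosed.measurableSet ?_
    simp only [hS, Set.ofPred_forall]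
    refine isClosed_iInter fun z => isClosed_iInter fun _ => isClosed_le
      (continuous_const.mul hacont.norm) ((MvPolynomial.continuous_eval _).comp ?_).norm
    fun_prop
  refine ⟨fun ξ => θ (Nat.findGreatest (S ξ) N), (measurable_of_countable θ).comp hmeas,
    fun ξ => hθ _, fun ξ z hz => ?_⟩
  obtain ⟨k, hk, hkS⟩ := H (a ξ) (ha0 ξ)
  have hspec : S ξ (Nat.findGreatest (S ξ) N) :=
    Nat.findGreatest_spec (P := S ξ) hk fun z hz => by rw [hta]; exact hkS z hz
  refine le_trans ?_ (hspec z hz)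
  rw [div_mul_eq_mul_div, div_le_iff₀ hApos]
  nlinarith [hwa ξ]

/-! ### The Fourier-Laplace transform of exponentially decaying functions -/

/-- The directional derivative along the `j`-th coordinate. -/
def dirD (j : Fin n) (f : Sp n → ℂ) : Sp n → ℂ :=
  fun x => fderiv ℝ f x (EuclideanSpace.single j (1 : ℝ))

theorem contDiff_dirD (j : Fin n) {f : Sp n → ℂ} (hf : ContDiff ℝ ∞ f) :
    ContDiff ℝ ∞ (dirD j f) :=
  (hf.fderiv_right (m := ∞) (by simp)).clm_apply contDiff_const

theorem contDiff_dirD_iterate (j : Fin n) {f : Sp n → ℂ} (hf : ContDiff ℝ ∞ f) (k : ℕ) :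
    ContDiff ℝ ∞ ((dirD j)^[k] f) := by
  induction k with
  | zero => exact hf
  | succ k ih =>
    rw [Function.iterate_succ_apply']
    exact contDiff_dirD j ih

/-- The bilinear pairing `x · z` of a real and a complex vector. -/
def pair (x : Sp n) (z : Fin n → ℂ) : ℂ := ∑ i, (x i : ℂ) * z i

theorem continuous_pair : Continuous fun q : Sp n × (Fin n → ℂ) => pair q.1 q.2 := by
  unfold pair
  fun_prop

theorem pair_add_right (x : Sp n) (z y : Fin n → ℂ) : pair x (z + y) = pair x z + pair x y := by
  simp [pair, mul_add, Finset.sum_add_distrib]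

theorem pair_smul_right (x : Sp n) (c : ℂ) (z : Fin n → ℂ) : pair x (c • z) = c * pair x z := by
  simp only [pair, Finset.mul_sum, Pi.smul_apply, smul_eq_mul]
  exact Finset.sum_congr rfl fun i _ => by ring

theorem pair_ofReal (x ξ : Sp n) : pair x (fun i => (ξ i : ℂ)) = (inner ℝ x ξ : ℝ) := by
  simp [pair, PiLp.inner_apply, mul_comm]

/-- Each of the `n` coordinates contributes at most `ρ‖x‖` to the exponent. This is the source of
the condition `n * ρ < a` in all later estimates. -/
theorem norm_exp_pair_le {x : Sp n} {z : Fin n → ℂ} {ρ : ℝ} (hz : ∀ i, |(z i).im| ≤ ρ) :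
    ‖Complex.exp (Complex.I * pair x z)‖ ≤ Real.exp (n * ρ * ‖x‖) := by
  rw [Complex.norm_exp, Real.exp_le_exp]
  have h1 : (Complex.I * pair x z).re = ∑ i, -(x i * (z i).im) := by
    simp [pair, Complex.mul_re]
  rw [h1]
  refine (Finset.sum_le_card_nsmul _ _ (ρ * ‖x‖) fun i _ => ?_).trans_eq ?_
  · refine (neg_le_abs _).trans ?_
    rw [abs_mul, mul_comm]
    exact mul_le_mul (hz i) (PiLp.norm_apply_le x i) (abs_nonneg _)
      ((abs_nonneg _).trans (hz i))
  · simp [mul_assoc]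

theorem integrable_exp_neg_norm {b : ℝ} (hb : 0 < b) :
    Integrable fun x : Sp n => Real.exp (-b * ‖x‖) := by
  have h1 : Integrable fun x : Sp n => (1 + ‖x‖) ^ (-((n : ℝ) + 1)) :=
    integrable_one_add_norm (by simp)
  refine (h1.const_mul (Real.exp b * ((n + 1).factorial / b ^ (n + 1)))).mono'
    (by fun_prop) (Eventually.of_forall fun x => ?_)
  have hx := norm_nonneg x
  rw [Real.norm_of_nonneg (Real.exp_pos _).le]
  have h2 := Real.pow_div_factorial_le_exp (b * (1 + ‖x‖)) (by positivity) (n + 1)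
  have h3 : (1 + ‖x‖) ^ (-((n : ℝ) + 1)) = ((1 + ‖x‖) ^ (n + 1))⁻¹ := by
    rw [Real.rpow_neg (by positivity)]
    norm_cast
  have h4 : Real.exp (-b * ‖x‖) = Real.exp b * (Real.exp (b * (1 + ‖x‖)))⁻¹ := by
    rw [← Real.exp_neg, ← Real.exp_add]
    ring_nf
  rw [h3, h4, mul_assoc]
  refine mul_le_mul_of_nonneg_left ?_ (Real.exp_pos _).le
  rw [inv_le_comm₀ (Real.exp_pos _) (by positivity)]
  refine le_trans (le_of_eq ?_) h2
  rw [mul_pow]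
  field_simp

/-- The integral which bounds Fourier-Laplace transforms. -/
def expInt (n : ℕ) (b : ℝ) : ℝ := ∫ x : Sp n, Real.exp (-b * ‖x‖)

theorem expInt_nonneg (n : ℕ) (b : ℝ) : 0 ≤ expInt n b :=
  integral_nonneg fun _ => (Real.exp_pos _).le

/-- The Fourier-Laplace transform `∫ e^{i x·z} f(x) dx`. -/
def fourierLaplace (f : Sp n → ℂ) (z : Fin n → ℂ) : ℂ :=
  ∫ x, Complex.exp (Complex.I * pair x z) * f x

theorem norm_exp_pair_mul_le {f : Sp n → ℂ} {B a ρ : ℝ} (hB : ∀ x, ‖f x‖ ≤ B * Real.exp (-a * ‖x‖))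
    {z : Fin n → ℂ} (hz : ∀ i, |(z i).im| ≤ ρ) (x : Sp n) :
    ‖Complex.exp (Complex.I * pair x z) * f x‖ ≤ B * Real.exp (-(a - n * ρ) * ‖x‖) := by
  rw [norm_mul]
  refine (mul_le_mul (norm_exp_pair_le hz) (hB x) (norm_nonneg _) (Real.exp_pos _).le).trans_eq ?_
  rw [mul_left_comm, ← Real.exp_add]
  ring_nf

theorem integrable_exp_pair_mul {f : Sp n → ℂ} (hf : Continuous f) {B a ρ : ℝ}
    (hB : ∀ x, ‖f x‖ ≤ B * Real.exp (-a * ‖x‖)) {z : Fin n → ℂ} (hz : ∀ i, |(z i).im| ≤ ρ)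
    (ha : n * ρ < a) : Integrable fun x => Complex.exp (Complex.I * pair x z) * f x := by
  refine ((integrable_exp_neg_norm (sub_pos.2 ha)).const_mul B).mono' ?_
    (Eventually.of_forall (norm_exp_pair_mul_le hB hz))
  refine Continuous.aestronglyMeasurable ?_
  have := continuous_pair.comp (continuous_id.prodMk (continuous_const (y := z)) :
    Continuous fun x : Sp n => (x, z))
  exact ((Complex.continuous_exp.comp (continuous_const.mul this))).mul hf

theorem norm_fourierLaplace_le {f : Sp n → ℂ} {B a ρ : ℝ}
    (hB : ∀ x, ‖f x‖ ≤ B * Real.exp (-a * ‖x‖)) {z : Fin n → ℂ} (hz : ∀ i, |(z i).im| ≤ ρ)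
    (ha : n * ρ < a) : ‖fourierLaplace f z‖ ≤ B * expInt n (a - n * ρ) := by
  rw [expInt, ← integral_const_mul]
  exact norm_integral_le_of_norm_le ((integrable_exp_neg_norm (sub_pos.2 ha)).const_mul B)
    (Eventually.of_forall (norm_exp_pair_mul_le hB hz))

theorem hasFDerivAt_exp_pair (z : Fin n → ℂ) (x : Sp n) :
    DifferentiableAt ℝ (fun x : Sp n => Complex.exp (Complex.I * pair x z)) x ∧
    ∀ j, fderiv ℝ (fun x : Sp n => Complex.exp (Complex.I * pair x z)) x
      (EuclideanSpace.single j (1 : ℝ)) =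
        Complex.I * z j * Complex.exp (Complex.I * pair x z) := by
  have hp : ∀ y : Sp n, pair y z =
      (∑ i, (Complex.ofRealCLM.comp (EuclideanSpace.proj i : Sp n →L[ℝ] ℝ)).smulRight (z i)) y := by
    intro y
    simp [pair]
  set ℓ : Sp n →L[ℝ] ℂ :=
    ∑ i, (Complex.ofRealCLM.comp (EuclideanSpace.proj i : Sp n →L[ℝ] ℝ)).smulRight (z i) with hℓ
  simp_rw [hp]
  have h1 : HasFDerivAt (fun x : Sp n => Complex.exp (Complex.I * ℓ x))
      (Complex.exp (Complex.I * ℓ x) • (Complex.I • ℓ)) x :=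
    (ℓ.hasFDerivAt.const_mul Complex.I).cexp
  refine ⟨h1.differentiableAt, fun j => ?_⟩
  have h2 : ℓ (EuclideanSpace.single j (1 : ℝ)) = z j := by
    rw [← hp]
    rw [pair, Finset.sum_eq_single j (fun i _ hij => by simp [hij]) (by simp)]
    simp
  rw [h1.fderiv]
  simp only [smul_apply, h2, smul_eq_mul]
  ring

theorem fourierLaplace_dirD {f : Sp n → ℂ} (hf : ContDiff ℝ ∞ f) (j : Fin n) {B a ρ : ℝ}
    (hB : ∀ x, ‖f x‖ ≤ B * Real.exp (-a * ‖x‖))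
    (hB' : ∀ x, ‖dirD j f x‖ ≤ B * Real.exp (-a * ‖x‖))
    {z : Fin n → ℂ} (hz : ∀ i, |(z i).im| ≤ ρ) (ha : n * ρ < a) :
    fourierLaplace (dirD j f) z = -(Complex.I * z j) * fourierLaplace f z := by
  have hi := integrable_exp_pair_mul hf.continuous hB hz ha
  have hi' := integrable_exp_pair_mul (contDiff_dirD j hf).continuous hB' hz ha
  have he : ∀ x, fderiv ℝ (fun x : Sp n => Complex.exp (Complex.I * pair x z)) x
      (EuclideanSpace.single j (1 : ℝ)) * f x =
      Complex.I * z j * (Complex.exp (Complex.I * pair x z) * f x) := by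
    intro x
    rw [(hasFDerivAt_exp_pair z x).2 j]
    ring
  have := integral_mul_fderiv_eq_neg_fderiv_mul_of_integrable (μ := volume)
    (f := fun x : Sp n => Complex.exp (Complex.I * pair x z)) (g := f)
    (v := EuclideanSpace.single j (1 : ℝ)) (by simp_rw [he]; exact hi.const_mul _) hi' hi
    (fun x _ => (hasFDerivAt_exp_pair z x).1)
    fun x _ => (hf.differentiable (by simp)) x
  rw [fourierLaplace, fourierLaplace]
  change ∫ x, Complex.exp (Complex.I * pair x z) * fderiv ℝ f x (EuclideanSpace.single j (1 : ℝ)) = _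
  rw [this]
  simp_rw [he]
  rw [integral_const_mul]
  ring

/-- Repeated integration by parts in one coordinate direction. Only pure derivatives along that
coordinate enter, so mixed derivatives never have to be estimated. -/
theorem norm_pow_mul_fourierLaplace_le {f : Sp n → ℂ} (hf : ContDiff ℝ ∞ f) {j : Fin n}
    {B a ρ : ℝ} {M : ℕ} (hB : ∀ k ≤ M, ∀ x, ‖(dirD j)^[k] f x‖ ≤ B * Real.exp (-a * ‖x‖))
    {z : Fin n → ℂ} (hz : ∀ i, |(z i).im| ≤ ρ) (ha : n * ρ < a) :
    ‖z j‖ ^ M * ‖fourierLaplace f z‖ ≤ B * expInt n (a - n * ρ) := by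
  have key : ∀ k ≤ M, fourierLaplace ((dirD j)^[k] f) z =
      (-(Complex.I * z j)) ^ k * fourierLaplace f z := by
    intro k
    induction k with
    | zero => simp
    | succ k ih =>
      intro hk
      have h1 := hB k (by omega)
      have h2 := hB (k + 1) hk
      rw [Function.iterate_succ_apply'] at h2 ⊢
      rw [fourierLaplace_dirD (contDiff_dirD_iterate j hf k) j h1 h2 hz ha, ih (by omega)]
      ring
  have := norm_fourierLaplace_le (hB M le_rfl) hz ha
  rw [key M le_rfl, norm_mul, norm_pow, norm_neg, norm_mul, Complex.norm_I, one_mul] at this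
  exact this

theorem norm_le_sum_abs (ξ : Sp n) : ‖ξ‖ ≤ ∑ i, |ξ i| := by
  rw [EuclideanSpace.norm_eq, Real.sqrt_le_left (Finset.sum_nonneg fun _ _ => abs_nonneg _)]
  exact Finset.sum_sq_le_sq_sum_of_nonneg fun _ _ => norm_nonneg _

/-- Rapid decay of the Fourier-Laplace transform in strips. -/
theorem one_add_norm_pow_mul_fourierLaplace_le {f : Sp n → ℂ} (hf : ContDiff ℝ ∞ f)
    {B a ρ : ℝ} {M : ℕ} (hB0 : ∀ x, ‖f x‖ ≤ B * Real.exp (-a * ‖x‖))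
    (hB : ∀ j, ∀ k ≤ M, ∀ x, ‖(dirD j)^[k] f x‖ ≤ B * Real.exp (-a * ‖x‖))
    (ha : n * ρ < a) (ξ : Sp n) {ζ : Fin n → ℂ} (hζ : ‖ζ‖ ≤ ρ) :
    (1 + ‖ξ‖) ^ M * ‖fourierLaplace f ((fun i => (ξ i : ℂ)) + ζ)‖ ≤
      (1 + n * ρ + n) ^ M * (B * expInt n (a - n * ρ)) := by
  set z : Fin n → ℂ := (fun i => (ξ i : ℂ)) + ζ with hz
  have hρ : 0 ≤ ρ := (norm_nonneg _).trans hζ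
  have hzim : ∀ i, |(z i).im| ≤ ρ := fun i => by
    simpa [hz] using (Complex.abs_im_le_norm _).trans ((norm_le_pi_norm ζ i).trans hζ)
  have h0 := norm_fourierLaplace_le hB0 hzim ha
  have h1 : ∀ j, ‖z j‖ ^ M * ‖fourierLaplace f z‖ ≤ B * expInt n (a - n * ρ) :=
    fun j => norm_pow_mul_fourierLaplace_le hf (hB j) hzim ha
  have h2 : ‖ξ‖ ≤ n * (ρ + ‖z‖) := by
    refine (norm_le_sum_abs ξ).trans ((Finset.sum_le_card_nsmul _ _ (ρ + ‖z‖) fun i _ => ?_).trans_eq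
      (by rw [nsmul_eq_mul, Finset.card_univ, Fintype.card_fin]))
    have e : (ξ i : ℂ) = z i - ζ i := by simp [hz]
    have := norm_sub_le (z i) (ζ i)
    rw [← e, Complex.norm_real, Real.norm_eq_abs] at this
    linarith [norm_le_pi_norm z i, (norm_le_pi_norm ζ i).trans hζ]
  -- The sup norm is attained at one coordinate, so the estimate along that coordinate suffices. The
  -- maximum with `1` covers small `z`, and in dimension zero only that case occurs.
  have h3 : max 1 ‖z‖ ^ M * ‖fourierLaplace f z‖ ≤ B * expInt n (a - n * ρ) := by
    rcases le_total ‖z‖ 1 with h | h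
    · rw [max_eq_left h, one_pow, one_mul]
      exact h0
    · rw [max_eq_right h]
      rcases isEmpty_or_nonempty (Fin n) with he | he
      · rw [Subsingleton.elim z 0, norm_zero] at h
        linarith
      · obtain ⟨j, hj⟩ := Finite.exists_max fun i => ‖z i‖
        have : ‖z‖ = ‖z j‖ := le_antisymm ((pi_norm_le_iff_of_nonempty z).2 hj) (norm_le_pi_norm z j)
        rw [this]
        exact h1 j
  have h4 : 1 + ‖ξ‖ ≤ (1 + n * ρ + n) * max 1 ‖z‖ := by
    have ha := le_max_left 1 ‖z‖
    have hb := le_max_right 1 ‖z‖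
    have hn : (0 : ℝ) ≤ n := n.cast_nonneg
    nlinarith [mul_nonneg hn hρ, mul_le_mul_of_nonneg_left hb hn, mul_nonneg (mul_nonneg hn hρ)
      (sub_nonneg.2 ha)]
  calc (1 + ‖ξ‖) ^ M * ‖fourierLaplace f z‖
      ≤ ((1 + n * ρ + n) * max 1 ‖z‖) ^ M * ‖fourierLaplace f z‖ :=
        mul_le_mul_of_nonneg_right (pow_le_pow_left₀ (by positivity) h4 _) (norm_nonneg _)
    _ = (1 + n * ρ + n) ^ M * (max 1 ‖z‖ ^ M * ‖fourierLaplace f z‖) := by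
        rw [mul_pow, mul_assoc]
    _ ≤ _ := mul_le_mul_of_nonneg_left h3 (by positivity)

/-! ### Derivatives of `1 / cosh(c|x|)` -/

/-- The entire function `w ↦ cosh(c√w)`. -/
theorem exists_entire_cosh_sqrt (c : ℝ) :
    ∃ h : ℂ → ℂ, Differentiable ℂ h ∧ ∀ u : ℂ, h (u ^ 2) = Complex.cosh (c * u) := by
  set a : ℕ → ℂ := fun k => ((2 * k).factorial : ℂ)⁻¹ with ha
  set p := FormalMultilinearSeries.ofScalars ℂ a with hp
  have hrad : p.radius = ⊤ := by
    refine FormalMultilinearSeries.ofScalars_radius_eq_top_of_tendsto ℂ a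
      (Eventually.of_forall fun k => inv_ne_zero (by exact_mod_cast Nat.factorial_ne_zero _)) ?_
    refine squeeze_zero (fun k => by positivity) (fun k => ?_)
      (tendsto_one_div_add_atTop_nhds_zero_nat (𝕜 := ℝ))
    have h1 : (2 * (k + 1)).factorial = (2 * k + 2) * ((2 * k + 1) * (2 * k).factorial) := by
      rw [show 2 * (k + 1) = 2 * k + 1 + 1 by ring, Nat.factorial_succ, Nat.factorial_succ]
    have h2 : (0 : ℝ) < (2 * k).factorial := by positivity
    simp only [ha, Nat.succ_eq_add_one, h1, norm_inv, Complex.norm_natCast]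
    push_cast
    rw [div_le_div_iff₀ (by positivity) (by positivity), inv_mul_eq_div, one_mul, div_le_iff₀
      (by positivity)]
    rw [inv_mul_eq_div, le_div_iff₀ h2]
    nlinarith [mul_nonneg h2.le (k.cast_nonneg (α := ℝ)),
      mul_nonneg (mul_nonneg h2.le (k.cast_nonneg (α := ℝ))) (k.cast_nonneg (α := ℝ))]
  have han : Differentiable ℂ p.sum := by
    have h := (p.hasFPowerSeriesOnBall (by rw [hrad]; simp)).analyticOnNhd
    rw [hrad, Metric.eball_top] at h
    exact fun z => (h z (Set.mem_univ z)).differentiableAt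
  refine ⟨fun w => p.sum (c ^ 2 * w), han.comp (differentiable_id.const_mul _), fun u => ?_⟩
  rw [Complex.cosh_eq_tsum, hp]
  change FormalMultilinearSeries.ofScalarsSum a ((c : ℂ) ^ 2 * u ^ 2) = _
  rw [FormalMultilinearSeries.ofScalars_sum_eq]
  refine tsum_congr fun k => ?_
  rw [ha, smul_eq_mul, pow_mul, mul_pow]
  ring

/-- One has `|cosh u|² = sinh²(Re u) + cos²(Im u)`. In this strip the cosine term is at least `1/2`,
which keeps at least half of `cosh²(Re u)`. -/
theorem norm_cosh_lower {u : ℂ} (h : |u.im| ≤ Real.pi / 4) :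
    Real.exp |u.re| / 4 ≤ ‖Complex.cosh u‖ := by
  have h1 : ‖Complex.cosh u‖ ^ 2 = Real.sinh u.re ^ 2 + Real.cos u.im ^ 2 := by
    rw [← Complex.normSq_eq_norm_sq]
    conv_lhs => rw [← Complex.re_add_im u, Complex.cosh_add, Complex.cosh_mul_I, Complex.sinh_mul_I]
    rw [← Complex.ofReal_cosh, ← Complex.ofReal_sinh, ← Complex.ofReal_cos, ← Complex.ofReal_sin]
    have : (Real.cosh u.re : ℂ) * (Real.cos u.im : ℂ) +
        (Real.sinh u.re : ℂ) * ((Real.sin u.im : ℂ) * Complex.I) =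
        ((Real.cosh u.re * Real.cos u.im : ℝ) : ℂ) +
          ((Real.sinh u.re * Real.sin u.im : ℝ) : ℂ) * Complex.I := by
      push_cast
      ring
    rw [this, Complex.normSq_add_mul_I]
    nlinarith [Real.cosh_sq u.re, Real.sin_sq_add_cos_sq u.im]
  have h2 : 1 / 2 ≤ Real.cos u.im ^ 2 := by
    rw [Real.cos_sq]
    have := Real.cos_nonneg_of_neg_pi_div_two_le_of_le (x := 2 * u.im)
      (by linarith [(abs_le.1 h).1]) (by linarith [(abs_le.1 h).2])
    linarith
  have h3 : Real.exp |u.re| / 2 ≤ Real.cosh u.re := by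
    rw [← Real.cosh_abs, Real.cosh_eq]
    linarith [Real.exp_pos (-|u.re|)]
  have h4 := Real.cosh_sq u.re
  refine le_of_sq_le_sq ?_ (norm_nonneg _)
  have h5 := Real.exp_pos |u.re|
  nlinarith [mul_self_le_mul_self (by positivity) h3]

/-- The right side of `hu` is the holomorphic extension of `|x + t e_j|²` to complex `t = z`. It
equals `(x_j + z)²` plus the nonnegative number `|x|² - x_j²`, which cannot enlarge the imaginary
part of a square root. So `c u` stays in the strip of `norm_cosh_lower`. -/
theorem norm_cosh_quadratic_lower {c : ℝ} (hc : 0 < c) {x : Sp n} (j : Fin n) {z u : ℂ}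
    (hz : |z.im| ≤ Real.pi / (4 * c)) (hu : u ^ 2 = (‖x‖ ^ 2 : ℝ) + 2 * (x j : ℝ) * z + z ^ 2) :
    Real.exp (c * (‖x‖ - |z.re| - |z.im|)) / 4 ≤ ‖Complex.cosh (c * u)‖ := by
  have hre : u.re ^ 2 - u.im ^ 2 = ‖x‖ ^ 2 + 2 * x j * z.re + z.re ^ 2 - z.im ^ 2 := by
    have := congrArg Complex.re hu
    simp [pow_two] at this
    linarith
  have him : u.re * u.im = (x j + z.re) * z.im := by
    have := congrArg Complex.im hu
    simp [pow_two] at this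
    linarith
  have hxj : x j ^ 2 ≤ ‖x‖ ^ 2 := by
    rw [sq_le_sq, abs_of_nonneg (norm_nonneg x)]
    exact PiLp.norm_apply_le x j
  -- Otherwise the real part of `hu` would make `|Re u|` exceed `|x_j + Re z|` as well,
  -- contradicting the equality of products in `him`.
  have h1 : u.im ^ 2 ≤ z.im ^ 2 := by
    by_contra! h
    have h2 : (x j + z.re) ^ 2 < u.re ^ 2 := by nlinarith
    have h3 := mul_lt_mul'' h2 h (sq_nonneg _) (sq_nonneg _)
    rw [← mul_pow, ← mul_pow, him] at h3
    exact lt_irrefl _ h3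
  have h1' : |u.im| ≤ |z.im| := sq_le_sq.1 h1
  have h4 : ‖x‖ - |z.re| - |z.im| ≤ |u.re| := by
    have hxj' := PiLp.norm_apply_le x j
    rw [Real.norm_eq_abs] at hxj'
    have h5 : (‖x‖ - |z.re|) ^ 2 ≤ (|u.re| + |z.im|) ^ 2 := by
      have e1 : -(|x j| * |z.re|) ≤ x j * z.re := by
        rw [← abs_mul]; exact neg_abs_le _
      have e2 := mul_le_mul_of_nonneg_right hxj' (abs_nonneg z.re)
      nlinarith [sq_abs z.re, sq_abs u.re, sq_abs z.im, mul_nonneg (abs_nonneg u.re) (abs_nonneg z.im),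
        sq_nonneg u.im]
    linarith [(le_abs_self _).trans (abs_le_of_sq_le_sq h5 (by positivity))]
  refine le_trans ?_ (norm_cosh_lower (u := c * u) ?_)
  · refine div_le_div_of_nonneg_right (Real.exp_le_exp.2 ?_) (by norm_num)
    rw [Complex.re_ofReal_mul, abs_mul, abs_of_pos hc]
    exact mul_le_mul_of_nonneg_left h4 hc.le
  · rw [Complex.im_ofReal_mul, abs_mul, abs_of_pos hc]
    calc c * |u.im| ≤ c * (Real.pi / (4 * c)) := mul_le_mul_of_nonneg_left (h1'.trans hz) hc.le
      _ = Real.pi / 4 := by field_simp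

/-- The function `1 / cosh(c|x|)`. -/
def sechNorm (n : ℕ) (c : ℝ) (x : Sp n) : ℂ := ((Real.cosh (c * ‖x‖) : ℝ) : ℂ)⁻¹

theorem contDiff_sechNorm (c : ℝ) : ContDiff ℝ ∞ (sechNorm n c) := by
  refine ContDiff.inv (Complex.ofRealCLM.contDiff.comp (contDiff_cosh_norm c)) fun x => ?_
  exact_mod_cast (Real.cosh_pos _).ne'

theorem norm_add_smul_single_sq (x : Sp n) (j : Fin n) (t : ℝ) :
    ‖x + t • EuclideanSpace.single j (1 : ℝ)‖ ^ 2 = ‖x‖ ^ 2 + 2 * x j * t + t ^ 2 := by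
  rw [norm_add_sq_real, norm_smul, inner_smul_right, EuclideanSpace.inner_single_right]
  simp
  ring

/-- Along each coordinate direction the function extends holomorphically to a strip of width
independent of `x`, and remains `O(e^{-c|x|})` on a disc of fixed radius. Cauchy's estimates give
the derivatives the same rate of decay. -/
theorem exists_norm_dirD_sechNorm_le {c : ℝ} (hc : 0 < c) (M : ℕ) : ∃ B : ℝ, 0 ≤ B ∧
    ∀ (j : Fin n), ∀ k ≤ M, ∀ x, ‖(dirD j)^[k] (sechNorm n c) x‖ ≤ B * Real.exp (-c * ‖x‖) := by
  obtain ⟨h, hd, hh⟩ := exists_entire_cosh_sqrt c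
  set r : ℝ := Real.pi / (4 * c) with hr
  have hr0 : 0 < r := by positivity
  set G : Fin n → Sp n → ℂ → ℂ := fun j x z =>
    (h ((‖x‖ ^ 2 : ℝ) + 2 * (x j : ℝ) * z + z ^ 2))⁻¹ with hG
  have hlow : ∀ (j : Fin n) (x : Sp n) (z : ℂ), |z.im| ≤ r → Real.exp (c * (‖x‖ - |z.re| - |z.im|)) / 4 ≤
      ‖h ((‖x‖ ^ 2 : ℝ) + 2 * (x j : ℝ) * z + z ^ 2)‖ := by
    intro j x z hz
    obtain ⟨u, hu⟩ := IsAlgClosed.exists_pow_nat_eq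
      (((‖x‖ ^ 2 : ℝ) : ℂ) + 2 * (x j : ℝ) * z + z ^ 2) (n := 2) (by norm_num)
    rw [← hu, hh]
    exact norm_cosh_quadratic_lower hc j hz hu
  have hne : ∀ (j : Fin n) (x : Sp n) (z : ℂ), |z.im| ≤ r →
      h ((‖x‖ ^ 2 : ℝ) + 2 * (x j : ℝ) * z + z ^ 2) ≠ 0 := fun j x z hz =>
    norm_pos_iff.1 (lt_of_lt_of_le (by positivity) (hlow j x z hz))
  have hGd : ∀ (j : Fin n) (x : Sp n) (z : ℂ), |z.im| ≤ r → DifferentiableAt ℂ (G j x) z := fun j x z hz => by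
    refine DifferentiableAt.inv ?_ (hne j x z hz)
    exact hd.differentiableAt.comp z (by fun_prop)
  have hGreal : ∀ (j : Fin n) (x : Sp n) (t : ℝ), G j x t =
      sechNorm n c (x + t • EuclideanSpace.single j (1 : ℝ)) := by
    intro j x t
    have e : ((‖x‖ ^ 2 : ℝ) : ℂ) + 2 * (x j : ℝ) * (t : ℂ) + (t : ℂ) ^ 2 =
        ((‖x + t • EuclideanSpace.single j (1 : ℝ)‖ : ℝ) : ℂ) ^ 2 := by
      rw [← Complex.ofReal_pow ‖x + t • EuclideanSpace.single j (1 : ℝ)‖, norm_add_smul_single_sq]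
      push_cast
      ring
    simp only [hG]
    rw [e, hh, sechNorm]
    push_cast
    rfl
  have hGshift : ∀ (j : Fin n) (x : Sp n) (t : ℝ), G j (x + t • EuclideanSpace.single j (1 : ℝ)) =
      fun z => G j x (z + t) := by
    intro j x t
    funext z
    simp only [hG, norm_add_smul_single_sq]
    congr 2
    simp
    ring
  have hana : ∀ j x k, DifferentiableAt ℂ (iteratedDeriv k (G j x)) 0 := by
    intro j x k
    have ho : IsOpen {z : ℂ | |z.im| < r} :=
      isOpen_lt (continuous_abs.comp Complex.continuous_im) continuous_const
    have : AnalyticAt ℂ (G j x) 0 := by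
      refine DifferentiableOn.analyticAt (s := {z : ℂ | |z.im| < r}) (fun z hz =>
        (hGd j x z (le_of_lt hz)).differentiableWithinAt) (ho.mem_nhds ?_)
      simpa using hr0
    rw [iteratedDeriv_eq_iterate]
    exact (this.iterated_deriv k).differentiableAt
  -- Real directional derivatives at `x` are complex derivatives of `G j x` at `0`; `hGshift` moves
  -- the base point along the line in the induction.
  have key : ∀ j k x, (dirD j)^[k] (sechNorm n c) x = iteratedDeriv k (G j x) 0 := by
    intro j k
    induction k with
    | zero =>
      intro x
      have := hGreal j x 0
      simp only [zero_smul, add_zero, Complex.ofReal_zero] at this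
      simp [this]
    | succ k ih =>
      intro x
      rw [Function.iterate_succ_apply', dirD]
      have hdiff := ((contDiff_dirD_iterate j (contDiff_sechNorm (n := n) c) k).differentiable
        (by simp)) x
      have h1 : HasDerivAt (fun t : ℝ => (dirD j)^[k] (sechNorm n c)
          (x + t • EuclideanSpace.single j (1 : ℝ))) _ 0 :=
        hdiff.hasFDerivAt.hasLineDerivAt (EuclideanSpace.single j (1 : ℝ))
      have h2 : (fun t : ℝ => (dirD j)^[k] (sechNorm n c)
          (x + t • EuclideanSpace.single j (1 : ℝ))) =
          fun t : ℝ => iteratedDeriv k (G j x) (t : ℂ) := by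
        funext t
        rw [ih, hGshift, iteratedDeriv_comp_add_const]
        simp only [zero_add]
      rw [h2] at h1
      have h3 : HasDerivAt (fun t : ℝ => iteratedDeriv k (G j x) (t : ℂ))
          (deriv (iteratedDeriv k (G j x)) ((0 : ℝ) : ℂ)) 0 :=
        HasDerivAt.comp_ofReal (by simpa using (hana j x k).hasDerivAt)
      rw [h1.unique h3, iteratedDeriv_succ, Complex.ofReal_zero]
  -- On the circle of radius `r` one has `|Re z| + |Im z| ≤ 2r`, which costs the factor `e^{2cr}`.
  -- Summing the Cauchy constants over `k` gives one bound for all orders.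
  refine ⟨∑ k ∈ Finset.range (M + 1), k.factorial * (4 * Real.exp (c * (2 * r))) / r ^ k,
    Finset.sum_nonneg fun k _ => by positivity, fun j k hk x => ?_⟩
  rw [key]
  have hb := Complex.norm_iteratedDeriv_le_of_forall_mem_sphere_norm_le (c := (0 : ℂ)) (f := G j x)
    (C := 4 * Real.exp (c * (2 * r)) * Real.exp (-c * ‖x‖)) k hr0 ?_ ?_
  · refine hb.trans ?_
    have := Finset.single_le_sum
      (f := fun k : ℕ => (k.factorial : ℝ) * (4 * Real.exp (c * (2 * r))) / r ^ k)
      (fun k _ => by positivity) (Finset.mem_range.2 (Nat.lt_succ_of_le hk))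
    refine le_trans (le_of_eq ?_) (mul_le_mul_of_nonneg_right this (Real.exp_pos _).le)
    ring
  · refine DifferentiableOn.diffContOnCl fun z hz => (hGd j x z ?_).differentiableWithinAt
    have := Metric.closure_ball_subset_closedBall hz
    rw [mem_closedBall_zero_iff] at this
    exact (Complex.abs_im_le_norm z).trans this
  · intro z hz
    rw [mem_sphere_zero_iff_norm] at hz
    have h1 := hlow j x z ((Complex.abs_im_le_norm z).trans hz.le)
    simp only [hG]
    rw [norm_inv]
    have h2 : Real.exp (c * (‖x‖ - 2 * r)) / 4 ≤
        ‖h ((‖x‖ ^ 2 : ℝ) + 2 * (x j : ℝ) * z + z ^ 2)‖ := by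
      refine le_trans ?_ h1
      refine div_le_div_of_nonneg_right (Real.exp_le_exp.2 (mul_le_mul_of_nonneg_left ?_ hc.le))
        (by norm_num)
      linarith [Complex.abs_im_le_norm z, Complex.abs_re_le_norm z]
    refine (inv_anti₀ (by positivity) h2).trans_eq ?_
    rw [inv_div, mul_assoc, ← Real.exp_add, div_eq_mul_inv, ← Real.exp_neg]
    ring_nf

/-! ### The Fourier-Laplace transform of test functions -/

theorem wordD_cons (i : Fin n) (w : List (Fin n)) (f : Test n) :
    wordD (i :: w) f = partialD i (wordD w f) := by
  simp [wordD, Module.End.mul_apply]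

theorem dirD_test (j : Fin n) (f : Test n) : dirD j f = partialD j f :=
  funext fun x => (partialD_eq_fderiv j f x).symm

theorem dirD_iterate_test (j : Fin n) (f : Test n) (k : ℕ) :
    (dirD j)^[k] f = wordD (List.replicate k j) f := by
  induction k with
  | zero => rfl
  | succ k ih => rw [Function.iterate_succ_apply', ih, dirD_test, List.replicate_succ, wordD_cons]

/-- On `K` the function `e^{a|x|}` is bounded, so any exponential rate is available. The constant
depends on `K` and `a`, but neither on the test function nor on the order. -/
theorem exists_norm_dirD_test_le {K : Set (Sp n)} (hK : IsCompact K) (a : ℝ) : ∃ A : ℝ, 0 ≤ A ∧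
    ∀ (M : ℕ) (f : Test n), tsupport f ⊆ K → (∀ x, ‖f x‖ ≤ A * semi K M f * Real.exp (-a * ‖x‖)) ∧
      ∀ j, ∀ k ≤ M, ∀ x, ‖(dirD j)^[k] f x‖ ≤ A * semi K M f * Real.exp (-a * ‖x‖) := by
  obtain ⟨A, hA⟩ := hK.bddAbove_image (f := fun x : Sp n => Real.exp (a * ‖x‖))
    (by fun_prop)
  have key : ∀ (M : ℕ) (f : Test n), tsupport f ⊆ K → ∀ w : List (Fin n), w.length ≤ M → ∀ x,
      ‖wordD w f x‖ ≤ max A 0 * semi K M f * Real.exp (-a * ‖x‖) := by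
    intro M f hf w hw x
    by_cases hx : x ∈ K
    · have h1 : Real.exp (a * ‖x‖) ≤ max A 0 := (hA ⟨x, hx, rfl⟩).trans (le_max_left _ _)
      have h2 := le_semi f hw hx
      have h3 : 1 ≤ max A 0 * Real.exp (-a * ‖x‖) := by
        have := mul_le_mul_of_nonneg_right h1 (Real.exp_pos (-a * ‖x‖)).le
        rwa [← Real.exp_add, neg_mul, add_neg_cancel, Real.exp_zero, ← neg_mul] at this
      nlinarith [mul_le_mul_of_nonneg_left h3 (semi_nonneg K M f)]
    · rw [image_eq_zero_of_notMem_tsupport fun h => hx (hf (tsupport_wordD w f h)), norm_zero]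
      exact mul_nonneg (mul_nonneg (le_max_right _ _) (semi_nonneg _ _ _)) (Real.exp_pos _).le
  refine ⟨max A 0, le_max_right _ _, fun M f hf => ⟨key M f hf [] (Nat.zero_le _),
    fun j k hk x => ?_⟩⟩
  rw [dirD_iterate_test]
  exact key M f hf _ (by simpa using hk) x

theorem exists_norm_test_le (f : Test n) (a : ℝ) : ∃ B : ℝ, ∀ x,
    ‖f x‖ ≤ B * Real.exp (-a * ‖x‖) := by
  obtain ⟨A, -, H⟩ := exists_norm_dirD_test_le f.hasCompactSupport a
  exact ⟨_, (H 0 f le_rfl).1⟩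

theorem exists_im_le (z : Fin n → ℂ) : ∀ i, |(z i).im| ≤ ‖z‖ := fun i =>
  (Complex.abs_im_le_norm _).trans (norm_le_pi_norm z i)

theorem fourierLaplace_partialD (f : Test n) (j : Fin n) (z : Fin n → ℂ) :
    fourierLaplace (partialD j f) z = -(Complex.I * z j) * fourierLaplace f z := by
  obtain ⟨A, -, H⟩ := exists_norm_dirD_test_le f.hasCompactSupport (n * ‖z‖ + 1)
  have H1 := H 1 f le_rfl
  rw [← dirD_test]
  exact fourierLaplace_dirD f.contDiff j H1.1 (H1.2 j 1 le_rfl) (exists_im_le z)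
    (lt_add_one _)

theorem integrable_exp_pair_mul_test (f : Test n) (z : Fin n → ℂ) :
    Integrable fun x => Complex.exp (Complex.I * pair x z) * f x := by
  obtain ⟨B, hB⟩ := exists_norm_test_le f (n * ‖z‖ + 1)
  exact integrable_exp_pair_mul f.continuous hB (exists_im_le z) (lt_add_one _)

theorem fourierLaplace_add (f g : Test n) (z : Fin n → ℂ) :
    fourierLaplace (f + g : Test n) z = fourierLaplace f z + fourierLaplace g z := by
  rw [fourierLaplace, fourierLaplace, fourierLaplace, ← integral_add
    (integrable_exp_pair_mul_test f z) (integrable_exp_pair_mul_test g z)]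
  exact integral_congr_ae (Eventually.of_forall fun x => mul_add _ _ _)

theorem fourierLaplace_smul (c : ℂ) (f : Test n) (z : Fin n → ℂ) :
    fourierLaplace (c • f : Test n) z = c * fourierLaplace f z := by
  rw [fourierLaplace, fourierLaplace, ← integral_const_mul]
  exact integral_congr_ae (Eventually.of_forall fun x => mul_left_comm _ _ _)

/-- The Fourier-Laplace transform at `z` as a linear functional on test functions. -/
def fourierLaplaceLM (z : Fin n → ℂ) : Test n →ₗ[ℂ] ℂ where
  toFun f := fourierLaplace f z
  map_add' f g := fourierLaplace_add f g z
  map_smul' c f := fourierLaplace_smul c f z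

/-- The operator `D_i = -i ∂_i` on test functions. -/
def testD (i : Fin n) : Module.End ℂ (Test n) := (-Complex.I) • partialD i

/-- The operator `D^α` on test functions. -/
def testDpow (α : Fin n →₀ ℕ) : Module.End ℂ (Test n) :=
  ((List.finRange n).map fun i => testD i ^ α i).prod

/-- The transpose of `p(D)`, for a polynomial `p` of degree at most `m`. -/
def testTranspose (m : ℕ) (p : MvPolynomial (Fin n) ℂ) : Module.End ℂ (Test n) :=
  ∑ α ∈ multiIdx n m, (p.coeff (Finsupp.equivFunOnFinite.symm α) * (-1) ^ ∑ i, α i) •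
    testDpow (Finsupp.equivFunOnFinite.symm α)

theorem fourierLaplace_testD_pow (i : Fin n) (k : ℕ) (f : Test n) (z : Fin n → ℂ) :
    fourierLaplace ((testD i ^ k) f) z = (-z i) ^ k * fourierLaplace f z := by
  induction k with
  | zero => simp
  | succ k ih =>
    rw [pow_succ', Module.End.mul_apply]
    change fourierLaplace ((-Complex.I) • partialD i ((testD i ^ k) f) : Test n) z = _
    rw [fourierLaplace_smul, fourierLaplace_partialD, ih]
    linear_combination (z i * (-z i) ^ k * fourierLaplace f z) * Complex.I_mul_I

theorem fourierLaplace_testDpow (α : Fin n →₀ ℕ) (f : Test n) (z : Fin n → ℂ) :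
    fourierLaplace (testDpow α f) z = (∏ i, (-z i) ^ α i) * fourierLaplace f z := by
  have key : ∀ l : List (Fin n), fourierLaplace ((l.map fun i => testD i ^ α i).prod f) z =
      (l.map fun i => (-z i) ^ α i).prod * fourierLaplace f z := by
    intro l
    induction l with
    | nil => simp
    | cons i l ih =>
      rw [List.map_cons, List.prod_cons, Module.End.mul_apply, fourierLaplace_testD_pow, ih,
        List.map_cons, List.prod_cons, mul_assoc]
  rw [testDpow, key, ← List.ofFn_eq_map, List.prod_ofFn]

/-- Under the kernel `e^{ix·z}` each `D_j` becomes multiplication by `-z_j`, and these signs cancel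
the `(-1)^{|α|}` of the transpose. -/
theorem fourierLaplace_testTranspose {m : ℕ} {p : MvPolynomial (Fin n) ℂ} (hp : p.totalDegree ≤ m)
    (f : Test n) (z : Fin n → ℂ) :
    fourierLaplace (testTranspose m p f) z = MvPolynomial.eval z p * fourierLaplace f z := by
  change fourierLaplaceLM z (testTranspose m p f) = _
  rw [testTranspose, LinearMap.sum_apply, map_sum, eval_eq_sum_multiIdx hp, Finset.sum_mul]
  refine Finset.sum_congr rfl fun α _ => ?_
  rw [LinearMap.smul_apply, map_smul, smul_eq_mul]
  change _ * fourierLaplace (testDpow _ f) z = _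
  rw [fourierLaplace_testDpow, mul_assoc, mul_assoc, ← mul_assoc ((-1) ^ _),
    ← Finset.prod_pow_eq_pow_sum, ← Finset.prod_mul_distrib]
  congr 2
  refine Finset.prod_congr rfl fun i _ => ?_
  rw [Finsupp.equivFunOnFinite_symm_apply_apply, ← mul_pow]
  ring

theorem measurable_fourierLaplace {f : Sp n → ℂ} (hf : Continuous f) :
    Measurable (fourierLaplace f) := by
  have hc : Continuous fun q : (Fin n → ℂ) × Sp n =>
      Complex.exp (Complex.I * pair q.2 q.1) * f q.2 :=
    (Complex.continuous_exp.comp (continuous_const.mul (continuous_pair.comp continuous_swap))).mul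
      (hf.comp continuous_snd)
  exact (hc.stronglyMeasurable.integral_prod_right' (ν := volume)).measurable

/-! ### Mean value property and Fourier inversion -/

/-- The normalized measure on the parameters of the unit circle. -/
def circleMeasure : Measure ℝ :=
  ENNReal.ofReal (2 * Real.pi)⁻¹ • volume.restrict (Set.Ioc 0 (2 * Real.pi))

instance : IsProbabilityMeasure circleMeasure where
  measure_univ := by
    rw [circleMeasure, Measure.smul_apply, Measure.restrict_apply_univ, Real.volume_Ioc, sub_zero,
      smul_eq_mul, ← ENNReal.ofReal_mul (by positivity), inv_mul_cancel₀ (by positivity),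
      ENNReal.ofReal_one]

theorem integral_circleMeasure (F : ℂ → ℂ) :
    ∫ t, F (circleMap 0 1 t) ∂circleMeasure = Real.circleAverage F 0 1 := by
  rw [circleMeasure, integral_smul_measure, Real.circleAverage_def,
    intervalIntegral.integral_of_le (by positivity), ENNReal.toReal_ofReal (by positivity)]

theorem norm_circleMap_one (t : ℝ) : ‖circleMap 0 1 t‖ = 1 := by simp

/-- After exchanging integrals, the mean value property is applied to the entire function `e^{ix·(z
+ wθ)}` of `w` for each fixed `x`. Holomorphy of the transform itself is not needed. -/
theorem integral_fourierLaplace_circle {f : Sp n → ℂ} (hf : Continuous f) {B a ρ : ℝ}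
    (hB : ∀ x, ‖f x‖ ≤ B * Real.exp (-a * ‖x‖)) {z θ : Fin n → ℂ}
    (hz : ∀ t : ℝ, ∀ i, |((z + circleMap 0 1 t • θ) i).im| ≤ ρ) (ha : n * ρ < a) :
    ∫ t, fourierLaplace f (z + circleMap 0 1 t • θ) ∂circleMeasure = fourierLaplace f z := by
  unfold fourierLaplace
  rw [integral_integral_swap]
  · refine integral_congr_ae (Eventually.of_forall fun x => ?_)
    simp only
    rw [integral_mul_const]
    congr 1
    have h1 := integral_circleMeasure fun w => Complex.exp (Complex.I * pair x (z + w • θ))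
    rw [h1]
    have h2 : DiffContOnCl ℂ (fun w : ℂ => Complex.exp (Complex.I * pair x (z + w • θ)))
        (Metric.ball 0 |1|) := by
      refine Differentiable.diffContOnCl ?_
      simp_rw [pair_add_right, pair_smul_right]
      fun_prop
    have h3 := h2.circleAverage
    rw [h3, zero_smul, add_zero]
  · have hi : Integrable (fun y : ℝ × Sp n => (1 : ℝ) * (B * Real.exp (-(a - n * ρ) * ‖y.2‖)))
        (circleMeasure.prod volume) :=
      (integrable_const (1 : ℝ)).mul_prod ((integrable_exp_neg_norm (sub_pos.2 ha)).const_mul B)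
    refine hi.mono' ?_ (Eventually.of_forall fun y => ?_)
    · refine Continuous.aestronglyMeasurable ?_
      refine (Complex.continuous_exp.comp (continuous_const.mul (continuous_pair.comp
        (continuous_snd.prodMk (continuous_const.add
          (((continuous_circleMap 0 1).comp continuous_fst).smul continuous_const)))))).mul
        (hf.comp continuous_snd)
    · rw [one_mul]
      exact norm_exp_pair_mul_le hB (hz y.1) y.2

/-- The test function `f` as a Schwartz function. -/
abbrev toSchwartz (f : Test n) : 𝓢(Sp n, ℂ) := f.hasCompactSupport.toSchwartzMap f.contDiff

theorem fourierLaplace_ofReal (f : Test n) (ξ : Sp n) :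
    fourierLaplace f (fun i => (ξ i : ℂ)) = hat (toSchwartz f) (-ξ) := by
  rw [hat_apply, fourierLaplace]
  refine integral_congr_ae (Eventually.of_forall fun x => ?_)
  simp only
  rw [pair_ofReal, inner_neg_left, real_inner_comm]
  push_cast
  rw [neg_mul_neg]
  rfl

theorem integral_hat (φ : 𝓢(Sp n, ℂ)) : ∫ ξ, hat φ (-ξ) = (2 * Real.pi) ^ n * φ 0 := by
  rw [integral_neg_eq_self fun ξ => hat φ ξ]
  change ∫ ξ, (𝓕 φ) ((2 * Real.pi)⁻¹ • ξ) = _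
  rw [Measure.integral_comp_inv_smul_of_nonneg _ _ (by positivity), finrank_euclideanSpace_fin]
  have h1 : ∫ ξ, (𝓕 φ) ξ = (𝓕⁻ (𝓕 φ)) 0 := by
    rw [SchwartzMap.fourierInv_coe, Real.fourierInv_eq']
    simp
  rw [h1, FourierTransform.fourierInv_fourier_eq, Complex.real_smul]
  push_cast
  rfl

theorem integral_fourierLaplace (f : Test n) :
    ∫ ξ : Sp n, fourierLaplace f (fun i => (ξ i : ℂ)) = (2 * Real.pi) ^ n * f 0 := by
  simp_rw [fourierLaplace_ofReal]
  exact integral_hat _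

/-! ### The fundamental solution of a polynomial -/

/-- The function `θ` chooses for every `ξ` a circle of radius at most `ρ` on which `|p(ξ + ·)|` is
bounded below by `c` times the weight. -/
structure IsCircleChoice (m : ℕ) (p : MvPolynomial (Fin n) ℂ) (ρ c : ℝ)
    (θ : Sp n → Fin n → ℂ) : Prop where
  degree : p.totalDegree ≤ m
  ne_zero : p ≠ 0
  pos : 0 < c
  meas : Measurable θ
  bound : ∀ ξ, ‖θ ξ‖ ≤ ρ
  lower : ∀ ξ (z : ℂ), ‖z‖ = 1 →
    c * weight m p ξ ≤ ‖MvPolynomial.eval ((fun i => (ξ i : ℂ)) + z • θ ξ) p‖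

/-- The point `ξ + e^{it}θ(ξ)`. -/
def node (θ : Sp n → Fin n → ℂ) (y : Sp n × ℝ) : Fin n → ℂ :=
  (fun i => (y.1 i : ℂ)) + circleMap 0 1 y.2 • θ y.1

theorem measurable_node {θ : Sp n → Fin n → ℂ} (hθ : Measurable θ) : Measurable (node θ) := by
  have h1 : Measurable fun y : Sp n × ℝ => (fun i => (y.1 i : ℂ) : Fin n → ℂ) :=
    Continuous.measurable (by fun_prop)
  have h2 : Measurable fun y : Sp n × ℝ => circleMap 0 1 y.2 :=
    (continuous_circleMap 0 1).measurable.comp measurable_snd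
  exact h1.add (h2.smul (hθ.comp measurable_fst))

/-- The measure `dξ dt / 2π` over which the fundamental solution is an integral. -/
abbrev nodeMeasure (n : ℕ) : Measure (Sp n × ℝ) := (volume : Measure (Sp n)).prod circleMeasure

theorem integrable_japanese (n : ℕ) :
    Integrable fun ξ : Sp n => ((1 + ‖ξ‖) ^ (n + 1))⁻¹ := by
  have h1 : Integrable fun x : Sp n => (1 + ‖x‖) ^ (-((n : ℝ) + 1)) :=
    integrable_one_add_norm (by simp)
  refine h1.congr (Eventually.of_forall fun x => ?_)
  simp only
  rw [Real.rpow_neg (by positivity)]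
  norm_cast

/-- The integral of `(1 + |ξ|)^{-n-1}`. -/
def japInt (n : ℕ) : ℝ := ∫ ξ : Sp n, ((1 + ‖ξ‖) ^ (n + 1))⁻¹

theorem integrable_node_japanese (η : Sp n) :
    Integrable (fun y : Sp n × ℝ => ((1 + ‖y.1 - η‖) ^ (n + 1))⁻¹) (nodeMeasure n) := by
  have := ((integrable_japanese n).comp_sub_right η).mul_prod
    (integrable_const (1 : ℝ) (μ := circleMeasure))
  simpa using this

theorem integral_node_japanese (η : Sp n) :
    ∫ y, ((1 + ‖y.1 - η‖) ^ (n + 1))⁻¹ ∂nodeMeasure n = japInt n := by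
  rw [integral_prod _ (integrable_node_japanese η)]
  simp only [integral_const, probReal_univ, one_smul]
  exact integral_sub_right_eq_self (fun ξ : Sp n => ((1 + ‖ξ‖) ^ (n + 1))⁻¹) η

theorem norm_integral_node_le {G : Sp n × ℝ → ℂ} {A : ℝ} (η : Sp n)
    (h : ∀ y, ‖G y‖ ≤ A * ((1 + ‖y.1 - η‖) ^ (n + 1))⁻¹) :
    ‖∫ y, G y ∂nodeMeasure n‖ ≤ A * japInt n := by
  rw [← integral_node_japanese η, ← integral_const_mul]
  exact norm_integral_le_of_norm_le ((integrable_node_japanese η).const_mul A)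
    (Eventually.of_forall h)

/-! ### Division by the polynomial along the circles -/

namespace IsCircleChoice

variable {m : ℕ} {p : MvPolynomial (Fin n) ℂ} {ρ c : ℝ} {θ : Sp n → Fin n → ℂ}

theorem weight_pos (h : IsCircleChoice m p ρ c θ) (ξ : Sp n) : 0 < weight m p ξ := by
  obtain ⟨κ, hκ, H⟩ := exists_weight_lower h.degree h.ne_zero
  exact hκ.trans_le (H ξ)

theorem lower_node (h : IsCircleChoice m p ρ c θ) (y : Sp n × ℝ) :
    c * weight m p y.1 ≤ ‖MvPolynomial.eval (node θ y) p‖ :=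
  h.lower y.1 _ (norm_circleMap_one _)

theorem eval_node_ne_zero (h : IsCircleChoice m p ρ c θ) (y : Sp n × ℝ) :
    MvPolynomial.eval (node θ y) p ≠ 0 :=
  norm_pos_iff.1 ((mul_pos h.pos (h.weight_pos _)).trans_le (h.lower_node y))

theorem norm_smul_le (h : IsCircleChoice m p ρ c θ) (y : Sp n × ℝ) :
    ‖circleMap 0 1 y.2 • θ y.1‖ ≤ ρ := by
  rw [norm_smul, norm_circleMap_one, one_mul]
  exact h.bound _

theorem measurable_eval_node (h : IsCircleChoice m p ρ c θ) :
    Measurable fun y => MvPolynomial.eval (node θ y) p :=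
  (MvPolynomial.continuous_eval p).measurable.comp (measurable_node h.meas)

/-- Of the `m + n + 1` powers of decay, `m` pay for moving the weight from the centre `y.1` of the
circle to `η`, and the other `n + 1` give integrability. The freedom in `η` serves both the weighted
Fourier bound and moderateness. -/
theorem norm_div_le (h : IsCircleChoice m p ρ c θ) (η : Sp n) (y : Sp n × ℝ) {F : ℂ} {A : ℝ}
    (hF : (1 + ‖y.1 - η‖) ^ (m + n + 1) * ‖F‖ ≤ A) :
    ‖F / MvPolynomial.eval (node θ y) p‖ ≤
      (A * ((multiIdx n m).card : ℝ) ^ 2 / c / weight m p η) * ((1 + ‖y.1 - η‖) ^ (n + 1))⁻¹ := by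
  have hw := weight_le_mul h.degree y.1 η
  rw [norm_sub_rev] at hw
  have hη := h.weight_pos η
  have hc := h.pos
  set s : ℝ := 1 + ‖y.1 - η‖ with hs
  have hs0 : 0 < s := by positivity
  set k : ℝ := ((multiIdx n m).card : ℝ) ^ 2
  have h1 : c * weight m p η ≤ k * s ^ m * ‖MvPolynomial.eval (node θ y) p‖ := by
    have := mul_le_mul_of_nonneg_left (h.lower_node y) (by positivity : 0 ≤ k * s ^ m)
    nlinarith
  have hp0 : 0 < ‖MvPolynomial.eval (node θ y) p‖ := norm_pos_iff.2 (h.eval_node_ne_zero y)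
  rw [norm_div, div_le_iff₀ hp0]
  have e1 : s ^ (m + n + 1) = s ^ m * s ^ (n + 1) := by rw [add_assoc, pow_add]
  have hA : 0 ≤ A := le_trans (by positivity) hF
  have h2 : ‖F‖ ≤ A * (s ^ m * s ^ (n + 1))⁻¹ := by
    rw [← div_eq_mul_inv, le_div_iff₀ (by positivity), mul_comm, ← e1]
    exact hF
  refine h2.trans ?_
  have h3 : A * (s ^ m * s ^ (n + 1))⁻¹ =
      (A * (s ^ m * s ^ (n + 1))⁻¹ / (c * weight m p η)) * (c * weight m p η) := by
    field_simp
  rw [h3]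
  refine (mul_le_mul_of_nonneg_left h1 (by positivity)).trans_eq ?_
  field_simp

/-- The bound for the Fourier-Laplace transform along the nodes. -/
def flConst (n m : ℕ) (ρ a : ℝ) : ℝ := (1 + n * ρ + n) ^ (m + n + 1) * expInt n (a - n * ρ)

theorem norm_quot_le (h : IsCircleChoice m p ρ c θ) {f : Sp n → ℂ} (hf : ContDiff ℝ ∞ f)
    {B a : ℝ} (hB0 : ∀ x, ‖f x‖ ≤ B * Real.exp (-a * ‖x‖))
    (hB : ∀ j, ∀ k ≤ m + n + 1, ∀ x, ‖(dirD j)^[k] f x‖ ≤ B * Real.exp (-a * ‖x‖))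
    (ha : n * ρ < a) (η : Sp n) (y : Sp n × ℝ) :
    ‖fourierLaplace f (node θ y - fun i => (η i : ℂ)) / MvPolynomial.eval (node θ y) p‖ ≤
      (B * flConst n m ρ a * ((multiIdx n m).card : ℝ) ^ 2 / c / weight m p η) *
        ((1 + ‖y.1 - η‖) ^ (n + 1))⁻¹ := by
  refine h.norm_div_le η y ?_
  have e : (node θ y - fun i => (η i : ℂ)) =
      (fun i => (((y.1 - η) i : ℝ) : ℂ)) + circleMap 0 1 y.2 • θ y.1 := by
    ext i
    simp [node]
    ring
  rw [e]
  refine (one_add_norm_pow_mul_fourierLaplace_le hf hB0 hB ha (y.1 - η) (h.norm_smul_le y)).trans_eq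
    ?_
  rw [flConst]
  ring

/-- A Peetre-type inequality turns decay around the origin into decay around `ξ₀`, so that `1/p~`
can be taken at `ξ₀`, where the weight of a net can be bounded below. -/
theorem norm_quot_test_le (h : IsCircleChoice m p ρ c θ) {f : Sp n → ℂ} (hf : ContDiff ℝ ∞ f)
    {B a : ℝ} (hB0 : ∀ x, ‖f x‖ ≤ B * Real.exp (-a * ‖x‖))
    (hB : ∀ j, ∀ k ≤ m + n + 1, ∀ x, ‖(dirD j)^[k] f x‖ ≤ B * Real.exp (-a * ‖x‖))
    (ha : n * ρ < a) (ξ₀ : Sp n) (y : Sp n × ℝ) :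
    ‖fourierLaplace f (node θ y) / MvPolynomial.eval (node θ y) p‖ ≤
      ((1 + ‖ξ₀‖) ^ (m + n + 1) * (B * flConst n m ρ a) * ((multiIdx n m).card : ℝ) ^ 2 / c /
        weight m p ξ₀) * ((1 + ‖y.1 - ξ₀‖) ^ (n + 1))⁻¹ := by
  refine h.norm_div_le ξ₀ y ?_
  have h1 := one_add_norm_pow_mul_fourierLaplace_le hf hB0 hB ha y.1 (h.norm_smul_le y)
  have h2 : 1 + ‖y.1 - ξ₀‖ ≤ (1 + ‖ξ₀‖) * (1 + ‖y.1‖) := by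
    nlinarith [norm_sub_le y.1 ξ₀, mul_nonneg (norm_nonneg y.1) (norm_nonneg ξ₀)]
  calc (1 + ‖y.1 - ξ₀‖) ^ (m + n + 1) * ‖fourierLaplace f (node θ y)‖
      ≤ ((1 + ‖ξ₀‖) * (1 + ‖y.1‖)) ^ (m + n + 1) * ‖fourierLaplace f (node θ y)‖ :=
        mul_le_mul_of_nonneg_right (pow_le_pow_left₀ (by positivity) h2 _) (norm_nonneg _)
    _ = (1 + ‖ξ₀‖) ^ (m + n + 1) * ((1 + ‖y.1‖) ^ (m + n + 1) * ‖fourierLaplace f (node θ y)‖) := by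
        rw [mul_pow, mul_assoc]
    _ ≤ _ := by
        refine mul_le_mul_of_nonneg_left (h1.trans_eq ?_) (by positivity)
        rw [flConst]
        ring

theorem integrable_quot_test (h : IsCircleChoice m p ρ c θ) (f : Test n) :
    Integrable (fun y => fourierLaplace f (node θ y) / MvPolynomial.eval (node θ y) p)
      (nodeMeasure n) := by
  obtain ⟨A, -, H⟩ := exists_norm_dirD_test_le f.hasCompactSupport (n * ρ + 1)
  have H1 := H (m + n + 1) f le_rfl
  refine ((integrable_node_japanese 0).const_mul _).mono'
    (((measurable_fourierLaplace f.continuous).comp (measurable_node h.meas)).div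
      h.measurable_eval_node).aestronglyMeasurable
    (Eventually.of_forall (h.norm_quot_test_le f.contDiff H1.1 H1.2 (lt_add_one _) 0))

end IsCircleChoice

/-- The functional `f ↦ (2π)^{-n} ∫ f^(-ξ - e^{it}θ(ξ)) / p(ξ + e^{it}θ(ξ)) dξ dt/2π`. -/
def solFun (p : MvPolynomial (Fin n) ℂ) (θ : Sp n → Fin n → ℂ) (f : Test n) : ℂ :=
  ((2 * Real.pi) ^ n : ℂ)⁻¹ *
    ∫ y, fourierLaplace f (node θ y) / MvPolynomial.eval (node θ y) p ∂nodeMeasure n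

theorem norm_two_pi_pow_inv (n : ℕ) :
    ‖((2 * Real.pi) ^ n : ℂ)⁻¹‖ = ((2 * Real.pi) ^ n)⁻¹ := by
  rw [norm_inv, norm_pow, norm_mul, Complex.norm_real, Complex.norm_ofNat,
    Real.norm_of_nonneg Real.pi_pos.le]

/-- The constant in the bound for the fundamental solution on functions supported in `K` depends
on `p` only through the constant `c` and the weight at a point. -/
theorem exists_norm_solFun_le (m : ℕ) (ρ c : ℝ) (ξ₀ : Sp n) {K : Set (Sp n)}
    (hK : IsCompact K) : ∃ C : ℝ, ∀ p θ, IsCircleChoice m p ρ c θ → ∀ f : Test n, tsupport f ⊆ K →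
      ‖solFun p θ f‖ ≤ C / weight m p ξ₀ * semi K (m + n + 1) f := by
  obtain ⟨A, -, H⟩ := exists_norm_dirD_test_le hK (n * ρ + 1)
  refine ⟨((2 * Real.pi) ^ n)⁻¹ * ((1 + ‖ξ₀‖) ^ (m + n + 1) *
    (A * IsCircleChoice.flConst n m ρ (n * ρ + 1)) *
      ((multiIdx n m).card : ℝ) ^ 2 / c * japInt n), fun p θ h f hf => ?_⟩
  have H1 := H (m + n + 1) f hf
  rw [solFun, norm_mul, norm_two_pi_pow_inv]
  refine (mul_le_mul_of_nonneg_left (norm_integral_node_le ξ₀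
    (h.norm_quot_test_le f.contDiff H1.1 H1.2 (lt_add_one _) ξ₀)) (by positivity)).trans_eq ?_
  ring

/-! ### The distribution and its equation `p(D)E = δ` -/

theorem continuous_partialD (i : Fin n) : Continuous (partialD i : Test n → Test n) :=
  (TestFunction.lineDerivCLM ℂ (EuclideanSpace.single i (1 : ℝ)) : Test n →L[ℂ] Test n).continuous

theorem continuous_wordD (w : List (Fin n)) : Continuous (wordD w : Test n → Test n) := by
  induction w with
  | nil => exact continuous_id
  | cons i w ih =>
    have : (wordD (i :: w) : Test n → Test n) = fun f => partialD i (wordD w f) :=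
      funext fun f => wordD_cons i w f
    rw [this]
    exact (continuous_partialD i).comp ih

/-- A linear functional on test functions which satisfies seminorm estimates is a distribution. -/
theorem continuous_of_semi_bound (T : Test n →ₗ[ℂ] ℂ)
    (h : ∀ K : Set (Sp n), IsCompact K → ∃ (C : ℝ) (j : ℕ), ∀ f : Test n, tsupport f ⊆ K →
      ‖T f‖ ≤ C * semi K j f) : Continuous T := by
  rw [TestFunction.continuous_iff_continuous_comp]
  intro K hKΩ
  obtain ⟨C, j, H⟩ := h K K.isCompact
  set S := (List.finite_length_le (Fin n) j).toFinset
  -- The majorant uses sup norms over the whole space rather than over `K`, because these are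
  -- continuous functions of the test function.
  set Q : Test n → ℝ := fun f =>
    |C| * ∑ w ∈ S, ‖TestFunction.toBoundedContinuousFunctionCLM ℂ (wordD w f)‖ with hQ
  have hQc : Continuous Q := by
    refine continuous_const.mul (continuous_finsetSum _ fun w _ => ?_)
    exact ((TestFunction.toBoundedContinuousFunctionCLM ℂ).continuous.comp
      (continuous_wordD w)).norm
  have hQ0 : Q 0 = 0 := by
    simp only [hQ, map_zero, norm_zero, Finset.sum_const_zero, mul_zero]
  have hTQ : ∀ f : Test n, tsupport f ⊆ K → ‖T f‖ ≤ Q f := by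
    intro f hf
    refine (H f hf).trans ((mul_le_mul_of_nonneg_right (le_abs_self C) (semi_nonneg _ _ _)).trans
      (mul_le_mul_of_nonneg_left ?_ (abs_nonneg _)))
    refine semi_le (Finset.sum_nonneg fun _ _ => norm_nonneg _) fun w hw x _ => ?_
    refine (BoundedContinuousFunction.norm_coe_le_norm
      (TestFunction.toBoundedContinuousFunctionCLM ℂ (wordD w f)) x).trans ?_
    exact Finset.single_le_sum
      (f := fun w => ‖TestFunction.toBoundedContinuousFunctionCLM ℂ (wordD w f)‖)
      (fun _ _ => norm_nonneg _) (by simpa [S] using hw)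
  set L : ContDiffMapSupportedIn (Sp n) ℂ ⊤ K →ₗ[ℂ] ℂ :=
    T ∘ₗ (TestFunction.ofSupportedInCLM ℂ hKΩ).toLinearMap with hL
  change Continuous L
  refine continuous_of_continuousAt_zero L ?_
  rw [ContinuousAt, map_zero]
  have hc := hQc.comp (TestFunction.ofSupportedInCLM ℂ hKΩ).continuous
  have h0 : Tendsto (fun f => Q (TestFunction.ofSupportedInCLM ℂ hKΩ f)) (𝓝 0) (𝓝 0) := by
    have := hc.tendsto 0
    rw [Function.comp_apply, map_zero, hQ0] at this
    exact this
  exact squeeze_zero_norm (fun f => hTQ _ f.tsupport_subset) h0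

/-- The fundamental solution as a distribution. -/
def solDistr {m : ℕ} {p : MvPolynomial (Fin n) ℂ} {ρ c : ℝ} {θ : Sp n → Fin n → ℂ}
    (h : IsCircleChoice m p ρ c θ) : Distr n :=
  let T : Test n →ₗ[ℂ] ℂ :=
    { toFun := solFun p θ
      map_add' := fun f g => by
        rw [solFun, solFun, solFun, ← mul_add, ← integral_add (h.integrable_quot_test f)
          (h.integrable_quot_test g)]
        simp_rw [fourierLaplace_add, add_div]
      map_smul' := fun a f => by
        rw [solFun, solFun, RingHom.id_apply, smul_eq_mul, mul_left_comm]
        simp_rw [fourierLaplace_smul, mul_div_assoc]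
        rw [integral_const_mul] }
  ⟨T, continuous_of_semi_bound T fun _ hK =>
    let ⟨C, hC⟩ := exists_norm_solFun_le m ρ c 0 hK
    ⟨C / weight m p 0, m + n + 1, fun f hf => hC p θ h f hf⟩⟩

theorem solDistr_apply {m : ℕ} {p : MvPolynomial (Fin n) ℂ} {ρ c : ℝ} {θ : Sp n → Fin n → ℂ}
    (h : IsCircleChoice m p ρ c θ) (f : Test n) : solDistr h f = solFun p θ f := rfl

/-- The factor `p` from the transpose cancels the denominator; then the circle average collapses to
its centre and Fourier inversion at the origin applies. -/
theorem solDistr_transpose {m : ℕ} {p : MvPolynomial (Fin n) ℂ} {ρ c : ℝ} {θ : Sp n → Fin n → ℂ}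
    (h : IsCircleChoice m p ρ c θ) (f : Test n) : solDistr h (testTranspose m p f) = f 0 := by
  rw [solDistr_apply, solFun]
  have hi := h.integrable_quot_test (testTranspose m p f)
  have e : ∀ y, fourierLaplace (testTranspose m p f) (node θ y) / MvPolynomial.eval (node θ y) p =
      fourierLaplace f (node θ y) := fun y => by
    rw [fourierLaplace_testTranspose h.degree, mul_div_cancel_left₀ _ (h.eval_node_ne_zero y)]
  simp_rw [e] at hi ⊢
  rw [integral_prod _ hi]
  obtain ⟨B, hB⟩ := exists_norm_test_le f (n * ρ + 1)
  have e2 : ∀ ξ : Sp n, ∫ t, fourierLaplace f (node θ (ξ, t)) ∂circleMeasure =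
      fourierLaplace f fun i => (ξ i : ℂ) := by
    intro ξ
    have hz : ∀ t : ℝ, ∀ i, |(((fun i => (ξ i : ℂ)) + circleMap 0 1 t • θ ξ) i).im| ≤ ρ := by
      intro t i
      have hn := (exists_im_le (circleMap 0 1 t • θ ξ) i).trans (h.norm_smul_le (ξ, t))
      rw [Pi.add_apply, Complex.add_im, Complex.ofReal_im, zero_add]
      exact hn
    simp only [node]
    exact integral_fourierLaplace_circle f.continuous hB hz (lt_add_one (n * ρ))
  simp_rw [e2]
  rw [integral_fourierLaplace, inv_mul_cancel_left₀]
  simp [Real.pi_ne_zero]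

/-! ### The quotient of the fundamental solution by `cosh(c|x|)` -/

/-- The inverse of the Fourier transform `hat` on the Schwartz space. -/
def hatInv (n : ℕ) : 𝓢(Sp n, ℂ) →L[ℂ] 𝓢(Sp n, ℂ) :=
  FourierTransform.fourierInvCLM ℂ 𝓢(Sp n, ℂ) ∘L
    SchwartzMap.compCLMOfContinuousLinearEquiv ℂ
      (ContinuousLinearEquiv.smulLeft (Units.mk0 (2 * Real.pi) (by positivity)))

theorem hatInv_hat (φ : 𝓢(Sp n, ℂ)) : hatInv n (hat φ) = φ := by
  have h : SchwartzMap.compCLMOfContinuousLinearEquiv ℂ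
      (ContinuousLinearEquiv.smulLeft (Units.mk0 (2 * Real.pi) (by positivity))) (hat φ) = 𝓕 φ := by
    ext x
    change (𝓕 φ) ((2 * Real.pi)⁻¹ • ((2 * Real.pi) • x)) = _
    rw [inv_smul_smul₀ (by positivity)]
  change 𝓕⁻ (SchwartzMap.compCLMOfContinuousLinearEquiv ℂ
      (ContinuousLinearEquiv.smulLeft (Units.mk0 (2 * Real.pi) (by positivity))) (hat φ)) = φ
  rw [h, FourierTransform.fourierInv_fourier_eq]

theorem hat_hatInv (φ : 𝓢(Sp n, ℂ)) : hat (hatInv n φ) = φ := by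
  ext x
  change (𝓕 (𝓕⁻ (SchwartzMap.compCLMOfContinuousLinearEquiv ℂ
      (ContinuousLinearEquiv.smulLeft (Units.mk0 (2 * Real.pi) (by positivity))) φ)))
        ((2 * Real.pi)⁻¹ • x) = _
  rw [FourierTransform.fourier_fourierInv_eq]
  change φ ((2 * Real.pi) • ((2 * Real.pi)⁻¹ • x)) = _
  rw [smul_inv_smul₀ (by positivity)]

/-- The transform of a product is a convolution. The shifts `η` are real, so `z - η` stays in the
strip where the transform of `q` is defined. -/
theorem fourierLaplace_hat_mul {q : Sp n → ℂ} (hq : Continuous q) {B a ρ : ℝ}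
    (hB : ∀ x, ‖q x‖ ≤ B * Real.exp (-a * ‖x‖)) {z : Fin n → ℂ} (hz : ∀ i, |(z i).im| ≤ ρ)
    (ha : n * ρ < a) (φ : 𝓢(Sp n, ℂ)) :
    fourierLaplace (fun x => hat φ x * q x) z =
      ∫ η : Sp n, φ η * fourierLaplace q (z - fun i => (η i : ℂ)) := by
  have e1 : ∀ x η : Sp n, φ η * (Complex.exp (Complex.I * pair x (z - fun i => (η i : ℂ))) * q x) =
      Complex.exp (-Complex.I * inner ℝ x η) * φ η *
        (Complex.exp (Complex.I * pair x z) * q x) := by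
    intro x η
    have : pair x (z - fun i => (η i : ℂ)) = pair x z - (inner ℝ x η : ℝ) := by
      rw [← pair_ofReal, eq_sub_iff_add_eq, ← pair_add_right, sub_add_cancel]
    rw [this, mul_sub, sub_eq_add_neg, Complex.exp_add, neg_mul]
    ring
  have e2 : fourierLaplace (fun x => hat φ x * q x) z = ∫ x, ∫ η : Sp n,
      φ η * (Complex.exp (Complex.I * pair x (z - fun i => (η i : ℂ))) * q x) := by
    refine integral_congr_ae (Eventually.of_forall fun x => ?_)
    simp only [e1]
    rw [integral_mul_const, ← hat_apply]
    ring
  rw [e2, integral_integral_swap]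
  · refine integral_congr_ae (Eventually.of_forall fun η => ?_)
    simp only
    rw [integral_const_mul, fourierLaplace]
  · have hi := (integrable_exp_pair_mul hq hB hz ha).norm.mul_prod
      (φ.integrable (μ := volume)).norm
    refine hi.mono' (Continuous.aestronglyMeasurable ?_) (Eventually.of_forall fun y => ?_)
    · have h1 : Continuous fun y : Sp n × Sp n => pair y.1 (z - fun i => (y.2 i : ℂ)) :=
        continuous_pair.comp (continuous_fst.prodMk (by fun_prop))
      exact (φ.continuous.comp continuous_snd).mul ((Complex.continuous_exp.comp
        (continuous_const.mul h1)).mul (hq.comp continuous_fst))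
    · simp only [Function.uncurry, e1]
      rw [norm_mul, norm_mul, Complex.norm_exp]
      simp [mul_comm]

/-- The Fourier transform of the product of the fundamental solution and `q`. -/
def solHat (p : MvPolynomial (Fin n) ℂ) (θ : Sp n → Fin n → ℂ) (q : Sp n → ℂ) (η : Sp n) : ℂ :=
  ((2 * Real.pi) ^ n : ℂ)⁻¹ * ∫ y, fourierLaplace q (node θ y - fun i => (η i : ℂ)) /
    MvPolynomial.eval (node θ y) p ∂nodeMeasure n

namespace IsCircleChoice

variable {m : ℕ} {p : MvPolynomial (Fin n) ℂ} {ρ c : ℝ} {θ : Sp n → Fin n → ℂ} {q : Sp n → ℂ}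
  {B a : ℝ}

theorem measurable_quot (h : IsCircleChoice m p ρ c θ) (hq : Continuous q) :
    Measurable fun x : Sp n × (Sp n × ℝ) =>
      fourierLaplace q (node θ x.2 - fun i => (x.1 i : ℂ)) / MvPolynomial.eval (node θ x.2) p := by
  have h1 : Measurable fun x : Sp n × (Sp n × ℝ) => (fun i => (x.1 i : ℂ) : Fin n → ℂ) :=
    Continuous.measurable (by fun_prop)
  exact ((measurable_fourierLaplace hq).comp
    (((measurable_node h.meas).comp measurable_snd).sub h1)).div
      (h.measurable_eval_node.comp measurable_snd)

theorem stronglyMeasurable_solHat (h : IsCircleChoice m p ρ c θ) (hq : Continuous q) :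
    StronglyMeasurable (solHat p θ q) :=
  stronglyMeasurable_const.mul
    ((h.measurable_quot hq).stronglyMeasurable.integral_prod_right' (ν := nodeMeasure n))

/-- Pulling out `1/p~` exactly at `η` cancels the weight, so the bound is uniform in `p` and `η` for
given `c`. -/
theorem weight_mul_norm_solHat_le (h : IsCircleChoice m p ρ c θ) (hq : ContDiff ℝ ∞ q)
    (hB0 : ∀ x, ‖q x‖ ≤ B * Real.exp (-a * ‖x‖))
    (hB : ∀ j, ∀ k ≤ m + n + 1, ∀ x, ‖(dirD j)^[k] q x‖ ≤ B * Real.exp (-a * ‖x‖))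
    (ha : n * ρ < a) (η : Sp n) :
    weight m p η * ‖solHat p θ q η‖ ≤ ((2 * Real.pi) ^ n)⁻¹ *
      (B * flConst n m ρ a * ((multiIdx n m).card : ℝ) ^ 2 / c * japInt n) := by
  have hw := h.weight_pos η
  rw [solHat, norm_mul, norm_two_pi_pow_inv, mul_left_comm]
  refine mul_le_mul_of_nonneg_left ?_ (by positivity)
  refine (mul_le_mul_of_nonneg_left (norm_integral_node_le η
    (h.norm_quot_le hq hB0 hB ha η)) hw.le).trans_eq ?_
  field_simp

/-- This bound depends on `p`, through a lower bound of its weight. It serves only to make `solHat`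
the Fourier transform of a tempered distribution. -/
theorem exists_norm_solHat_le (h : IsCircleChoice m p ρ c θ) (hq : ContDiff ℝ ∞ q)
    (hB0 : ∀ x, ‖q x‖ ≤ B * Real.exp (-a * ‖x‖))
    (hB : ∀ j, ∀ k ≤ m + n + 1, ∀ x, ‖(dirD j)^[k] q x‖ ≤ B * Real.exp (-a * ‖x‖))
    (ha : n * ρ < a) : ∃ A, ∀ η, ‖solHat p θ q η‖ ≤ A := by
  obtain ⟨κ, hκ, H⟩ := exists_weight_lower h.degree h.ne_zero
  exact ⟨_, fun η => (le_div_iff₀' hκ).2 ((mul_le_mul_of_nonneg_right (H η) (norm_nonneg _)).trans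
    (h.weight_mul_norm_solHat_le hq hB0 hB ha η))⟩

/-- Justifies the exchange of integrals in the pairing below. The quotient has an integral over the
nodes bounded independently of `η`, so integrability of `φ` is enough. -/
theorem integrable_mul_quot (h : IsCircleChoice m p ρ c θ) (hq : ContDiff ℝ ∞ q)
    (hB0 : ∀ x, ‖q x‖ ≤ B * Real.exp (-a * ‖x‖))
    (hB : ∀ j, ∀ k ≤ m + n + 1, ∀ x, ‖(dirD j)^[k] q x‖ ≤ B * Real.exp (-a * ‖x‖))
    (ha : n * ρ < a) {φ : Sp n → ℂ} (hφ : Integrable φ) :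
    Integrable (fun x : Sp n × (Sp n × ℝ) =>
      φ x.1 * (fourierLaplace q (node θ x.2 - fun i => (x.1 i : ℂ)) /
        MvPolynomial.eval (node θ x.2) p)) (volume.prod (nodeMeasure n)) := by
  obtain ⟨κ, hκ, H⟩ := exists_weight_lower h.degree h.ne_zero
  have hm : AEStronglyMeasurable (fun x : Sp n × (Sp n × ℝ) =>
      φ x.1 * (fourierLaplace q (node θ x.2 - fun i => (x.1 i : ℂ)) /
        MvPolynomial.eval (node θ x.2) p)) (volume.prod (nodeMeasure n)) :=
    hφ.aestronglyMeasurable.comp_fst.mul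
      (h.measurable_quot hq.continuous).aestronglyMeasurable
  set A := B * flConst n m ρ a * ((multiIdx n m).card : ℝ) ^ 2 / c with hA
  have hB' : 0 ≤ B := by
    have := (norm_nonneg _).trans (hB0 0)
    simpa using this
  have hA0 : 0 ≤ A := by
    have := h.pos
    have hρ := (norm_nonneg _).trans (h.bound 0)
    have := expInt_nonneg n (a - n * ρ)
    rw [hA, flConst]
    positivity
  have hle : ∀ (η : Sp n) (y : Sp n × ℝ),
      ‖fourierLaplace q (node θ y - fun i => (η i : ℂ)) / MvPolynomial.eval (node θ y) p‖ ≤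
      (A / κ) * ((1 + ‖y.1 - η‖) ^ (n + 1))⁻¹ := fun η y =>
    (h.norm_quot_le hq hB0 hB ha η y).trans (mul_le_mul_of_nonneg_right
      (div_le_div_of_nonneg_left hA0 hκ (H η)) (by positivity))
  have hquot : ∀ η : Sp n, Integrable (fun y => fourierLaplace q (node θ y - fun i => (η i : ℂ)) /
      MvPolynomial.eval (node θ y) p) (nodeMeasure n) := fun η =>
    ((integrable_node_japanese η).const_mul (A / κ)).mono'
      ((h.measurable_quot hq.continuous).comp
        (measurable_prodMk_left (x := η))).aestronglyMeasurable
      (Eventually.of_forall (hle η))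
  rw [integrable_prod_iff hm]
  refine ⟨Eventually.of_forall fun η => (hquot η).const_mul (φ η), ?_⟩
  refine (hφ.norm.mul_const (A / κ * japInt n)).mono' hm.norm.integral_prod_right'
    (Eventually.of_forall fun η => ?_)
  rw [Real.norm_of_nonneg (integral_nonneg fun _ => norm_nonneg _)]
  simp only [norm_mul]
  rw [integral_const_mul]
  refine mul_le_mul_of_nonneg_left ?_ (norm_nonneg _)
  rw [← integral_node_japanese η, ← integral_const_mul]
  exact integral_mono (hquot η).norm ((integrable_node_japanese η).const_mul (A / κ)) (hle η)

/-- The pairing of the fundamental solution with a product `q φ^`. -/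
theorem integral_solHat_mul (h : IsCircleChoice m p ρ c θ) (hq : ContDiff ℝ ∞ q)
    (hB0 : ∀ x, ‖q x‖ ≤ B * Real.exp (-a * ‖x‖))
    (hB : ∀ j, ∀ k ≤ m + n + 1, ∀ x, ‖(dirD j)^[k] q x‖ ≤ B * Real.exp (-a * ‖x‖))
    (ha : n * ρ < a) (φ : 𝓢(Sp n, ℂ)) :
    ∫ η, solHat p θ q η * φ η = ((2 * Real.pi) ^ n : ℂ)⁻¹ *
      ∫ y, fourierLaplace (fun x => hat φ x * q x) (node θ y) /
        MvPolynomial.eval (node θ y) p ∂nodeMeasure n := by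
  have e1 : ∀ y, fourierLaplace (fun x => hat φ x * q x) (node θ y) /
      MvPolynomial.eval (node θ y) p = ∫ η : Sp n, φ η *
        (fourierLaplace q (node θ y - fun i => (η i : ℂ)) / MvPolynomial.eval (node θ y) p) := by
    intro y
    have hz : ∀ i, |(node θ y i).im| ≤ ρ := by
      intro i
      have hn := (exists_im_le (circleMap 0 1 y.2 • θ y.1) i).trans (h.norm_smul_le y)
      rw [node, Pi.add_apply, Complex.add_im, Complex.ofReal_im, zero_add]
      exact hn
    rw [fourierLaplace_hat_mul hq.continuous hB0 hz ha φ, ← integral_div]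
    simp_rw [mul_div_assoc]
  simp_rw [e1]
  rw [← integral_integral_swap (h.integrable_mul_quot hq hB0 hB ha φ.integrable),
    ← integral_const_mul]
  refine integral_congr_ae (Eventually.of_forall fun η => ?_)
  simp only
  rw [integral_const_mul, solHat]
  ring

end IsCircleChoice

/-- The tempered distribution whose Fourier transform is the bounded function `g`. -/
theorem exists_tempered_of_bounded {g : Sp n → ℂ} (hg : StronglyMeasurable g) {A : ℝ}
    (hA : ∀ η, ‖g η‖ ≤ A) :
    ∃ w : 𝓢'(Sp n, ℂ), ∀ φ : 𝓢(Sp n, ℂ), w (hat φ) = ∫ ξ, g ξ * φ ξ := by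
  have hmem : MemLp g ⊤ := memLp_top_of_bound hg.aestronglyMeasurable A (Eventually.of_forall hA)
  refine ⟨PointwiseConvergenceCLM.precomp ℂ (hatInv n) (Lp.toTemperedDistribution hmem.toLp),
    fun φ => ?_⟩
  change Lp.toTemperedDistribution hmem.toLp (hatInv n (hat φ)) = _
  rw [hatInv_hat, Lp.toTemperedDistribution_apply]
  refine integral_congr_ae ?_
  filter_upwards [hmem.coeFn_toLp] with x hx
  rw [hx, smul_eq_mul, mul_comm]

theorem norm_sechNorm_le (c : ℝ) (x : Sp n) : ‖sechNorm n c x‖ ≤ 2 * Real.exp (-c * ‖x‖) := by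
  rw [sechNorm, norm_inv, Complex.norm_real, Real.norm_of_nonneg (Real.cosh_pos _).le, neg_mul,
    Real.exp_neg, ← div_eq_mul_inv, inv_le_comm₀ (Real.cosh_pos _) (by positivity), inv_div,
    Real.cosh_eq]
  linarith [Real.exp_pos (-(c * ‖x‖))]

theorem fourierLaplace_divCosh (c : ℝ) (f : Test n) :
    fourierLaplace (divCosh c f) = fourierLaplace fun x => toSchwartz f x * sechNorm n c x := by
  congr 1

theorem exists_isDivCosh_solDistr (n m : ℕ) {c ρ κ : ℝ} (hc : 0 < c) (hρ : n * ρ < c) :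
    ∃ C₀ : ℝ, ∀ p θ, ∀ h : IsCircleChoice (n := n) m p ρ κ θ, ∃ w : 𝓢'(Sp n, ℂ),
      IsDivCosh c (solDistr h) w ∧ MemB ⊤ (weight m p) w ∧
        normB ⊤ (weight m p) w ≤ ENNReal.ofReal C₀ := by
  obtain ⟨B, -, hB⟩ := exists_norm_dirD_sechNorm_le (n := n) hc (m + n + 1)
  have hB0 : ∀ x, ‖sechNorm n c x‖ ≤ max B 2 * Real.exp (-c * ‖x‖) := fun x =>
    (norm_sechNorm_le c x).trans
      (mul_le_mul_of_nonneg_right (le_max_right _ _) (Real.exp_pos _).le)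
  replace hB : ∀ (j : Fin n), ∀ k ≤ m + n + 1, ∀ x,
      ‖(dirD j)^[k] (sechNorm n c) x‖ ≤ max B 2 * Real.exp (-c * ‖x‖) := fun j k hk x =>
    (hB j k hk x).trans (mul_le_mul_of_nonneg_right (le_max_left _ _) (Real.exp_pos _).le)
  have hq := contDiff_sechNorm (n := n) c
  -- One factor `(2π)^{-n}` comes from the norm, the other from the fundamental solution.
  set C := ((2 * Real.pi) ^ n)⁻¹ * (((2 * Real.pi) ^ n)⁻¹ * (max B 2 *
    IsCircleChoice.flConst n m ρ c * ((multiIdx n m).card : ℝ) ^ 2 / κ * japInt n)) with hC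
  refine ⟨C, fun p θ h => ?_⟩
  obtain ⟨A, hA⟩ := h.exists_norm_solHat_le hq hB0 hB hρ
  obtain ⟨w, hw⟩ := exists_tempered_of_bounded (h.stronglyMeasurable_solHat hq.continuous) hA
  have hF : HasFourierFun w (solHat p θ (sechNorm n c)) := by
    refine ⟨?_, fun φ _ => hw φ⟩
    exact (memLp_top_of_bound (h.stronglyMeasurable_solHat hq.continuous).aestronglyMeasurable A
      (Eventually.of_forall hA)).locallyIntegrable le_top
  have hn : normB ⊤ (weight m p) w ≤ ENNReal.ofReal C := by
    refine (iInf₂_le _ hF).trans ?_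
    have h1 : eLpNorm (fun ξ => (weight m p ξ : ℂ) * solHat p θ (sechNorm n c) ξ) ⊤ ≤
        ENNReal.ofReal (((2 * Real.pi) ^ n)⁻¹ * (max B 2 *
          IsCircleChoice.flConst n m ρ c * ((multiIdx n m).card : ℝ) ^ 2 / κ * japInt n)) := by
      rw [eLpNorm_exponent_top]
      refine eLpNormEssSup_le_of_ae_bound (Eventually.of_forall fun ξ => ?_)
      rw [norm_mul, Complex.norm_real, Real.norm_of_nonneg (weight_nonneg _ _ _)]
      exact h.weight_mul_norm_solHat_le hq hB0 hB hρ ξ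
    refine (mul_le_mul_right h1 _).trans ?_
    rw [← ENNReal.ofReal_mul (by positivity)]
  refine ⟨w, fun f => ?_, ⟨⟨_, hF⟩, hn.trans_lt ENNReal.ofReal_lt_top⟩, hn⟩
  rw [solDistr_apply, solFun, fourierLaplace_divCosh]
  -- Every Schwartz function is a Fourier transform, so testing with `f` amounts to testing the
  -- transform with `hatInv n f`. That function need not have compact support, but `hw` holds for
  -- all Schwartz functions.
  have := h.integral_solHat_mul hq hB0 hB hρ (hatInv n (toSchwartz f))
  rw [hat_hatInv] at this
  rw [← this, ← hw, hat_hatInv]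

/-! ### Representatives of generalized numbers -/

namespace GenNum

variable {𝕜 : Type} [NormedField 𝕜]

theorem IsRep.add {r s : Idx → 𝕜} {z w : GenNum 𝕜} (hr : IsRep r z) (hs : IsRep s w) :
    IsRep (fun ε => r ε + s ε) (z + w) := by
  obtain ⟨h, rfl⟩ := hr
  obtain ⟨h', rfl⟩ := hs
  exact ⟨(ModNet 𝕜).add_mem h h', rfl⟩

theorem IsRep.mul {r s : Idx → 𝕜} {z w : GenNum 𝕜} (hr : IsRep r z) (hs : IsRep s w) :
    IsRep (fun ε => r ε * s ε) (z * w) := by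
  obtain ⟨h, rfl⟩ := hr
  obtain ⟨h', rfl⟩ := hs
  exact ⟨(ModNet 𝕜).mul_mem h h', rfl⟩

theorem isRep_const (a : 𝕜) : IsRep (fun _ => a) (const a) := ⟨Moderate.const ‖a‖, rfl⟩

theorem IsRep.pow {r : Idx → 𝕜} {z : GenNum 𝕜} (hr : IsRep r z) (k : ℕ) :
    IsRep (fun ε => r ε ^ k) (z ^ k) := by
  obtain ⟨h, rfl⟩ := hr
  exact ⟨(ModNet 𝕜).pow_mem h k, by rw [← map_pow]; rfl⟩

theorem isRep_natCast (k : ℕ) : IsRep (fun _ => (k : 𝕜)) (k : GenNum 𝕜) := by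
  rw [← map_natCast (const (𝕜 := 𝕜))]
  exact isRep_const _

theorem IsRep.sum {ι : Type} (t : Finset ι) {r : ι → Idx → 𝕜} {z : ι → GenNum 𝕜}
    (h : ∀ i ∈ t, IsRep (r i) (z i)) : IsRep (fun ε => ∑ i ∈ t, r i ε) (∑ i ∈ t, z i) := by
  classical
  induction t using Finset.induction_on with
  | empty => simpa using isRep_natCast (𝕜 := 𝕜) 0
  | insert i t hi ih =>
    simp_rw [Finset.sum_insert hi]
    exact (h i (Finset.mem_insert_self i t)).add
      (ih fun j hj => h j (Finset.mem_insert_of_mem hj))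

theorem IsRep.abs {r : Idx → 𝕜} {z : GenNum 𝕜} (hr : IsRep r z) :
    IsRep (fun ε => ‖r ε‖) (GenNum.abs z) := by
  obtain ⟨h, rfl⟩ := hr
  exact ⟨by simpa [ModNet] using h, rfl⟩

theorem IsRep.sqrt {r : Idx → ℝ} {z : GenNum ℝ} (hr : IsRep r z) :
    IsRep (fun ε => √(r ε)) (GenNum.sqrt z) := by
  obtain ⟨h, rfl⟩ := hr
  exact ⟨_, rfl⟩

/-- Invertible generalized numbers are bounded below by a power of `ε`. -/
theorem IsRep.exists_lower {r : Idx → 𝕜} {z : GenNum 𝕜} (hr : IsRep r z) (hz : IsUnit z) :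
    ∃ (N : ℕ) (c : ℝ), 0 < c ∧ ∀ᶠ ε : Idx in near0, c * (ε : ℝ) ^ (N : ℝ) ≤ ‖r ε‖ := by
  obtain ⟨h, rfl⟩ := hr
  obtain ⟨w, hw⟩ := hz.exists_right_inv
  obtain ⟨s, rfl⟩ := mk_surjective w
  rw [← map_mul, ← map_one mk, mk_eq_mk] at hw
  -- Order one of the negligible net `r s - 1` suffices: for `ε ≤ 1/(2C)` it is at most `1/2`. Then
  -- `|r||s| ≥ 1/2`, and the moderate bound on `s` becomes a lower bound on `r`.
  obtain ⟨C, hC, hb⟩ := (hw 1).exists_pos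
  obtain ⟨N, hN⟩ := s.2
  obtain ⟨D, hD, hd⟩ := hN.exists_pos
  refine ⟨N, 1 / (2 * D), by positivity, ?_⟩
  filter_upwards [hb.bound, hd.bound, eventually_le_near0 (η := 1 / (2 * C)) (by positivity)]
    with ε h1 h2 h3
  have h0 := ε.2.1
  have hp : 0 < (ε : ℝ) ^ (N : ℝ) := Real.rpow_pos_of_pos h0 _
  rw [norm_norm, Real.norm_of_nonneg (Real.rpow_nonneg h0.le _)] at h1 h2
  rw [Nat.cast_one, Real.rpow_one] at h1
  rw [Real.rpow_neg h0.le] at h2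
  have h4 : C * ε ≤ 1 / 2 := by
    refine (mul_le_mul_of_nonneg_left h3 hC.le).trans_eq ?_
    field_simp
  have h5 : (1 : ℝ) ≤ ‖r ε‖ * ‖(s : Idx → 𝕜) ε‖ + 1 / 2 := by
    have e : (1 : 𝕜) = r ε * (s : Idx → 𝕜) ε - (r ε * (s : Idx → 𝕜) ε - 1) := by ring
    have h6 : ‖(1 : 𝕜)‖ ≤ ‖r ε * (s : Idx → 𝕜) ε‖ + ‖r ε * (s : Idx → 𝕜) ε - 1‖ := by
      conv_lhs => rw [e]
      exact norm_sub_le _ _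
    rw [norm_one, norm_mul] at h6
    exact h6.trans (add_le_add le_rfl (h1.trans h4))
  have h7 : 1 / 2 ≤ ‖r ε‖ * (D * ((ε : ℝ) ^ (N : ℝ))⁻¹) := by
    linarith [mul_le_mul_of_nonneg_left h2 (norm_nonneg (r ε))]
  have h8 := mul_le_mul_of_nonneg_right h7 (mul_pos (inv_pos.2 hD) hp).le
  refine le_trans (le_of_eq ?_) (h8.trans_eq ?_) <;> field_simp

end GenNum

theorem IsRepresentative.polyD {m : ℕ} {P : MvPolynomial (Fin n) (GenNum ℂ)}
    {Pnet : Idx → MvPolynomial (Fin n) ℂ} (h : IsRepresentative m P Pnet) (α : Fin n → ℕ) :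
    IsRepresentative m (polyD α P) fun ε => polyD α (Pnet ε) := by
  refine ⟨fun ε => totalDegree_polyD_le (h.1 ε) α, fun s => ?_⟩
  simp_rw [coeff_polyD]
  exact (GenNum.isRep_natCast _).mul (h.2 _)

theorem IsRepresentative.eval {m : ℕ} {P : MvPolynomial (Fin n) (GenNum ℂ)}
    (hP : P.totalDegree ≤ m) {Pnet : Idx → MvPolynomial (Fin n) ℂ}
    (h : IsRepresentative m P Pnet) (z : Fin n → ℂ) :
    GenNum.IsRep (fun ε => MvPolynomial.eval z (Pnet ε))
      (MvPolynomial.eval (fun i => GenNum.const (z i)) P) := by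
  have e : (fun ε => MvPolynomial.eval z (Pnet ε)) = fun ε => ∑ α ∈ multiIdx n m,
      (Pnet ε).coeff (Finsupp.equivFunOnFinite.symm α) * ∏ i, z i ^ α i :=
    funext fun ε => eval_eq_sum_multiIdx (h.1 ε) z
  rw [e, eval_eq_sum_multiIdx hP]
  refine GenNum.IsRep.sum _ fun α _ => (h.2 _).mul ?_
  simp_rw [← map_pow, ← map_prod]
  exact GenNum.isRep_const _

theorem IsRepresentative.weight {m : ℕ} {P : MvPolynomial (Fin n) (GenNum ℂ)}
    (hP : P.totalDegree ≤ m) {Pnet : Idx → MvPolynomial (Fin n) ℂ}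
    (h : IsRepresentative m P Pnet) (ξ : Sp n) :
    GenNum.IsRep (fun ε => weight m (Pnet ε) ξ) (genWeight m P ξ) :=
  (GenNum.IsRep.sum _ fun α _ =>
    (((h.polyD α).eval (totalDegree_polyD_le hP α) fun i => (ξ i : ℂ)).abs.pow 2)).sqrt

/-- Representatives of the coefficients are chosen independently. The sum is truncated to `multiIdx
n m` because vanishing coefficients may have received nonzero negligible nets, which would spoil the
degree bound. -/
theorem exists_isRepresentative {m : ℕ} {P : MvPolynomial (Fin n) (GenNum ℂ)}
    (hP : P.totalDegree ≤ m) : ∃ Pnet, IsRepresentative m P Pnet := by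
  choose r hr using fun α => GenNum.mk_surjective (P.coeff α)
  have hc : ∀ ε s, (∑ α ∈ multiIdx n m,
      MvPolynomial.monomial (Finsupp.equivFunOnFinite.symm α)
        ((r (Finsupp.equivFunOnFinite.symm α) : Idx → ℂ) ε)).coeff s =
      if ∑ i, s i ≤ m then (r s : Idx → ℂ) ε else 0 := by
    intro ε s
    rw [MvPolynomial.coeff_sum]
    simp_rw [MvPolynomial.coeff_monomial]
    split_ifs with hs
    · rw [Finset.sum_eq_single_of_mem (s : Fin n → ℕ) (mem_multiIdx.2 hs)]
      · simp
      · intro α _ hα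
        rw [if_neg]
        rintro rfl
        exact hα (by ext; simp)
    · refine Finset.sum_eq_zero fun α hα => if_neg ?_
      rintro rfl
      exact hs (by simpa using mem_multiIdx.1 hα)
  refine ⟨fun ε => ∑ α ∈ multiIdx n m, MvPolynomial.monomial (Finsupp.equivFunOnFinite.symm α)
    ((r (Finsupp.equivFunOnFinite.symm α) : Idx → ℂ) ε), fun ε => ?_, fun s => ?_⟩
  · refine totalDegree_le_iff_coeff.2 fun s hs => ?_
    rw [hc, if_neg (not_le.2 hs)]
  · simp_rw [hc]
    by_cases hs : ∑ i, s i ≤ m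
    · simp_rw [if_pos hs]
      exact ⟨(r s).2, hr s⟩
    · simp_rw [if_neg hs]
      rw [totalDegree_le_iff_coeff.1 hP s (not_le.1 hs)]
      simpa using GenNum.isRep_natCast (𝕜 := ℂ) 0

/-! ### The transposed operator on representatives -/

/-- The operator `D^α` on moderate nets. -/
def netDpow (α : Fin n →₀ ℕ) : Module.End (ModNet ℂ) (EcM n) :=
  ((List.finRange n).map fun i => (netD i : Module.End (ModNet ℂ) (EcM n)) ^ α i).prod

theorem netD_pow_apply (i : Fin n) (k : ℕ) (f : EcM n) (ε : Idx) :
    ((((netD i : Module.End (ModNet ℂ) (EcM n)) ^ k) f : EcM n) : Idx → Test n) ε =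
      (testD i ^ k) ((f : Idx → Test n) ε) := by
  induction k with
  | zero => rfl
  | succ k ih =>
    rw [pow_succ', pow_succ', Module.End.mul_apply, Module.End.mul_apply, ← ih]
    rfl

theorem netDpow_apply (α : Fin n →₀ ℕ) (f : EcM n) (ε : Idx) :
    ((netDpow α f : EcM n) : Idx → Test n) ε = testDpow α ((f : Idx → Test n) ε) := by
  rw [netDpow, testDpow]
  induction List.finRange n with
  | nil => rfl
  | cons i l ih =>
    rw [List.map_cons, List.prod_cons, Module.End.mul_apply, netD_pow_apply, ih, List.map_cons,
      List.prod_cons, Module.End.mul_apply]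

theorem Gc.D_pow_mk (i : Fin n) (k : ℕ) (f : EcM n) :
    (Gc.D i ^ k) (Gc.mk f) = Gc.mk (((netD i : Module.End (ModNet ℂ) (EcM n)) ^ k) f) := by
  induction k with
  | zero => rfl
  | succ k ih =>
    rw [pow_succ', pow_succ', Module.End.mul_apply, Module.End.mul_apply, ih]
    rfl

theorem Gc.Dpow_mk (α : Fin n →₀ ℕ) (f : EcM n) :
    Gc.Dpow α (Gc.mk f) = Gc.mk (netDpow α f) := by
  rw [netDpow, Gc.Dpow]
  induction List.finRange n with
  | nil => rfl
  | cons i l ih =>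
    rw [List.map_cons, List.prod_cons, Module.End.mul_apply, ih, Gc.D_pow_mk, List.map_cons,
      List.prod_cons, Module.End.mul_apply]

theorem Gc.mk_sum {ι : Type} (t : Finset ι) (f : ι → EcM n) :
    Gc.mk (∑ i ∈ t, f i) = ∑ i ∈ t, Gc.mk (f i) :=
  map_sum (AddMonoidHom.mk' Gc.mk Gc.mk_add) f t

theorem transposeD_eq_sum {m : ℕ} {P : MvPolynomial (Fin n) (GenNum ℂ)} (hP : P.totalDegree ≤ m) :
    transposeD P = ∑ α ∈ multiIdx n m,
      (P.coeff (Finsupp.equivFunOnFinite.symm α) * (-1) ^ ∑ i, α i) •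
        Gc.Dpow (Finsupp.equivFunOnFinite.symm α) := by
  rw [transposeD, sum_support_eq_sum_multiIdx hP fun s a => (a * (-1) ^ s.degree) • Gc.Dpow s]
  · simp [Finsupp.degree_eq_sum]
  · simp

theorem exists_transposeD_mk {m : ℕ} {P : MvPolynomial (Fin n) (GenNum ℂ)}
    (hP : P.totalDegree ≤ m) {Pnet : Idx → MvPolynomial (Fin n) ℂ}
    (h : IsRepresentative m P Pnet) (f : EcM n) : ∃ F : EcM n, transposeD P (Gc.mk f) = Gc.mk F ∧
      ∀ ε, (F : Idx → Test n) ε = testTranspose m (Pnet ε) ((f : Idx → Test n) ε) := by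
  choose hm hr using h.2
  refine ⟨∑ α ∈ multiIdx n m, ((⟨_, hm (Finsupp.equivFunOnFinite.symm α)⟩ : ModNet ℂ) *
    (-1) ^ ∑ i, α i) • netDpow (Finsupp.equivFunOnFinite.symm α) f, ?_, fun ε => ?_⟩
  · rw [transposeD_eq_sum hP, LinearMap.sum_apply, Gc.mk_sum]
    refine Finset.sum_congr rfl fun α _ => ?_
    rw [LinearMap.smul_apply, Gc.Dpow_mk, Gc.mk_smul, map_mul, hr, map_pow, map_neg, map_one]
  · rw [testTranspose, LinearMap.sum_apply, AddSubmonoidClass.coe_finsetSum, Finset.sum_apply]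
    refine Finset.sum_congr rfl fun α _ => ?_
    rw [LinearMap.smul_apply, ← netDpow_apply]
    rfl

/-! ### Nets of fundamental solutions -/

theorem exists_le_of_eventually_near0 {p : Idx → Prop} (h : ∀ᶠ ε in near0, p ε) :
    ∃ η : ℝ, 0 < η ∧ η ≤ 1 ∧ ∀ ε : Idx, (ε : ℝ) ≤ η → p ε := by
  obtain ⟨t, ht, hp⟩ := mem_comap.1 h
  obtain ⟨r, hr, hb⟩ := Metric.mem_nhds_iff.1 ht
  refine ⟨min (r / 2) 1, by positivity, min_le_right _ _, fun ε hε => hp (hb ?_)⟩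
  rw [Metric.mem_ball, Real.dist_eq, sub_zero, abs_of_pos ε.2.1]
  linarith [hε.trans (min_le_left _ _)]

theorem exists_fundamental_net (n m : ℕ) {c : ℝ} (hc : 0 < c) :
    ∃ C₀ : ℝ, ∀ P : MvPolynomial (Fin n) (GenNum ℂ), P.totalDegree ≤ m →
      (∃ ξ₀ : Sp n, IsUnit (genWeight m P ξ₀)) →
      ∀ Pnet : Idx → MvPolynomial (Fin n) ℂ, IsRepresentative m P Pnet →
        ∃ (E : Gc n →L[GenNum ℂ] GenNum ℂ) (Enet : Idx → Distr n),
          IsFundamentalSolution P E ∧ IsGivenBy E Enet ∧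
          ∀ ε, ∃ w : 𝓢'(Sp n, ℂ), IsDivCosh c (Enet ε) w ∧ MemB ⊤ (weight m (Pnet ε)) w ∧
            normB ⊤ (weight m (Pnet ε)) w ≤ ENNReal.ofReal C₀ := by
  -- Any positive `ρ` with `n * ρ < c` would do; the `+ 1` covers `n = 0`. Fixing `ρ` before `P`
  -- makes `κ` and `C₀` depend on `n`, `m` and `c` only.
  set ρ : ℝ := c / (n + 1) with hρ
  have hρ0 : 0 < ρ := by positivity
  have hnρ : n * ρ < c := by
    rw [hρ, mul_div_assoc', div_lt_iff₀ (by positivity)]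
    linarith
  obtain ⟨κ, hκ, hcircle⟩ := exists_measurable_circle n m hρ0
  obtain ⟨C₀, hdiv⟩ := exists_isDivCosh_solDistr n m (κ := κ) hc hnρ
  refine ⟨C₀, fun P hP ⟨ξ₀, hξ₀⟩ Pnet hrep => ?_⟩
  have hex : ∀ ε, ∃ T : Distr n,
      (Pnet ε ≠ 0 → ∃ (θ : _) (h : IsCircleChoice m (Pnet ε) ρ κ θ), T = solDistr h) ∧
      ∃ w : 𝓢'(Sp n, ℂ), IsDivCosh c T w ∧ MemB ⊤ (weight m (Pnet ε)) w ∧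
            normB ⊤ (weight m (Pnet ε)) w ≤ ENNReal.ofReal C₀ := by
    intro ε
    -- For `ε` away from zero `P_ε` may vanish. Only the norm bound is required there, and the zero
    -- distribution satisfies it.
    by_cases h0 : Pnet ε = 0
    · have hF : HasFourierFun (0 : 𝓢'(Sp n, ℂ)) fun _ => 0 :=
        ⟨locallyIntegrable_zero, fun φ _ => by simp⟩
      have hn : normB ⊤ (weight m (Pnet ε)) (0 : 𝓢'(Sp n, ℂ)) ≤ 0 :=
        (iInf₂_le _ hF).trans_eq (by simp only [mul_zero, eLpNorm_zero'])
      exact ⟨0, fun h => absurd h0 h, 0, fun f => rfl, ⟨⟨_, hF⟩, hn.trans_lt ENNReal.zero_lt_top⟩,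
        hn.trans zero_le⟩
    · obtain ⟨θ, hθ, hb, hl⟩ := hcircle (Pnet ε) (hrep.1 ε) h0
      have h : IsCircleChoice m (Pnet ε) ρ κ θ := ⟨hrep.1 ε, h0, hκ, hθ, hb, hl⟩
      exact ⟨solDistr h, fun _ => ⟨θ, h, rfl⟩, hdiv _ θ h⟩
  choose Enet hE hw using hex
  obtain ⟨N, c', hc', hlow⟩ := (hrep.weight hP ξ₀).exists_lower hξ₀
  have hne : ∀ ε : Idx, c' * (ε : ℝ) ^ (N : ℝ) ≤ ‖weight m (Pnet ε) ξ₀‖ → Pnet ε ≠ 0 := by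
    intro ε hε h0
    rw [h0] at hε
    have : weight m (0 : MvPolynomial (Fin n) ℂ) ξ₀ = 0 := by simp [weight, polyD]
    rw [this, norm_zero] at hε
    exact (mul_pos hc' (Real.rpow_pos_of_pos ε.2.1 _)).not_ge hε
  have hmod : ModDistr Enet := by
    intro K hK
    obtain ⟨C, hC⟩ := exists_norm_solFun_le m ρ κ ξ₀ hK
    obtain ⟨η, hη, hη1, H⟩ := exists_le_of_eventually_near0 hlow
    -- Replacing `C` by `|C| + 1` makes the constant positive, as `ModDistr` demands.
    refine ⟨m + n + 1, (|C| + 1) / c', N, η, by positivity, hη, hη1, fun f hf ε hε => ?_⟩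
    have h1 := H ε hε
    obtain ⟨θ, h, hT⟩ := hE ε (hne ε h1)
    rw [Real.norm_of_nonneg (weight_nonneg _ _ _)] at h1
    have hp : 0 < (ε : ℝ) ^ (N : ℝ) := Real.rpow_pos_of_pos ε.2.1 _
    rw [hT, solDistr_apply]
    refine (hC _ θ h f hf).trans (mul_le_mul_of_nonneg_right ?_ (semi_nonneg _ _ _))
    rw [Real.rpow_neg ε.2.1.le, ← div_eq_mul_inv, div_div]
    exact div_le_div₀ (by positivity) (by linarith [le_abs_self C]) (by positivity) h1
  refine ⟨⟨ofNet Enet hmod, continuous_ofNet Enet hmod⟩, Enet, ?_, ⟨hmod, rfl⟩, hw⟩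
  refine LinearMap.ext fun u => ?_
  obtain ⟨f, rfl⟩ := Gc.mk_surjective u
  obtain ⟨F, hF, hFε⟩ := exists_transposeD_mk hP hrep f
  change ofNet Enet hmod (transposeD P (Gc.mk f)) = iotaDelta n (Gc.mk f)
  rw [hF, iotaDelta, ofNet_mk, ofNet_mk, GenNum.mk_eq_mk]
  -- For small `ε` the two representatives coincide exactly.
  refine Negligible.zero.mono ?_
  filter_upwards [hlow] with ε hε
  obtain ⟨θ, h, hT⟩ := hE ε (hne ε hε)
  have : Enet ε ((F : Idx → Test n) ε) = dirac n ((f : Idx → Test n) ε) := by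
    rw [hFε, hT, solDistr_transpose]
    rfl
  simp only [this, sub_self, norm_zero, abs_zero, le_refl]

end Colombeau

end

/-- Operators `P(D)` of order at most `m` on `ℝⁿ` with coefficients in `ℂ~` correspond to
polynomials `P` of degree at most `m` over `ℂ~`. -/
theorem mainTheorem1 (n m : ℕ) :
    (∀ P : MvPolynomial (Fin n) (GenNum ℂ), P.totalDegree ≤ m →
      (∃ ξ₀ : EuclideanSpace ℝ (Fin n), IsUnit (genWeight m P ξ₀)) →
      ∃ E : Gc n →L[GenNum ℂ] GenNum ℂ, IsBasic E ∧ IsFundamentalSolution P E) ∧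
    ∀ c : ℝ, 0 < c → ∃ C₀ : ℝ, ∀ P : MvPolynomial (Fin n) (GenNum ℂ), P.totalDegree ≤ m →
      (∃ ξ₀ : EuclideanSpace ℝ (Fin n), IsUnit (genWeight m P ξ₀)) →
      ∀ Pnet : Set.Ioc (0 : ℝ) 1 → MvPolynomial (Fin n) ℂ, IsRepresentative m P Pnet →
        ∃ (E : Gc n →L[GenNum ℂ] GenNum ℂ) (Enet : Set.Ioc (0 : ℝ) 1 → Distr n),
          IsFundamentalSolution P E ∧ IsGivenBy E Enet ∧
          ∀ ε, ∃ w : TemperedDistribution (EuclideanSpace ℝ (Fin n)) ℂ,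
            IsDivCosh c (Enet ε) w ∧ MemB ⊤ (weight m (Pnet ε)) w ∧
              normB ⊤ (weight m (Pnet ε)) w ≤ ENNReal.ofReal C₀ := by
  refine ⟨fun P hP hξ => ?_, fun c hc => exists_fundamental_net n m hc⟩
  -- Any positive `c` would do for existence alone; `1` is taken.
  obtain ⟨C₀, h⟩ := exists_fundamental_net n m one_pos
  obtain ⟨Pnet, hrep⟩ := exists_isRepresentative hP
  obtain ⟨E, Enet, hE, hgiven, -⟩ := h P hP hξ Pnet hrep
  exact ⟨E, ⟨Enet, hgiven⟩, hE⟩
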